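/- Let $(X,g)$ be a Kähler manifold (Hausdorff, second countable), with fundamental form $\omega(v,w)=g(Jv,w)$ and Riemannian volume $dV$. Let $\Lambda$ be the adjoint of wedging with $\omega$. Let $\mathbb V\to X$ be a flat complex vector bundle with flat connection $D=d'+d''$, split into its parts of type $(1,0)$ and $(0,1)$. Let $K=\langle\cdot,\cdot\rangle_K$ be a smooth Hermitian metric on $\mathbb V$. Define $\delta',\delta''$ by $$\partial\langle u,v\rangle_K=\langle\delta'u,v\rangle_K+\langle u,d''v\rangle_K,\qquad \bar\partial\langle u,v\rangle_K=\langle\delta''u,v\rangle_K+\langle u,d'v\rangle_K ,$$ and put $\theta_K=(d'-\delta')/2$, $\bar\theta_K=(d''-\delta'')/2$, $\bar\partial_K=(d''+\delta'')/2$, $D''_K=\bar\partial_K+\theta_K$ and $G_K=(D''_K)^2$. For a measurable set $A\subseteq X$ let $$E_A(K)=\int_A|\theta_K+\bar\theta_K|^2\,dV$$ be the energy of $K$ on $A$, where the norm is induced by $g$ and $K$. For a smooth $K$-self-adjoint endomorphism $h$ of $\mathbb V$ with compact support let $K_t$, $t\in\mathbb R$, be given by $\langle u,v\rangle_{K_t}=\langle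 \exp(th)u,v\rangle_K$. Call $K$ a critical point of the energy if for every such $h$, and every measurable $A$ that contains the support of $h$ and on which $|\theta_K+\bar\theta_K|^2$ is integrable, the function $t\mapsto E_A(K_t)$ has derivative $0$ at $t=0$. Then: 1. The energy density $|\theta_K+\bar\theta_K|^2$ is locally integrable. For all $h$ and $A$ as above, each $K_t$ is a smooth Hermitian metric, and $t\mapsto E_A(K_t)$ is differentiable at $t=0$ with $$\frac{d}{dt}E_A(K_t)\Big|_{t=0}=-\int_X\big\langle \sqrt{-1}\,\Lambda(d''\theta_K-d'\bar\theta_K),\,h\big\rangle_K\,dV .$$ 2. $K$ is a critical point of the energy if and only if it satisfies the Euler–Lagrange equation $$\sqrt{-1}\,\Lambda(d''\theta_K-d'\bar\theta_K)=0 .$$ 3. This equation holds if and only if $\Lambda G_K=0$, i.e. if and only if $K$ is a harmonic metric. -/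

import Mathlib

open scoped Manifold ContDiff Topology Matrix
open Set MeasureTheory Bundle

noncomputable section

namespace FlatKahler

/-- The model space `ℂ^m`; multiplication by `Complex.I` is its complex structure. -/
abbrev Cm (m : ℕ) := EuclideanSpace ℂ (Fin m)

/-! ### Calculus of forms on open sets of `ℂ^m`

A `0`-form with values in `W` is a function `ℂ^m → W`, a `1`-form is a function
`α : ℂ^m → ℂ^m → W`, real linear in its second argument (the tangent vector), and a `2`-form is a
function `β : ℂ^m → ℂ^m → ℂ^m → W`, alternating and real bilinear in the last two arguments. -/

section Calculus

variable {m : ℕ} {W : Type*} [NormedAddCommGroup W] [NormedSpace ℂ W]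

/-- `(∂f)_z(v) = (df(v) - i df(iv)) / 2`. -/
def del (f : Cm m → W) (z v : Cm m) : W :=
  (1 / 2 : ℂ) • (fderiv ℝ f z v - Complex.I • fderiv ℝ f z (Complex.I • v))

/-- `(∂̄f)_z(v) = (df(v) + i df(iv)) / 2`. -/
def delbar (f : Cm m → W) (z v : Cm m) : W :=
  (1 / 2 : ℂ) • (fderiv ℝ f z v + Complex.I • fderiv ℝ f z (Complex.I • v))

/-- The operator `∂` on `1`-forms (evaluated on constant vector fields `v`, `w`). -/
def del₁ (α : Cm m → Cm m → W) (z v w : Cm m) : W :=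
  del (fun y => α y w) z v - del (fun y => α y v) z w

/-- The operator `∂̄` on `1`-forms (evaluated on constant vector fields `v`, `w`). -/
def delbar₁ (α : Cm m → Cm m → W) (z v w : Cm m) : W :=
  delbar (fun y => α y w) z v - delbar (fun y => α y v) z w

end Calculus

section MatrixCalculus

variable {m n : ℕ}

/-- `∂` of a matrix of functions, entry by entry. -/
def delM (M : Cm m → Matrix (Fin n) (Fin n) ℂ) (z v : Cm m) : Matrix (Fin n) (Fin n) ℂ :=
  Matrix.of fun i j => del (fun y => M y i j) z v

/-- `∂̄` of a matrix of functions, entry by entry. -/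
def delbarM (M : Cm m → Matrix (Fin n) (Fin n) ℂ) (z v : Cm m) : Matrix (Fin n) (Fin n) ℂ :=
  Matrix.of fun i j => delbar (fun y => M y i j) z v

/-- `∂` of a matrix of `1`-forms, entry by entry. -/
def delM₁ (α : Cm m → Cm m → Matrix (Fin n) (Fin n) ℂ) (z v w : Cm m) :
    Matrix (Fin n) (Fin n) ℂ :=
  Matrix.of fun i j => del₁ (fun y u => α y u i j) z v w

/-- `∂̄` of a matrix of `1`-forms, entry by entry. -/
def delbarM₁ (α : Cm m → Cm m → Matrix (Fin n) (Fin n) ℂ) (z v w : Cm m) :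
    Matrix (Fin n) (Fin n) ℂ :=
  Matrix.of fun i j => delbar₁ (fun y u => α y u i j) z v w

end MatrixCalculus

/-! ### The operators attached to a Hermitian metric, in a flat frame

In a flat frame `v_1, …, v_n` a section is a function `u` with values in `ℂ^n`, the flat connection
is `D = d' + d'' = ∂ + ∂̄`, and a Hermitian metric is its Gram matrix `G`, `G i j = ⟨v_j, v_i⟩`, so
that `⟨u, w⟩ = w* G u`. -/

section Frame

variable {m n : ℕ}

/-- The pairing `⟨u, w⟩ = w* G u`, linear in `u` and conjugate linear in `w`. -/
def herm (G : Matrix (Fin n) (Fin n) ℂ) (u w : Fin n → ℂ) : ℂ := star w ⬝ᵥ (G *ᵥ u)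

/-- The operator `δ'`: `∂⟨u, w⟩ = ⟨δ'u, w⟩ + ⟨u, d''w⟩`, see `del_herm`. -/
def deltaP (G : Cm m → Matrix (Fin n) (Fin n) ℂ) (u : Cm m → Fin n → ℂ) (z v : Cm m) :
    Fin n → ℂ :=
  del u z v + ((G z)⁻¹ * delM G z v) *ᵥ u z

/-- The operator `δ''`: `∂̄⟨u, w⟩ = ⟨δ''u, w⟩ + ⟨u, d'w⟩`, see `delbar_herm`. -/
def deltaPP (G : Cm m → Matrix (Fin n) (Fin n) ℂ) (u : Cm m → Fin n → ℂ) (z v : Cm m) :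
    Fin n → ℂ :=
  delbar u z v + ((G z)⁻¹ * delbarM G z v) *ᵥ u z

/-- The extension of `δ''` to `1`-forms with values in the bundle. -/
def deltaPP₁ (G : Cm m → Matrix (Fin n) (Fin n) ℂ) (α : Cm m → Cm m → Fin n → ℂ)
    (z v w : Cm m) : Fin n → ℂ :=
  delbar₁ α z v w + (((G z)⁻¹ * delbarM G z v) *ᵥ α z w - ((G z)⁻¹ * delbarM G z w) *ᵥ α z v)

/-- `θ = (d' - δ') / 2`, a `1`-form of type `(1,0)` with values in the endomorphisms; column `j` of
its matrix is `θ v_j`. See `theta_mulVec` for the action on all sections. -/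
def theta (G : Cm m → Matrix (Fin n) (Fin n) ℂ) (z v : Cm m) : Matrix (Fin n) (Fin n) ℂ :=
  Matrix.of fun i j => (1 / 2 : ℂ) *
    (del (fun _ => (Pi.single j 1 : Fin n → ℂ)) z v i -
      deltaP G (fun _ => (Pi.single j 1 : Fin n → ℂ)) z v i)

/-- `θ̄ = (d'' - δ'') / 2`, a `1`-form of type `(0,1)` with values in the endomorphisms. -/
def thetaBar (G : Cm m → Matrix (Fin n) (Fin n) ℂ) (z v : Cm m) : Matrix (Fin n) (Fin n) ℂ :=
  Matrix.of fun i j => (1 / 2 : ℂ) *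
    (delbar (fun _ => (Pi.single j 1 : Fin n → ℂ)) z v i -
      deltaPP G (fun _ => (Pi.single j 1 : Fin n → ℂ)) z v i)

theorem theta_eq (G : Cm m → Matrix (Fin n) (Fin n) ℂ) (z v : Cm m) :
    theta G z v = (-(1 / 2) : ℂ) • ((G z)⁻¹ * delM G z v) := by
  ext i j
  simp [theta, deltaP]

theorem thetaBar_eq (G : Cm m → Matrix (Fin n) (Fin n) ℂ) (z v : Cm m) :
    thetaBar G z v = (-(1 / 2) : ℂ) • ((G z)⁻¹ * delbarM G z v) := by
  ext i j
  simp [thetaBar, deltaPP]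

/-- `θ u = (d'u - δ'u) / 2` for all sections `u`. -/
theorem theta_mulVec (G : Cm m → Matrix (Fin n) (Fin n) ℂ) (u : Cm m → Fin n → ℂ) (z v : Cm m) :
    theta G z v *ᵥ u z = (1 / 2 : ℂ) • (del u z v - deltaP G u z v) := by
  rw [theta_eq, Matrix.smul_mulVec, deltaP, sub_add_cancel_left, smul_neg, neg_smul]

/-- `θ̄ u = (d''u - δ''u) / 2` for all sections `u`. -/
theorem thetaBar_mulVec (G : Cm m → Matrix (Fin n) (Fin n) ℂ) (u : Cm m → Fin n → ℂ)
    (z v : Cm m) :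
    thetaBar G z v *ᵥ u z = (1 / 2 : ℂ) • (delbar u z v - deltaPP G u z v) := by
  rw [thetaBar_eq, Matrix.smul_mulVec, deltaPP, sub_add_cancel_left, smul_neg, neg_smul]

theorem herm_eq (G : Matrix (Fin n) (Fin n) ℂ) (u w : Fin n → ℂ) :
    herm G u w = ∑ i, ∑ j, star (w i) * (G i j * u j) := by
  simp [herm, dotProduct, Matrix.mulVec, Finset.mul_sum]

theorem fderiv_herm {G : Cm m → Matrix (Fin n) (Fin n) ℂ} {u w : Cm m → Fin n → ℂ}
    {z : Cm m} (hG : ∀ i j, DifferentiableAt ℝ (fun y => G y i j) z)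
    (hu : DifferentiableAt ℝ u z) (hw : DifferentiableAt ℝ w z) (v : Cm m) :
    fderiv ℝ (fun y => herm (G y) (u y) (w y)) z v =
      herm (G z) (fderiv ℝ u z v) (w z) +
      herm (Matrix.of fun i j => fderiv ℝ (fun y => G y i j) z v) (u z) (w z) +
      herm (G z) (u z) (fderiv ℝ w z v) := by
  have h1 : ∀ i, HasFDerivAt (fun y => u y i) _ z := hasFDerivAt_pi'.1 hu.hasFDerivAt
  have h2 : ∀ i, HasFDerivAt (fun y => w y i) _ z := hasFDerivAt_pi'.1 hw.hasFDerivAt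
  have h3 := HasFDerivAt.fun_sum (u := Finset.univ) fun i _ =>
    HasFDerivAt.fun_sum (u := Finset.univ) fun j _ =>
      (h2 i).star.mul ((hG i j).hasFDerivAt.mul (h1 j))
  have h4 := h3.congr_of_eventuallyEq (f₁ := fun y => herm (G y) (u y) (w y))
    (Filter.Eventually.of_forall fun y => herm_eq _ _ _)
  rw [h4.fderiv]
  simp only [herm_eq, Matrix.of_apply, sum_apply, ← Finset.sum_add_distrib]
  refine Finset.sum_congr rfl fun i _ => Finset.sum_congr rfl fun j _ => ?_
  simp
  ring

/-- The defining property of `δ'`: `∂⟨u, w⟩ = ⟨δ'u, w⟩ + ⟨u, d''w⟩`. -/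
theorem del_herm {G : Cm m → Matrix (Fin n) (Fin n) ℂ} {u w : Cm m → Fin n → ℂ}
    {z : Cm m} (hdet : IsUnit (G z).det)
    (hG : ∀ i j, DifferentiableAt ℝ (fun y => G y i j) z)
    (hu : DifferentiableAt ℝ u z) (hw : DifferentiableAt ℝ w z) (v : Cm m) :
    del (fun y => herm (G y) (u y) (w y)) z v =
      herm (G z) (deltaP G u z v) (w z) + herm (G z) (u z) (delbar w z v) := by
  have h : herm (G z) (deltaP G u z v) (w z) =
      herm (G z) (del u z v) (w z) + herm (delM G z v) (u z) (w z) := by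
    simp only [herm, deltaP, Matrix.mulVec_add, dotProduct_add, Matrix.mulVec_mulVec,
      Matrix.mul_nonsing_inv_cancel_left _ _ hdet]
  rw [h, del, fderiv_herm hG hu hw, fderiv_herm hG hu hw]
  simp only [herm_eq, del, delbar, delM, Matrix.of_apply, Pi.smul_apply, Pi.add_apply,
    Pi.sub_apply, smul_eq_mul, Finset.mul_sum, ← Finset.sum_add_distrib,
    ← Finset.sum_sub_distrib]
  refine Finset.sum_congr rfl fun i _ => Finset.sum_congr rfl fun j _ => ?_
  simp only [star_mul', star_add, Complex.star_def, Complex.conj_I, map_div₀, map_one, map_ofNat]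
  ring

/-- The defining property of `δ''`: `∂̄⟨u, w⟩ = ⟨δ''u, w⟩ + ⟨u, d'w⟩`. -/
theorem delbar_herm {G : Cm m → Matrix (Fin n) (Fin n) ℂ} {u w : Cm m → Fin n → ℂ}
    {z : Cm m} (hdet : IsUnit (G z).det)
    (hG : ∀ i j, DifferentiableAt ℝ (fun y => G y i j) z)
    (hu : DifferentiableAt ℝ u z) (hw : DifferentiableAt ℝ w z) (v : Cm m) :
    delbar (fun y => herm (G y) (u y) (w y)) z v =
      herm (G z) (deltaPP G u z v) (w z) + herm (G z) (u z) (del w z v) := by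
  have h : herm (G z) (deltaPP G u z v) (w z) =
      herm (G z) (delbar u z v) (w z) + herm (delbarM G z v) (u z) (w z) := by
    simp only [herm, deltaPP, Matrix.mulVec_add, dotProduct_add, Matrix.mulVec_mulVec,
      Matrix.mul_nonsing_inv_cancel_left _ _ hdet]
  rw [h, delbar, fderiv_herm hG hu hw, fderiv_herm hG hu hw]
  simp only [herm_eq, del, delbar, delbarM, Matrix.of_apply, Pi.smul_apply, Pi.add_apply,
    Pi.sub_apply, smul_eq_mul, Finset.mul_sum, ← Finset.sum_add_distrib]
  refine Finset.sum_congr rfl fun i _ => Finset.sum_congr rfl fun j _ => ?_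
  simp only [star_mul', star_sub, Complex.star_def, Complex.conj_I, map_div₀, map_one, map_ofNat]
  ring

/-- The Higgs operator `D'' = ∂̄_K + θ` on sections, where `∂̄_K = (d'' + δ'') / 2`. -/
def higgs (G : Cm m → Matrix (Fin n) (Fin n) ℂ) (u : Cm m → Fin n → ℂ) (z v : Cm m) :
    Fin n → ℂ :=
  (1 / 2 : ℂ) • (delbar u z v + deltaPP G u z v) + theta G z v *ᵥ u z

/-- The Higgs operator `D'' = ∂̄_K + θ` on `1`-forms with values in the bundle. -/
def higgs₁ (G : Cm m → Matrix (Fin n) (Fin n) ℂ) (α : Cm m → Cm m → Fin n → ℂ)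
    (z v w : Cm m) : Fin n → ℂ :=
  (1 / 2 : ℂ) • (delbar₁ α z v w + deltaPP₁ G α z v w) +
    (theta G z v *ᵥ α z w - theta G z w *ᵥ α z v)

/-- The pseudo-curvature `G_K = (D'')²`, an operator from sections to `2`-forms with values in the
bundle. -/
def pseudoCurvature (G : Cm m → Matrix (Fin n) (Fin n) ℂ) (u : Cm m → Fin n → ℂ) :
    Cm m → Cm m → Cm m → Fin n → ℂ :=
  higgs₁ G (higgs G u)

/-- The adjoint of the endomorphism `A` with respect to the Hermitian form `G`. -/
def adj (G A : Matrix (Fin n) (Fin n) ℂ) : Matrix (Fin n) (Fin n) ℂ := G⁻¹ * Aᴴ * G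

end Frame

/-! ### Linear algebra of a Riemannian metric in coordinates -/

section Metric

variable {m n : ℕ}

/-- The real basis `e_k, i e_k` of `ℂ^m`. -/
def realBasis (m : ℕ) : Module.Basis (Fin 2 × Fin m) ℝ (Cm m) :=
  Complex.basisOneI.smulTower (EuclideanSpace.basisFun (Fin m) ℂ).toBasis

/-- The matrix `(g_ab)` of a bilinear form in the real basis. -/
def metricMatrix (g : Cm m → Cm m → ℝ) : Matrix (Fin 2 × Fin m) (Fin 2 × Fin m) ℝ :=
  Matrix.of fun a b => g (realBasis m a) (realBasis m b)

/-- The fundamental form `ω(v, w) = g(Jv, w)`. -/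
def fundamentalForm (g : Cm m → Cm m → ℝ) (v w : Cm m) : ℝ := g (Complex.I • v) w

/-- `Λ` on `2`-forms, the adjoint of `f ↦ f ω`: the pointwise inner product of `β` with the (real)
form `ω`, `Λβ = ⟨β, ω⟩ = (1/2) ∑ g^{ac} g^{bd} β_{ab} ω_{cd}`. -/
def Lam {W : Type*} [AddCommGroup W] [Module ℂ W] (g : Cm m → Cm m → ℝ)
    (β : Cm m → Cm m → W) : W :=
  (1 / 2 : ℂ) • ∑ a, ∑ b, ∑ c, ∑ d,
    (((metricMatrix g)⁻¹ a c * (metricMatrix g)⁻¹ b d *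
      fundamentalForm g (realBasis m c) (realBasis m d) : ℝ) : ℂ) •
      β (realBasis m a) (realBasis m b)

/-- The square of the norm of an endomorphism-valued `1`-form at a point,
`∑ g^{ab} tr (A_a A_b^*)`, with the adjoint taken with respect to the Hermitian form `G`. -/
def normSqForm (g : Cm m → Cm m → ℝ) (G : Matrix (Fin n) (Fin n) ℂ)
    (A : Cm m → Matrix (Fin n) (Fin n) ℂ) : ℝ :=
  ∑ a, ∑ b, (metricMatrix g)⁻¹ a b *
    (Matrix.trace (A (realBasis m a) * adj G (A (realBasis m b)))).re

/-- The left side `√-1 Λ (d''θ - d'θ̄)` of the Euler–Lagrange equation, in a flat frame with Gram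
matrix `G` and in coordinates with metric coefficients `g`. -/
def eulerLagrange (g : Cm m → Cm m → Cm m → ℝ) (G : Cm m → Matrix (Fin n) (Fin n) ℂ)
    (z : Cm m) : Matrix (Fin n) (Fin n) ℂ :=
  Complex.I • Lam (g z) (fun v w => delbarM₁ (theta G) z v w - delM₁ (thetaBar G) z v w)

end Metric

/-! ### Kähler manifolds -/

section Manifold

variable {m : ℕ} {X : Type*} [TopologicalSpace X] [ChartedSpace (Cm m) X]

/-- A complex manifold is a smooth real manifold. -/
instance instIsManifoldReal [h : IsManifold 𝓘(ℂ, Cm m) ω X] : IsManifold 𝓘(ℝ, Cm m) ω X := by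
  refine isManifold_of_contDiffOn _ _ _ fun e e' he he' => ?_
  have h1 := (contDiffGroupoid ω 𝓘(ℂ, Cm m)).compatible he he'
  have h2 := (contDiffGroupoid ω 𝓘(ℂ, Cm m)).compatible he' he
  have h3 := (contMDiffOn_iff_contDiffOn (𝕜 := ℂ)).1 (contMDiffOn_of_mem_contDiffGroupoid h1)
  have h4 := h3.restrict_scalars ℝ
  simpa using h4

variable [IsManifold 𝓘(ℂ, Cm m) ω X]

/-- The coefficients `g_z(v, w)`, in the coordinate chart `φ`, of a Riemannian metric on `X`. -/
def localMetric
    (g : ContMDiffRiemannianMetric 𝓘(ℝ, Cm m) ∞ (Cm m)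
      (fun x : X => TangentSpace 𝓘(ℝ, Cm m) x))
    (φ : OpenPartialHomeomorph X (Cm m)) (z v w : Cm m) : ℝ :=
  g.inner (φ.symm z) (mfderiv 𝓘(ℝ, Cm m) 𝓘(ℝ, Cm m) φ.symm z v)
    (mfderiv 𝓘(ℝ, Cm m) 𝓘(ℝ, Cm m) φ.symm z w)

variable (m X) in
/-- A Kähler metric on `X`: a smooth Riemannian metric which is invariant under the complex
structure and whose fundamental form `ω` is closed. -/
structure KahlerMetric where
  /-- the Riemannian metric -/
  metric : ContMDiffRiemannianMetric 𝓘(ℝ, Cm m) ∞ (Cm m)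
      (fun x : X => TangentSpace 𝓘(ℝ, Cm m) x)
  invariant : ∀ φ ∈ atlas (Cm m) X, ∀ z ∈ φ.target, ∀ v w : Cm m,
    localMetric metric φ z (Complex.I • v) (Complex.I • w) = localMetric metric φ z v w
  closed : ∀ φ ∈ atlas (Cm m) X, ∀ z ∈ φ.target, ∀ u v w : Cm m,
    fderiv ℝ (fun y => fundamentalForm (localMetric metric φ y) v w) z u +
      fderiv ℝ (fun y => fundamentalForm (localMetric metric φ y) w u) z v +
      fderiv ℝ (fun y => fundamentalForm (localMetric metric φ y) u v) z w = 0

/-- The coefficients of a Kähler metric in the chart `φ`. -/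
def KahlerMetric.coeff (g : KahlerMetric m X) (φ : OpenPartialHomeomorph X (Cm m)) :
    Cm m → Cm m → Cm m → ℝ :=
  localMetric g.metric φ

variable [MeasurableSpace X]

/-- The Riemannian measure of the domain of the chart `φ`, as a measure on `X`: it has the density
`√det (g_ab)` with respect to the Lebesgue measure in coordinates. -/
def KahlerMetric.chartVolume (g : KahlerMetric m X) (φ : OpenPartialHomeomorph X (Cm m)) :
    Measure X :=
  (((realBasis m).addHaar.restrict φ.target).withDensity fun z =>
    ENNReal.ofReal (Real.sqrt (metricMatrix (g.coeff φ z)).det)).map φ.symm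

/-- The Riemannian volume measure on `X`: the measure whose restriction to the domain of each chart
is the Riemannian measure of this chart, obtained as their least upper bound. -/
def KahlerMetric.volume (g : KahlerMetric m X) : Measure X :=
  ⨆ φ ∈ atlas (Cm m) X, g.chartVolume φ

end Manifold

/-! ### Flat bundles and Hermitian metrics -/

section Bundle

variable {m : ℕ} (n : ℕ) {X : Type*} [TopologicalSpace X]
  (V : X → Type*) [∀ x, AddCommGroup (V x)] [∀ x, Module ℂ (V x)]
  [∀ x, TopologicalSpace (V x)] [TopologicalSpace (TotalSpace (Fin n → ℂ) V)]
  [FiberBundle (Fin n → ℂ) V] [VectorBundle ℂ (Fin n → ℂ) V]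

/-- The local frames (over an open set) of a bundle with model fiber `ℂ^n`. -/
abbrev Frame := Trivialization (Fin n → ℂ) (TotalSpace.proj : TotalSpace (Fin n → ℂ) V → X)

/-- A flat vector bundle: a complex vector bundle whose transition functions are locally constant.
The trivializations of its atlas are its flat frames, and the flat connection `D` is the
connection for which these frames are parallel. -/
class IsFlatBundle : Prop where
  locally_constant : ∀ (e e' : Frame n V)
    [MemTrivializationAtlas e] [MemTrivializationAtlas e'], ∀ x ∈ e.baseSet ∩ e'.baseSet,
    ∀ᶠ y in 𝓝 x, ∀ w : Fin n → ℂ, (e' ⟨y, e.symm y w⟩).2 = (e' ⟨x, e.symm x w⟩).2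

variable {n V}

/-- The Gram matrix `G i j = ⟨v_j, v_i⟩` at `y` of a sesquilinear form on the fibers, in the frame
`v_1, …, v_n` given by the trivialization `e`. -/
def gram (K : ∀ x, V x →ₗ[ℂ] V x →ₗ⋆[ℂ] ℂ)
    (e : Frame n V) (y : X) : Matrix (Fin n) (Fin n) ℂ :=
  Matrix.of fun i j => K y (e.symm y (Pi.single j 1)) (e.symm y (Pi.single i 1))

/-- The matrix at `y` of an endomorphism field in the frame given by the trivialization `e`. -/
def endMatrix (h : ∀ x, V x →ₗ[ℂ] V x) (e : Frame n V) (y : X) :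
    Matrix (Fin n) (Fin n) ℂ :=
  Matrix.of fun i j => (e ⟨y, h y (e.symm y (Pi.single j 1))⟩).2 i

/-- The exponential of an endomorphism of a fiber, computed in a frame. -/
def fiberExp (x : X) (A : V x →ₗ[ℂ] V x) : V x →ₗ[ℂ] V x :=
  let L := (trivializationAt (Fin n → ℂ) V x).linearEquivAt ℂ x
    (FiberBundle.mem_baseSet_trivializationAt' x)
  L.symm.conj (Matrix.toLin' (NormedSpace.exp (LinearMap.toMatrix' (L.conj A))))

variable (n) in
/-- The form `⟨u, w⟩_{K_t} = ⟨exp(th) u, w⟩_K`. -/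
def expVariation (K : ∀ x, V x →ₗ[ℂ] V x →ₗ⋆[ℂ] ℂ) (h : ∀ x, V x →ₗ[ℂ] V x) (t : ℝ) :
    ∀ x, V x →ₗ[ℂ] V x →ₗ⋆[ℂ] ℂ :=
  fun x => (K x).comp (fiberExp (n := n) x ((t : ℂ) • h x))

variable [ChartedSpace (Cm m) X]

variable (m n) in
/-- `K` is a smooth Hermitian metric on the bundle. -/
structure IsHermitianMetric
    (K : ∀ x, V x →ₗ[ℂ] V x →ₗ⋆[ℂ] ℂ) : Prop where
  symm : ∀ x u w, K x w u = star (K x u w)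
  pos : ∀ x u, u ≠ 0 → 0 < (K x u u).re
  smooth : ∀ (e : Frame n V) [MemTrivializationAtlas e], ∀ i j,
    ContMDiffOn 𝓘(ℝ, Cm m) 𝓘(ℝ, ℂ) ∞ (fun x => gram K e x i j) e.baseSet

variable (m n) in
/-- `h` is an admissible direction of variation of `K`: a smooth field of endomorphisms which are
self-adjoint with respect to `K`, with compact support. -/
structure IsVariation
    (K : ∀ x, V x →ₗ[ℂ] V x →ₗ⋆[ℂ] ℂ) (h : ∀ x, V x →ₗ[ℂ] V x) : Prop where
  selfAdjoint : ∀ x u w, K x (h x u) w = K x u (h x w)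
  smooth : ∀ (e : Frame n V) [MemTrivializationAtlas e], ∀ i j,
    ContMDiffOn 𝓘(ℝ, Cm m) 𝓘(ℝ, ℂ) ∞ (fun x => endMatrix h e x i j) e.baseSet
  compactSupport : IsCompact (closure {x | h x ≠ 0})

/-- The Gram matrix of `K` in a frame, as a function of the coordinates of the chart `φ`. -/
def localGram (K : ∀ x, V x →ₗ[ℂ] V x →ₗ⋆[ℂ] ℂ)
    (e : Frame n V) (φ : OpenPartialHomeomorph X (Cm m)) (z : Cm m) : Matrix (Fin n) (Fin n) ℂ :=
  gram K e (φ.symm z)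

variable [IsManifold 𝓘(ℂ, Cm m) ω X]

variable (n) in
/-- The energy density `|θ_K + θ̄_K|²` at the point `x` (computed in the preferred chart and flat
frame at `x`; it does not depend on them). -/
def energyDensity (g : KahlerMetric m X)
    (K : ∀ x, V x →ₗ[ℂ] V x →ₗ⋆[ℂ] ℂ) (x : X) : ℝ :=
  let φ := chartAt (Cm m) x
  let G := localGram K (trivializationAt (Fin n → ℂ) V x) φ
  normSqForm (g.coeff φ (φ x)) (G (φ x)) (fun v => theta G (φ x) v + thetaBar G (φ x) v)

variable (n) in
/-- The energy `E(K) = ∫_A |θ_K + θ̄_K|²` over the domain `A ⊆ X`. -/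
def energy [MeasurableSpace X] (g : KahlerMetric m X)
    (K : ∀ x, V x →ₗ[ℂ] V x →ₗ⋆[ℂ] ℂ) (A : Set X) : ℝ :=
  ∫ x in A, energyDensity n g K x ∂g.volume

variable (n) in
/-- The pointwise inner product `⟨√-1 Λ (d''θ_K - d'θ̄_K), h⟩_K` at the point `x`. -/
def gradientPairing (g : KahlerMetric m X)
    (K : ∀ x, V x →ₗ[ℂ] V x →ₗ⋆[ℂ] ℂ) (h : ∀ x, V x →ₗ[ℂ] V x) (x : X) : ℝ :=
  let φ := chartAt (Cm m) x
  let e := trivializationAt (Fin n → ℂ) V x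
  let G := localGram K e φ
  (Matrix.trace (eulerLagrange (g.coeff φ) G (φ x) * adj (G (φ x)) (endMatrix h e x))).re

variable (n) in
/-- `K` is a critical point of the energy: for every admissible direction `h`, the energy of
`K_t = K(exp(th)·,·)` over every domain that contains the support of `h`, and on which `K` has
finite energy, is stationary at `t = 0`. -/
def IsCriticalPoint [MeasurableSpace X] (g : KahlerMetric m X)
    (K : ∀ x, V x →ₗ[ℂ] V x →ₗ⋆[ℂ] ℂ) : Prop :=
  ∀ h : ∀ x, V x →ₗ[ℂ] V x, IsVariation m n K h →
    ∀ A : Set X, MeasurableSet A → closure {x | h x ≠ 0} ⊆ A →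
      IntegrableOn (energyDensity n g K) A g.volume →
      HasDerivAt (fun t : ℝ => energy n g (expVariation n K h t) A) 0 0

variable (n) in
/-- The equation `√-1 Λ (d''θ_K - d'θ̄_K) = 0`, in all charts and all flat frames. -/
def SolvesEulerLagrange
    (g : KahlerMetric m X) (K : ∀ x, V x →ₗ[ℂ] V x →ₗ⋆[ℂ] ℂ) : Prop :=
  ∀ φ ∈ atlas (Cm m) X,
    ∀ (e : Frame n V) [MemTrivializationAtlas e], ∀ z ∈ φ.target, φ.symm z ∈ e.baseSet →
      eulerLagrange (g.coeff φ) (localGram K e φ) z = 0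

variable (n) in
/-- The metric `K` is harmonic: `Λ G_K = 0`, in all charts and all flat frames. -/
def IsHarmonicMetric
    (g : KahlerMetric m X) (K : ∀ x, V x →ₗ[ℂ] V x →ₗ⋆[ℂ] ℂ) : Prop :=
  ∀ φ ∈ atlas (Cm m) X,
    ∀ (e : Frame n V) [MemTrivializationAtlas e], ∀ z ∈ φ.target, φ.symm z ∈ e.baseSet →
      ∀ u : Cm m → Fin n → ℂ, ContDiff ℝ ∞ u →
        Lam (g.coeff φ z) (pseudoCurvature (localGram K e φ) u z) = 0

end Bundle

end FlatKahler

end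

/-!
# Critical points of the energy of a metric on a flat bundle

In a flat frame a Hermitian metric is a function `G` with values in the positive definite matrices,
and everything in sight depends on the single real matrix-valued `1`-form `B = G⁻¹ dG`
(`gaugeForm`). Since `d + B` is a gauge transform of `d`, it is flat: `dB + B ∧ B = 0`
(`gaugeForm_flat`). As `θ` and `θ̄` are the `(1,0)`- and `(0,1)`-parts of `-B / 2`, the energy
density is `¼ g^{ab} tr(B_a B_b)` (`normSqForm_eq`), and since `Λ` is half the trace of `β(·, J·)`
and such traces are `J`-invariant, the left side of the Euler–Lagrange equation is
`L = ½ g^{ab} ∂_a B_b` (`eulerLagrange_eq`). The same computation for the pseudo-curvature, where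
flatness of `d + B` disposes of the commutators, gives `ΛG_K = -(i/2) L` (`Lam_pseudoCurvature`), so
that the Euler–Lagrange equation says precisely that the metric is harmonic.

For the first variation put `G_t = G exp(tH)` and regard it as a function on `ℝ × ℂ^m`. Its form
`G_t⁻¹ dG_t` is flat too, with `dt`-component `H`, and flatness in the directions `∂_t` and `v` says
that the `t`-derivative of `B` at `t = 0` is `dH + [B, H]` (`fderiv_gaugeForm_gramPath`). Under the
trace the commutators cancel, so the density varies by `½ g^{ab} Re tr(B_a ∂_b H)`
(`fderiv_pathDensity`). No covariant derivatives are needed: on a Kähler manifold holomorphic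
coordinates are harmonic, `∂_b (√g g^{ab}) = 0` (`IsKahlerAt.sum_fderiv_eq_zero`), so the Riemannian
divergence of a covector field `A` is `g^{ab} ∂_b A_a`. Hence the variation of the density plus
`Re tr(L H)` is half the divergence of `Re tr(B H)`, and integrates to zero if `H` is supported in
one chart and one frame (`integral_densityDeriv_add_of_subset`); a partition of unity handles the
general case (`integral_densityDeriv`). The density of the metrics `K_t` varies only on the compact
support of the variation, which justifies differentiation under the integral (`hasDerivAt_energy`).

If the metric is critical, the integral of `Re tr(L H)` vanishes for all admissible `H`. But `L` is
itself self-adjoint (`eulerLagrange_gram_mul`), so `H = χ L` is admissible for a bump function `χ`,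
and `tr(L L) ≥ 0` vanishes only where `L` does (`re_trace_mul_self_nonneg`); since the volume is
positive on open sets, `L = 0` (`solvesEulerLagrange_of_integral_eq_zero`).

The energy density and the pairing are defined pointwise, by preferred charts and frames. That any
chart and flat frame may be used instead is `energyDensity_eq` and `gradientPairing_eq`; for `L` it
relies on coordinate changes being holomorphic, because `D²τ` then has trace zero. That the volume,
a supremum of measures, is the expected one in each chart is `volume_restrict_source`.

Matrices carry the operator norm throughout, only to make the calculus of matrix-valued functions
available; any other norm would do.
-/

noncomputable section

namespace FlatKahler

open scoped Matrix.Norms.L2Operator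

/-! ### The form `G⁻¹ dG` of a matrix-valued function -/

section Gauge

variable {n : ℕ} {E : Type*} [NormedAddCommGroup E] [NormedSpace ℝ E]
  {E' : Type*} [NormedAddCommGroup E'] [NormedSpace ℝ E']

/-- The matrix-valued `1`-form `B = G⁻¹ dG`. It has this meaning where `G` is invertible; elsewhere
the inverse, and with it `B`, is zero. -/
def gaugeForm (G : E → Matrix (Fin n) (Fin n) ℂ) (z : E) : E →L[ℝ] Matrix (Fin n) (Fin n) ℂ :=
  (ContinuousLinearMap.mul ℝ (Matrix (Fin n) (Fin n) ℂ) (G z)⁻¹).comp (fderiv ℝ G z)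

theorem gaugeForm_apply (G : E → Matrix (Fin n) (Fin n) ℂ) (z v : E) :
    gaugeForm G z v = (G z)⁻¹ * fderiv ℝ G z v := rfl

theorem contDiffAt_ringInverse_comp {𝔸 : Type*} [NormedRing 𝔸] [NormedAlgebra ℝ 𝔸]
    [CompleteSpace 𝔸] {k : WithTop ℕ∞} {G : E → 𝔸} {z : E}
    (hG : ContDiffAt ℝ k G z) (hu : IsUnit (G z)) :
    ContDiffAt ℝ k (fun y => Ring.inverse (G y)) z :=
  ContDiffAt.comp z (contDiffAt_ringInverse (𝕜 := ℝ) (n := k) hu.unit) hG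

theorem fderiv_ringInverse_comp {𝔸 : Type*} [NormedRing 𝔸] [NormedAlgebra ℝ 𝔸]
    [CompleteSpace 𝔸] {G : E → 𝔸} {z : E}
    (hG : DifferentiableAt ℝ G z) (hu : IsUnit (G z)) (v : E) :
    fderiv ℝ (fun y => Ring.inverse (G y)) z v =
      -(Ring.inverse (G z) * fderiv ℝ G z v * Ring.inverse (G z)) := by
  have h2 := HasFDerivAt.comp z (hasFDerivAt_ringInverse (𝕜 := ℝ) hu.unit) hG.hasFDerivAt
  change fderiv ℝ (Ring.inverse ∘ G) z v = _
  rw [h2.fderiv]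
  simp only [ContinuousLinearMap.comp_apply, neg_apply, ContinuousLinearMap.mulLeftRight_apply]
  rw [← Ring.inverse_unit hu.unit, IsUnit.unit_spec]

theorem contDiffAt_matrix_inv {k : WithTop ℕ∞} {G : E → Matrix (Fin n) (Fin n) ℂ} {z : E}
    (hG : ContDiffAt ℝ k G z) (hu : IsUnit (G z).det) :
    ContDiffAt ℝ k (fun y => (G y)⁻¹) z := by
  simp only [Matrix.nonsing_inv_eq_ringInverse]
  exact contDiffAt_ringInverse_comp hG ((Matrix.isUnit_iff_isUnit_det _).2 hu)

theorem fderiv_matrix_inv {G : E → Matrix (Fin n) (Fin n) ℂ} {z : E}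
    (hG : DifferentiableAt ℝ G z) (hu : IsUnit (G z).det) (v : E) :
    fderiv ℝ (fun y => (G y)⁻¹) z v = -((G z)⁻¹ * fderiv ℝ G z v * (G z)⁻¹) := by
  simp only [Matrix.nonsing_inv_eq_ringInverse]
  exact fderiv_ringInverse_comp hG ((Matrix.isUnit_iff_isUnit_det _).2 hu) v

theorem eventually_isUnit_det {E : Type*} [TopologicalSpace E]
    {G : E → Matrix (Fin n) (Fin n) ℂ} {z : E}
    (hG : ContinuousAt G z) (hu : IsUnit (G z).det) : ∀ᶠ y in 𝓝 z, IsUnit (G y).det := by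
  have h : ContinuousAt (fun y => (G y).det) z :=
    (Continuous.matrix_det continuous_id).continuousAt.comp hG
  filter_upwards [h.eventually_ne hu.ne_zero] with y hy using isUnit_iff_ne_zero.2 hy

theorem contDiffAt_gaugeForm {G : E → Matrix (Fin n) (Fin n) ℂ} {z : E}
    (hG : ContDiffAt ℝ ∞ G z) (hu : IsUnit (G z).det) :
    ContDiffAt ℝ ∞ (gaugeForm G) z := by
  have h1 : ContDiffAt ℝ ∞ (fderiv ℝ G) z := hG.fderiv_right (by simp)
  have h2 := contDiffAt_matrix_inv hG hu
  have h3 : ContDiffAt ℝ ∞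
      (fun y => ContinuousLinearMap.mul ℝ (Matrix (Fin n) (Fin n) ℂ) (G y)⁻¹) z :=
    (ContinuousLinearMap.mul ℝ (Matrix (Fin n) (Fin n) ℂ)).contDiff.contDiffAt.comp z h2
  exact h3.clm_comp h1

theorem fderiv_gaugeForm {G : E → Matrix (Fin n) (Fin n) ℂ} {z : E}
    (hG : ContDiffAt ℝ ∞ G z) (hu : IsUnit (G z).det) (v w : E) :
    fderiv ℝ (gaugeForm G) z v w =
      (G z)⁻¹ * fderiv ℝ (fderiv ℝ G) z v w - gaugeForm G z v * gaugeForm G z w := by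
  have h1 : DifferentiableAt ℝ (fderiv ℝ G) z :=
    (hG.fderiv_right (m := 1) (by norm_cast)).differentiableAt (by simp)
  have h2 : DifferentiableAt ℝ (fun y => (G y)⁻¹) z :=
    (contDiffAt_matrix_inv hG hu).differentiableAt (by simp)
  have h0 : DifferentiableAt ℝ (gaugeForm G) z :=
    (contDiffAt_gaugeForm hG hu).differentiableAt (by simp)
  have h3 : fderiv ℝ (gaugeForm G) z v w = fderiv ℝ (fun y => gaugeForm G y w) z v := by
    rw [fderiv_clm_apply h0 (differentiableAt_const w)]; simp
  rw [h3]
  simp only [gaugeForm_apply]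
  have h4 : DifferentiableAt ℝ (fun y => fderiv ℝ G y w) z :=
    h1.clm_apply (differentiableAt_const w)
  rw [fderiv_fun_mul' h2 h4, fderiv_clm_apply h1 (differentiableAt_const w)]
  simp only [add_apply, smul_apply, fderiv_matrix_inv (hG.differentiableAt (by simp)) hu]
  simp [mul_assoc, sub_eq_add_neg]

/-- The connection `d + G⁻¹ dG`, a gauge transform of `d`, is flat. -/
theorem gaugeForm_flat {G : E → Matrix (Fin n) (Fin n) ℂ} {z : E}
    (hG : ContDiffAt ℝ ∞ G z) (hu : IsUnit (G z).det) (v w : E) :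
    fderiv ℝ (gaugeForm G) z v w = fderiv ℝ (gaugeForm G) z w v -
      (gaugeForm G z v * gaugeForm G z w - gaugeForm G z w * gaugeForm G z v) := by
  have h : fderiv ℝ (fderiv ℝ G) z v w = fderiv ℝ (fderiv ℝ G) z w v :=
    (hG.isSymmSndFDerivAt (by simp; norm_cast)) v w
  rw [fderiv_gaugeForm hG hu, fderiv_gaugeForm hG hu, h]
  abel

/-- Behaviour of `G⁻¹ dG` under a change of coordinates `τ` and a constant change of frame `P`. -/
theorem gaugeForm_pullback {G : E → Matrix (Fin n) (Fin n) ℂ} {G' : E' → Matrix (Fin n) (Fin n) ℂ}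
    {τ : E' → E} {y : E'} {P : Matrix (Fin n) (Fin n) ℂ} (hP : IsUnit P.det)
    (hτ : DifferentiableAt ℝ τ y) (hG : DifferentiableAt ℝ G (τ y))
    (h : G' =ᶠ[𝓝 y] fun x => Pᴴ * G (τ x) * P) (v : E') :
    gaugeForm G' y v = P⁻¹ * gaugeForm G (τ y) (fderiv ℝ τ y v) * P := by
  have h1 : HasFDerivAt (fun x => G (τ x)) ((fderiv ℝ G (τ y)).comp (fderiv ℝ τ y)) y :=
    HasFDerivAt.comp y hG.hasFDerivAt hτ.hasFDerivAt
  have h2 := ((h1.const_mul Pᴴ).mul_const' P)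
  have hP' : IsUnit (Pᴴ).det := by rw [Matrix.det_conjTranspose]; exact hP.star
  rw [gaugeForm_apply, gaugeForm_apply, h.fderiv_eq, h2.fderiv, h.eq_of_nhds]
  simp only [Matrix.mul_inv_rev]
  change P⁻¹ * ((G (τ y))⁻¹ * (Pᴴ)⁻¹) * (Pᴴ * fderiv ℝ G (τ y) (fderiv ℝ τ y v) * P) = _
  rw [show P⁻¹ * ((G (τ y))⁻¹ * (Pᴴ)⁻¹) * (Pᴴ * fderiv ℝ G (τ y) (fderiv ℝ τ y v) * P) =
    P⁻¹ * ((G (τ y))⁻¹ * ((Pᴴ)⁻¹ * Pᴴ) * fderiv ℝ G (τ y) (fderiv ℝ τ y v)) * P by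
      simp only [mul_assoc], Matrix.nonsing_inv_mul _ hP', mul_one]

theorem fderiv_gaugeForm_pullback {G : E → Matrix (Fin n) (Fin n) ℂ}
    {G' : E' → Matrix (Fin n) (Fin n) ℂ}
    {τ : E' → E} {y : E'} {P : Matrix (Fin n) (Fin n) ℂ} (hP : IsUnit P.det)
    (hτ : ContDiffAt ℝ ∞ τ y) (hG : ContDiffAt ℝ ∞ G (τ y)) (hu : IsUnit (G (τ y)).det)
    (h : G' =ᶠ[𝓝 y] fun x => Pᴴ * G (τ x) * P) (v w : E') :
    fderiv ℝ (gaugeForm G') y v w = P⁻¹ *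
      (fderiv ℝ (gaugeForm G) (τ y) (fderiv ℝ τ y v) (fderiv ℝ τ y w) +
        gaugeForm G (τ y) (fderiv ℝ (fderiv ℝ τ) y v w)) * P := by
  have hP' : IsUnit (Pᴴ).det := by rw [Matrix.det_conjTranspose]; exact hP.star
  have hu' : IsUnit (G' y).det := by
    rw [h.eq_of_nhds, Matrix.det_mul, Matrix.det_mul]; exact (hP'.mul hu).mul hP
  have hG1 : ContDiffAt ℝ ∞ (fun x => Pᴴ * G (τ x) * P) y :=
    (contDiffAt_const.mul (hG.comp y hτ)).mul contDiffAt_const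
  have hG' : ContDiffAt ℝ ∞ G' y := hG1.congr_of_eventuallyEq h
  have hev : ∀ᶠ x in 𝓝 y, DifferentiableAt ℝ τ x ∧ DifferentiableAt ℝ G (τ x) := by
    have e1 := (hτ.of_le (m := 1) (by norm_cast)).eventually (by simp)
    have e2 := hτ.continuousAt.eventually
      ((hG.of_le (m := 1) (by norm_cast)).eventually (by simp))
    filter_upwards [e1, e2] with x h1 h2
    exact ⟨h1.differentiableAt (by simp), h2.differentiableAt (by simp)⟩
  have hB : (fun x => gaugeForm G' x w) =ᶠ[𝓝 y]
      fun x => P⁻¹ * gaugeForm G (τ x) (fderiv ℝ τ x w) * P := by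
    filter_upwards [hev, h.eventuallyEq_nhds] with x hx hx'
    exact gaugeForm_pullback hP hx.1 hx.2 hx' w
  have h0 : DifferentiableAt ℝ (gaugeForm G') y :=
    (contDiffAt_gaugeForm hG' hu').differentiableAt (by simp)
  have h1 : DifferentiableAt ℝ (gaugeForm G) (τ y) :=
    (contDiffAt_gaugeForm hG hu).differentiableAt (by simp)
  have h2 : DifferentiableAt ℝ (fderiv ℝ τ) y :=
    (hτ.fderiv_right (m := 1) (by norm_cast)).differentiableAt (by simp)
  have h3 : fderiv ℝ (gaugeForm G') y v w = fderiv ℝ (fun x => gaugeForm G' x w) y v := by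
    rw [fderiv_clm_apply h0 (differentiableAt_const w)]; simp
  have h4 : HasFDerivAt (fun x => gaugeForm G (τ x))
      ((fderiv ℝ (gaugeForm G) (τ y)).comp (fderiv ℝ τ y)) y :=
    HasFDerivAt.comp (g := gaugeForm G) y h1.hasFDerivAt
      (hτ.differentiableAt (by simp)).hasFDerivAt
  have h5 := h4.clm_apply (h2.hasFDerivAt.clm_apply (hasFDerivAt_const w y))
  rw [h3, hB.fderiv_eq, ((h5.const_mul P⁻¹).mul_const' P).fderiv]
  change P⁻¹ * _ * P = _
  congr 2
  simp [add_comm]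

end Gauge

/-! ### Traces with respect to a Hermitian inner product -/

section Trace

variable {m : ℕ} {W : Type*} [AddCommGroup W] [Module ℝ W]

/-- The trace `g^{ab} Q(e_a, e_b)` of a bilinear map with respect to an inner product. -/
def metricTrace (g : Cm m → Cm m → ℝ) (Q : Cm m → Cm m → W) : W :=
  ∑ a, ∑ b, (metricMatrix g)⁻¹ a b • Q (realBasis m a) (realBasis m b)

/-- Real bilinearity of a map of two tangent vectors. The coefficients of a metric and the value of
a `2`-form at a point are unbundled functions, so bilinearity is a predicate. -/
def IsRealBilin (Q : Cm m → Cm m → W) : Prop :=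
  ∃ L : Cm m →ₗ[ℝ] Cm m →ₗ[ℝ] W, ∀ v w, Q v w = L v w

/-- A real inner product on `ℂ^m`, given as an unbundled map. -/
structure IsInner (g : Cm m → Cm m → ℝ) : Prop where
  bilin : IsRealBilin g
  symm : ∀ v w, g v w = g w v
  pos : ∀ v, v ≠ 0 → 0 < g v v

theorem IsRealBilin.mk' {Q : Cm m → Cm m → W} (h1 : ∀ u v w, Q (u + v) w = Q u w + Q v w)
    (h2 : ∀ (r : ℝ) v w, Q (r • v) w = r • Q v w) (h3 : ∀ u v w, Q u (v + w) = Q u v + Q u w)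
    (h4 : ∀ (r : ℝ) v w, Q v (r • w) = r • Q v w) : IsRealBilin Q :=
  ⟨LinearMap.mk₂ ℝ Q h1 h2 h3 h4, fun _ _ => rfl⟩

theorem metricTrace_add (g : Cm m → Cm m → ℝ) (Q R : Cm m → Cm m → W) :
    metricTrace g (fun v w => Q v w + R v w) = metricTrace g Q + metricTrace g R := by
  simp only [metricTrace, smul_add, Finset.sum_add_distrib]

theorem metricTrace_map {W' : Type*} [AddCommGroup W'] [Module ℝ W'] (g : Cm m → Cm m → ℝ)
    (Q : Cm m → Cm m → W) (f : W →ₗ[ℝ] W') :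
    metricTrace g (fun v w => f (Q v w)) = f (metricTrace g Q) := by
  simp only [metricTrace, map_sum, map_smul]

theorem metricTrace_neg (g : Cm m → Cm m → ℝ) (Q : Cm m → Cm m → W) :
    metricTrace g (fun v w => -Q v w) = -metricTrace g Q := by
  simp only [metricTrace, smul_neg, Finset.sum_neg_distrib]

theorem metricTrace_congr {g : Cm m → Cm m → ℝ} {Q R : Cm m → Cm m → W}
    (h : ∀ v w, Q v w = R v w) : metricTrace g Q = metricTrace g R := by
  simp only [metricTrace, h]

theorem metricMatrix_comp {g : Cm m → Cm m → ℝ} (hg : IsRealBilin g) (T : Cm m →ₗ[ℝ] Cm m) :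
    metricMatrix (fun v w => g (T v) (T w)) =
      (LinearMap.toMatrix (realBasis m) (realBasis m) T)ᵀ * metricMatrix g *
        LinearMap.toMatrix (realBasis m) (realBasis m) T := by
  obtain ⟨L, hL⟩ := hg
  have hT : ∀ a, T (realBasis m a) =
      ∑ c, LinearMap.toMatrix (realBasis m) (realBasis m) T c a • realBasis m c := fun a => by
    simp [LinearMap.toMatrix_apply, Module.Basis.sum_repr]
  ext a b
  simp only [metricMatrix, Matrix.of_apply, Matrix.mul_apply, hL, Matrix.transpose_apply]
  rw [hT a, hT b]
  simp only [map_sum, map_smul, LinearMap.sum_apply, LinearMap.smul_apply, smul_eq_mul,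
    Finset.mul_sum, Finset.sum_mul]
  refine Finset.sum_congr rfl fun c _ => Finset.sum_congr rfl fun d _ => by ring

theorem IsInner.posDef {g : Cm m → Cm m → ℝ} (hg : IsInner g) : (metricMatrix g).PosDef := by
  obtain ⟨L, hL⟩ := hg.bilin
  refine Matrix.PosDef.of_dotProduct_mulVec_pos ?_ fun x hx => ?_
  · ext a b
    simp [metricMatrix, hg.symm (realBasis m b) (realBasis m a)]
  · have h : star x ⬝ᵥ metricMatrix g *ᵥ x = g ((realBasis m).equivFun.symm x)
        ((realBasis m).equivFun.symm x) := by
      simp only [hL, Module.Basis.equivFun_symm_apply, map_sum, map_smul, LinearMap.sum_apply,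
        LinearMap.smul_apply, dotProduct, Matrix.mulVec, metricMatrix, Matrix.of_apply,
        star_trivial, smul_eq_mul, Finset.mul_sum]
      rw [Finset.sum_comm]
      refine Finset.sum_congr rfl fun c _ => Finset.sum_congr rfl fun d _ => by ring
    rw [h]
    exact hg.pos _ fun h0 => hx ((LinearEquiv.map_eq_zero_iff _).1 h0)

theorem IsInner.isUnit_det {g : Cm m → Cm m → ℝ} (hg : IsInner g) :
    IsUnit (metricMatrix g).det := isUnit_iff_ne_zero.2 hg.posDef.det_pos.ne'

theorem IsInner.inv_symm {g : Cm m → Cm m → ℝ} (hg : IsInner g) (a b : Fin 2 × Fin m) :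
    (metricMatrix g)⁻¹ a b = (metricMatrix g)⁻¹ b a := by
  have h := hg.posDef.inv.isHermitian.apply a b
  simpa using h.symm

theorem metricTrace_swap {g : Cm m → Cm m → ℝ} (hg : IsInner g) (Q : Cm m → Cm m → W) :
    metricTrace g (fun v w => Q w v) = metricTrace g Q := by
  simp only [metricTrace]
  rw [Finset.sum_comm]
  refine Finset.sum_congr rfl fun c _ => Finset.sum_congr rfl fun d _ => ?_
  rw [hg.inv_symm]

theorem sum_sum_comm {ι κ : Type*} [Fintype ι] [Fintype κ] {W : Type*} [AddCommMonoid W]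
    (f : ι → ι → κ → κ → W) :
    ∑ a, ∑ b, ∑ c, ∑ d, f a b c d = ∑ c, ∑ d, ∑ a, ∑ b, f a b c d := by
  calc _ = ∑ p : ι × ι, ∑ q : κ × κ, f p.1 p.2 q.1 q.2 := by simp only [Fintype.sum_prod_type]
    _ = ∑ q : κ × κ, ∑ p : ι × ι, f p.1 p.2 q.1 q.2 := Finset.sum_comm
    _ = _ := by simp only [Fintype.sum_prod_type]

/-- The trace does not depend on the coordinates. -/
theorem metricTrace_comp {g : Cm m → Cm m → ℝ} (hg : IsInner g) {Q : Cm m → Cm m → W}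
    (hQ : IsRealBilin Q) (T : Cm m →ₗ[ℝ] Cm m) (hT : IsUnit (LinearMap.det T)) :
    metricTrace (fun v w => g (T v) (T w)) (fun v w => Q (T v) (T w)) = metricTrace g Q := by
  obtain ⟨L, hL⟩ := hQ
  have hTe : ∀ a, T (realBasis m a) =
      ∑ c, LinearMap.toMatrix (realBasis m) (realBasis m) T c a • realBasis m c := fun a => by
    simp [LinearMap.toMatrix_apply, Module.Basis.sum_repr]
  rw [metricTrace, metricMatrix_comp hg.bilin]
  rw [← LinearMap.det_toMatrix (realBasis m)] at hT
  set P := LinearMap.toMatrix (realBasis m) (realBasis m) T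
  have hPt : IsUnit (Pᵀ).det := by rwa [Matrix.det_transpose]
  have key : P * (Pᵀ * metricMatrix g * P)⁻¹ * Pᵀ = (metricMatrix g)⁻¹ := by
    rw [Matrix.mul_inv_rev, Matrix.mul_inv_rev, ← mul_assoc, ← mul_assoc,
      Matrix.mul_nonsing_inv _ hT, one_mul, mul_assoc, Matrix.nonsing_inv_mul _ hPt, mul_one]
  have h1 : ∀ c d, (metricMatrix g)⁻¹ c d =
      ∑ a, ∑ b, P c a * (Pᵀ * metricMatrix g * P)⁻¹ a b * P d b := fun c d => by
    rw [← key]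
    simp only [Matrix.mul_apply, Matrix.transpose_apply, Finset.sum_mul]
    rw [Finset.sum_comm]
  simp only [metricTrace, h1, hTe, hL, map_sum, map_smul, LinearMap.sum_apply,
    LinearMap.smul_apply, Finset.smul_sum, Finset.sum_smul, smul_smul]
  rw [sum_sum_comm, Finset.sum_comm]
  refine Finset.sum_congr rfl fun c _ => Finset.sum_congr rfl fun d _ =>
    Finset.sum_congr rfl fun a _ => Finset.sum_congr rfl fun b _ => ?_
  congr 1
  ring

/-- Multiplication by `i`, as a real linear map. -/
def complexStructure (m : ℕ) : Cm m →L[ℝ] Cm m :=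
  (Complex.I • ContinuousLinearMap.id ℂ (Cm m)).restrictScalars ℝ

theorem I_smul_I_smul (v : Cm m) : Complex.I • Complex.I • v = -v := by
  rw [smul_smul, Complex.I_mul_I, neg_one_smul]

theorem isUnit_det_complexStructure :
    IsUnit (LinearMap.det (complexStructure m : Cm m →ₗ[ℝ] Cm m)) := by
  refine LinearMap.isUnit_iff_isUnit_det _ |>.1 (Module.End.isUnit_iff _ |>.2 ⟨?_, ?_⟩)
  · intro v w h
    have h' : Complex.I • v = Complex.I • w := h
    exact smul_right_injective _ Complex.I_ne_zero h'
  · intro v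
    refine ⟨-(Complex.I • v), ?_⟩
    change Complex.I • -(Complex.I • v) = v
    rw [smul_neg, I_smul_I_smul, neg_neg]

/-- The trace of a bilinear map with respect to a Hermitian metric is invariant under the complex
structure. -/
theorem metricTrace_I {g : Cm m → Cm m → ℝ} (hg : IsInner g)
    (hJ : ∀ v w, g (Complex.I • v) (Complex.I • w) = g v w) {Q : Cm m → Cm m → W}
    (hQ : IsRealBilin Q) :
    metricTrace g (fun v w => Q (Complex.I • v) (Complex.I • w)) = metricTrace g Q := by
  have h := metricTrace_comp hg hQ (complexStructure m : Cm m →ₗ[ℝ] Cm m)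
    isUnit_det_complexStructure
  rw [← h]
  congr 1
  ext v w
  exact (hJ v w).symm

/-- Bilinear maps that change sign under the complex structure, in particular the complex bilinear
ones, have trace zero with respect to a Hermitian metric. -/
theorem metricTrace_eq_zero {g : Cm m → Cm m → ℝ} (hg : IsInner g)
    (hJ : ∀ v w, g (Complex.I • v) (Complex.I • w) = g v w) {Q : Cm m → Cm m → W}
    (hQ : IsRealBilin Q) (h : ∀ v w, Q (Complex.I • v) (Complex.I • w) = -Q v w) :
    metricTrace g Q = 0 := by
  have h1 := metricTrace_I hg hJ hQ
  simp only [h, metricTrace_neg] at h1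
  have h2 : (2 : ℝ) • metricTrace g Q = 0 := by
    rw [two_smul]; nth_rewrite 1 [← h1]; simp
  simpa using h2

/-- Raising an index: `g^{bd} g(v, e_d)` are the coordinates of `v`. -/
theorem IsInner.sum_inv_mul {g : Cm m → Cm m → ℝ} (hg : IsInner g) (v : Cm m)
    (b : Fin 2 × Fin m) :
    ∑ d, (metricMatrix g)⁻¹ b d * g v (realBasis m d) = (realBasis m).repr v b := by
  obtain ⟨L, hL⟩ := hg.bilin
  have h1 : ∀ d, g v (realBasis m d) =
      ∑ c, metricMatrix g d c * (realBasis m).repr v c := fun d => by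
    conv_lhs => rw [hg.symm, ← (realBasis m).sum_repr v, hL]
    simp only [map_sum, map_smul, smul_eq_mul, metricMatrix, Matrix.of_apply, hL]
    exact Finset.sum_congr rfl fun c _ => mul_comm _ _
  have h2 : ∀ d, g v (realBasis m d) = (metricMatrix g *ᵥ ⇑((realBasis m).repr v)) d := h1
  simp only [h2]
  change ((metricMatrix g)⁻¹ *ᵥ (metricMatrix g *ᵥ ⇑((realBasis m).repr v))) b = _
  rw [Matrix.mulVec_mulVec, Matrix.nonsing_inv_mul _ hg.isUnit_det, Matrix.one_mulVec]

/-- `Λβ` is half the trace of `β(·, J·)`. -/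
theorem Lam_eq {W : Type*} [AddCommGroup W] [Module ℂ W] {g : Cm m → Cm m → ℝ} (hg : IsInner g)
    {β : Cm m → Cm m → W} (hβ : ∀ v, ∃ L : Cm m →ₗ[ℝ] W, ∀ w, β v w = L w) :
    Lam g β = (1 / 2 : ℂ) • metricTrace g (fun v w => β v (Complex.I • w)) := by
  rw [Lam, metricTrace]
  congr 1
  refine Finset.sum_congr rfl fun a _ => ?_
  obtain ⟨L, hL⟩ := hβ (realBasis m a)
  have h1 : ∀ c, β (realBasis m a) (Complex.I • realBasis m c) =
      ∑ b, (∑ d, (metricMatrix g)⁻¹ b d * g (Complex.I • realBasis m c) (realBasis m d)) •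
        β (realBasis m a) (realBasis m b) := fun c => by
    simp only [hg.sum_inv_mul, hL]
    conv_lhs => rw [← (realBasis m).sum_repr (Complex.I • realBasis m c)]
    simp only [map_sum, map_smul]
  simp only [h1, Finset.smul_sum, Finset.sum_smul, smul_smul, fundamentalForm]
  rw [Finset.sum_comm]
  refine Finset.sum_congr rfl fun c _ => Finset.sum_congr rfl fun b _ =>
    Finset.sum_congr rfl fun d _ => ?_
  rw [Complex.coe_smul, mul_assoc]

theorem isRealBilin_clm {F : Type*} [NormedAddCommGroup F] [NormedSpace ℝ F]
    (b : Cm m →L[ℝ] Cm m →L[ℝ] F) : IsRealBilin (fun v w => b v w) :=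
  .mk' (fun u v w => by simp) (fun r v w => by simp) (fun u v w => by simp)
    (fun r v w => by simp)

theorem metricTrace_smul {W : Type*} [AddCommGroup W] [Module ℂ W] (g : Cm m → Cm m → ℝ)
    (Q : Cm m → Cm m → W) (c : ℂ) :
    metricTrace g (fun v w => c • Q v w) = c • metricTrace g Q := by
  simp only [metricTrace, Finset.smul_sum, smul_comm c]

/-- `Λ` of a `2`-form built from a bilinear map `b` by antisymmetrization of `b(·, J·) - b(J·, ·)`
is a multiple of the trace of `b`. This is the shape of `d''θ - d'θ̄`, with `b_{ab} = ∂_a B_b`. -/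
theorem Lam_antisymm {W : Type*} [AddCommGroup W] [Module ℂ W] {g : Cm m → Cm m → ℝ}
    (hg : IsInner g) (hJ : ∀ v w, g (Complex.I • v) (Complex.I • w) = g v w)
    {b : Cm m → Cm m → W} (hb : IsRealBilin b) {β : Cm m → Cm m → W}
    (hβ : ∀ v w, β v w = (Complex.I / 4) • (b v (Complex.I • w) - b (Complex.I • v) w -
      b w (Complex.I • v) + b (Complex.I • w) v)) :
    Lam g β = (-Complex.I / 2) • metricTrace g b := by
  have hb' := hb
  obtain ⟨L, hL⟩ := hb'
  have hlin : ∀ v, ∃ L : Cm m →ₗ[ℝ] W, ∀ w, β v w = L w := by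
    intro v
    refine ⟨IsLinearMap.mk' (fun w => β v w) ⟨fun x y => ?_, fun r x => ?_⟩, fun w => rfl⟩
    · simp only [hβ, hL, smul_add, map_add, LinearMap.add_apply]
      module
    · simp only [hβ, hL, smul_comm Complex.I r, map_smul, LinearMap.smul_apply]
      module
  have hbil : IsRealBilin (fun v w => b w v) :=
    .mk' (fun u v w => by simp [hL]) (fun r v w => by simp [hL]) (fun u v w => by simp [hL])
      (fun r v w => by simp [hL])
  have e : ∀ v w, β v (Complex.I • w) = (-Complex.I / 4) • ((b v w + b w v) +
          (b (Complex.I • v) (Complex.I • w) + b (Complex.I • w) (Complex.I • v))) := by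
    intro v w
    rw [hβ]
    simp only [I_smul_I_smul, hL, map_neg, LinearMap.neg_apply]
    module
  rw [Lam_eq hg hlin, metricTrace_congr e, metricTrace_smul, metricTrace_add, metricTrace_add,
    metricTrace_add, metricTrace_I hg hJ hb, metricTrace_I hg hJ hbil, metricTrace_swap hg b]
  module

/-- A variant of `Lam_antisymm` with the `2`-form given by `β(·, J·)`; this is the shape of the
pseudo-curvature. -/
theorem Lam_of_apply_I {W : Type*} [AddCommGroup W] [Module ℂ W] {g : Cm m → Cm m → ℝ}
    (hg : IsInner g) (hJ : ∀ v w, g (Complex.I • v) (Complex.I • w) = g v w)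
    {b : Cm m → Cm m → W} (hb : IsRealBilin b) {β : Cm m → Cm m → W}
    (hβ : ∀ v w, β v (Complex.I • w) =
      (-Complex.I / 4) • (b v w + b (Complex.I • w) (Complex.I • v))) :
    Lam g β = (-Complex.I / 4) • metricTrace g b := by
  have hb' := hb
  obtain ⟨L, hL⟩ := hb'
  have hbil : IsRealBilin (fun v w => b w v) :=
    .mk' (fun u v w => by simp [hL]) (fun r v w => by simp [hL]) (fun u v w => by simp [hL])
      (fun r v w => by simp [hL])
  have hlin : ∀ v, ∃ L : Cm m →ₗ[ℝ] W, ∀ w, β v w = L w := by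
    intro v
    have e : ∀ w, β v w = (-Complex.I / 4) • (L v (-(Complex.I • w)) + L w (Complex.I • v)) := by
      intro w
      have h := hβ v (-(Complex.I • w))
      rw [smul_neg, I_smul_I_smul, neg_neg] at h
      rw [h, hL, hL]
    refine ⟨IsLinearMap.mk' (fun w => β v w) ⟨fun x y => ?_, fun r x => ?_⟩, fun w => rfl⟩
    · simp only [e, smul_add, map_add, LinearMap.add_apply, map_neg]
      module
    · simp only [e, smul_comm Complex.I r, map_smul, LinearMap.smul_apply, map_neg]
      module
  rw [Lam_eq hg hlin, metricTrace_congr hβ, metricTrace_smul, metricTrace_add,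
    metricTrace_I hg hJ hbil, metricTrace_swap hg b]
  module

end Trace

/-! ### The operators of the statement in terms of `G⁻¹ dG` -/

section Operators

variable {m n : ℕ}

theorem fderiv_entry {E : Type*} [NormedAddCommGroup E] [NormedSpace ℝ E]
    {F : E → Matrix (Fin n) (Fin n) ℂ} {z : E} (hF : DifferentiableAt ℝ F z)
    (v : E) (i j : Fin n) : fderiv ℝ (fun y => F y i j) z v = fderiv ℝ F z v i j := by
  let L : Matrix (Fin n) (Fin n) ℂ →L[ℝ] ℂ :=
    LinearMap.toContinuousLinearMap (Matrix.entryLinearMap ℝ ℂ i j)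
  have h := (L.hasFDerivAt (x := F z)).comp z hF.hasFDerivAt
  change fderiv ℝ (L ∘ F) z v = _
  rw [h.fderiv]
  rfl

theorem delM_eq {F : Cm m → Matrix (Fin n) (Fin n) ℂ} {z : Cm m} (hF : DifferentiableAt ℝ F z)
    (v : Cm m) : delM F z v =
      (1 / 2 : ℂ) • (fderiv ℝ F z v - Complex.I • fderiv ℝ F z (Complex.I • v)) := by
  ext i j
  simp [delM, del, fderiv_entry hF]

theorem delbarM_eq {F : Cm m → Matrix (Fin n) (Fin n) ℂ} {z : Cm m}
    (hF : DifferentiableAt ℝ F z) (v : Cm m) : delbarM F z v =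
      (1 / 2 : ℂ) • (fderiv ℝ F z v + Complex.I • fderiv ℝ F z (Complex.I • v)) := by
  ext i j
  simp [delbarM, delbar, fderiv_entry hF]

theorem theta_gauge {G : Cm m → Matrix (Fin n) (Fin n) ℂ} {z : Cm m}
    (hG : DifferentiableAt ℝ G z) (v : Cm m) : theta G z v =
      (-(1 / 4) : ℂ) • (gaugeForm G z v - Complex.I • gaugeForm G z (Complex.I • v)) := by
  rw [theta_eq, delM_eq hG, gaugeForm_apply, gaugeForm_apply, Matrix.mul_smul, mul_sub,
    Matrix.mul_smul, smul_smul]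
  norm_num

theorem thetaBar_gauge {G : Cm m → Matrix (Fin n) (Fin n) ℂ} {z : Cm m}
    (hG : DifferentiableAt ℝ G z) (v : Cm m) : thetaBar G z v =
      (-(1 / 4) : ℂ) • (gaugeForm G z v + Complex.I • gaugeForm G z (Complex.I • v)) := by
  rw [thetaBar_eq, delbarM_eq hG, gaugeForm_apply, gaugeForm_apply, Matrix.mul_smul, mul_add,
    Matrix.mul_smul, smul_smul]
  norm_num

theorem eventually_differentiableAt {E F : Type*} [NormedAddCommGroup E] [NormedSpace ℝ E]
    [NormedAddCommGroup F] [NormedSpace ℝ F] {G : E → F} {z : E} (hG : ContDiffAt ℝ ∞ G z) :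
    ∀ᶠ y in 𝓝 z, DifferentiableAt ℝ G y := by
  filter_upwards [(hG.of_le (m := 1) (by norm_cast)).eventually (by simp)] with y hy
    using hy.differentiableAt (by simp)

theorem fderiv_clm_const {E F E' : Type*} [NormedAddCommGroup E] [NormedSpace ℝ E]
    [NormedAddCommGroup E'] [NormedSpace ℝ E'] [NormedAddCommGroup F] [NormedSpace ℝ F]
    {B : E → E' →L[ℝ] F} {z : E} (hB : DifferentiableAt ℝ B z) (v : E) (w : E') :
    fderiv ℝ (fun y => B y w) z v = fderiv ℝ B z v w := by
  rw [fderiv_clm_apply hB (differentiableAt_const w)]; simp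

theorem hasFDerivAt_gauge_comb {G : Cm m → Matrix (Fin n) (Fin n) ℂ} {z : Cm m}
    (hG : ContDiffAt ℝ ∞ G z) (hu : IsUnit (G z).det) (c d : ℂ) (w : Cm m) :
    DifferentiableAt ℝ
      (fun y => c • (gaugeForm G y w + d • gaugeForm G y (Complex.I • w))) z ∧
    ∀ v, fderiv ℝ (fun y => c • (gaugeForm G y w + d • gaugeForm G y (Complex.I • w))) z v =
      c • (fderiv ℝ (gaugeForm G) z v w + d • fderiv ℝ (gaugeForm G) z v (Complex.I • w)) := by
  have h0 : DifferentiableAt ℝ (gaugeForm G) z :=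
    (contDiffAt_gaugeForm hG hu).differentiableAt (by simp)
  have h1 : ∀ w, DifferentiableAt ℝ (fun y => gaugeForm G y w) z := fun w =>
    h0.clm_apply (differentiableAt_const w)
  refine ⟨((h1 w).add ((h1 _).const_smul d)).const_smul c, fun v => ?_⟩
  rw [fderiv_fun_const_smul ((h1 w).fun_add ((h1 _).fun_const_smul d)),
    fderiv_fun_add (h1 w) ((h1 _).fun_const_smul d), fderiv_fun_const_smul (h1 _)]
  simp only [smul_apply, add_apply, fderiv_clm_const h0]

/-- In terms of `B = G⁻¹ dG`, the Euler–Lagrange expression is `½ g^{ab} ∂_a B_b`. -/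
theorem eulerLagrange_eq {g : Cm m → Cm m → Cm m → ℝ} {G : Cm m → Matrix (Fin n) (Fin n) ℂ}
    {z : Cm m} (hg : IsInner (g z))
    (hJ : ∀ v w, g z (Complex.I • v) (Complex.I • w) = g z v w)
    (hG : ContDiffAt ℝ ∞ G z) (hu : IsUnit (G z).det) :
    eulerLagrange g G z =
      (1 / 2 : ℂ) • metricTrace (g z) (fun v w => fderiv ℝ (gaugeForm G) z v w) := by
  set b := fderiv ℝ (gaugeForm G) z with hb
  have hev := eventually_differentiableAt hG
  have h1 : ∀ v w, delbarM (fun y => theta G y w) z v = (1 / 2 : ℂ) •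
      ((-(1 / 4) : ℂ) • (b v w + (-Complex.I) • b v (Complex.I • w)) + Complex.I •
      ((-(1 / 4) : ℂ) • (b (Complex.I • v) w +
        (-Complex.I) • b (Complex.I • v) (Complex.I • w)))) := by
    intro v w
    obtain ⟨hd, hf⟩ := hasFDerivAt_gauge_comb hG hu (-(1 / 4)) (-Complex.I) w
    have he : (fun y => theta G y w) =ᶠ[𝓝 z] fun y =>
        (-(1 / 4) : ℂ) • (gaugeForm G y w + (-Complex.I) • gaugeForm G y (Complex.I • w)) := by
      filter_upwards [hev] with y hy
      rw [theta_gauge hy, neg_smul Complex.I, ← sub_eq_add_neg]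
    rw [delbarM_eq (hd.congr_of_eventuallyEq he), he.fderiv_eq, hf, hf]
  have h2 : ∀ v w, delM (fun y => thetaBar G y w) z v = (1 / 2 : ℂ) •
      ((-(1 / 4) : ℂ) • (b v w + Complex.I • b v (Complex.I • w)) - Complex.I •
      ((-(1 / 4) : ℂ) • (b (Complex.I • v) w +
        Complex.I • b (Complex.I • v) (Complex.I • w)))) := by
    intro v w
    obtain ⟨hd, hf⟩ := hasFDerivAt_gauge_comb hG hu (-(1 / 4)) Complex.I w
    have he : (fun y => thetaBar G y w) =ᶠ[𝓝 z] fun y =>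
        (-(1 / 4) : ℂ) • (gaugeForm G y w + Complex.I • gaugeForm G y (Complex.I • w)) := by
      filter_upwards [hev] with y hy
      rw [thetaBar_gauge hy]
    rw [delM_eq (hd.congr_of_eventuallyEq he), he.fderiv_eq, hf, hf]
  have hβ : ∀ v w, delbarM₁ (theta G) z v w - delM₁ (thetaBar G) z v w =
      (Complex.I / 4) • (b v (Complex.I • w) - b (Complex.I • v) w -
        b w (Complex.I • v) + b (Complex.I • w) v) := by
    intro v w
    have e1 : delbarM₁ (theta G) z v w =
      delbarM (fun y => theta G y w) z v - delbarM (fun y => theta G y v) z w := rfl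
    have e2 : delM₁ (thetaBar G) z v w =
      delM (fun y => thetaBar G y w) z v - delM (fun y => thetaBar G y v) z w := rfl
    rw [e1, e2, h1, h1, h2, h2]
    module
  rw [eulerLagrange, Lam_antisymm hg hJ (isRealBilin_clm b) hβ, smul_smul]
  congr 1
  linear_combination (-1 / 2) * Complex.I_mul_I

/-- Application of a matrix to a vector, as a continuous bilinear map. -/
def mulVecL (n : ℕ) : Matrix (Fin n) (Fin n) ℂ →L[ℝ] (Fin n → ℂ) →L[ℝ] (Fin n → ℂ) :=
  LinearMap.toContinuousBilinearMap (LinearMap.mk₂ ℝ (fun A v => A *ᵥ v)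
    (fun A B v => Matrix.add_mulVec A B v) (fun r A v => Matrix.smul_mulVec r A v)
    (fun A v w => Matrix.mulVec_add A v w) (fun r A v => Matrix.mulVec_smul A r v))

theorem mulVecL_apply (A : Matrix (Fin n) (Fin n) ℂ) (v : Fin n → ℂ) : mulVecL n A v = A *ᵥ v :=
  rfl

/-- The connection form of the Higgs operator `D'' = ∂̄ + C` in a flat frame, where
`C(v) = (i/2) B(Jv)` with `B = G⁻¹ dG`. -/
theorem higgs_eq {G : Cm m → Matrix (Fin n) (Fin n) ℂ} {y : Cm m} (hG : DifferentiableAt ℝ G y)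
    (u : Cm m → Fin n → ℂ) (v : Cm m) :
    higgs G u y v = delbar u y v + (Complex.I / 2) • (gaugeForm G y (Complex.I • v) *ᵥ u y) := by
  have h := thetaBar_gauge hG v
  rw [thetaBar_eq] at h
  have h2 : (G y)⁻¹ * delbarM G y v =
      (1 / 2 : ℂ) • (gaugeForm G y v + Complex.I • gaugeForm G y (Complex.I • v)) := by
    have h3 := congrArg ((-2 : ℂ) • ·) h
    simp only [smul_smul] at h3
    norm_num at h3
    rw [h3]; norm_num
  rw [higgs, deltaPP, h2, theta_gauge hG]
  simp only [Matrix.smul_mulVec, Matrix.add_mulVec, Matrix.sub_mulVec]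
  module

theorem higgs₁_eq {G : Cm m → Matrix (Fin n) (Fin n) ℂ} {y : Cm m} (hG : DifferentiableAt ℝ G y)
    (α : Cm m → Cm m → Fin n → ℂ) (v w : Cm m) :
    higgs₁ G α y v w = delbar₁ α y v w + (Complex.I / 2) •
      (gaugeForm G y (Complex.I • v) *ᵥ α y w - gaugeForm G y (Complex.I • w) *ᵥ α y v) := by
  have h2 : ∀ v, (G y)⁻¹ * delbarM G y v =
      (1 / 2 : ℂ) • (gaugeForm G y v + Complex.I • gaugeForm G y (Complex.I • v)) := by
    intro v
    have h := thetaBar_gauge hG v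
    rw [thetaBar_eq] at h
    have h3 := congrArg ((-2 : ℂ) • ·) h
    simp only [smul_smul] at h3
    norm_num at h3
    rw [h3]; norm_num
  rw [higgs₁, deltaPP₁, h2, h2, theta_gauge hG, theta_gauge hG]
  simp only [Matrix.smul_mulVec, Matrix.add_mulVec, Matrix.sub_mulVec]
  module

/-- The pseudo-curvature `∂̄C + C ∧ C`, with `C(v) = (i/2) B(Jv)`, acts by multiplication with a
matrix-valued `2`-form; no derivative of the section `u` remains. -/
theorem pseudoCurvature_eq {G : Cm m → Matrix (Fin n) (Fin n) ℂ} {z : Cm m}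
    (hG : ContDiffAt ℝ ∞ G z) (hu : IsUnit (G z).det) {u : Cm m → Fin n → ℂ}
    (hs : ContDiffAt ℝ ∞ u z) (v w : Cm m) :
    pseudoCurvature G u z v w =
      ((Complex.I / 4) • (fderiv ℝ (gaugeForm G) z v (Complex.I • w) +
          Complex.I • fderiv ℝ (gaugeForm G) z (Complex.I • v) (Complex.I • w) -
          fderiv ℝ (gaugeForm G) z w (Complex.I • v) -
          Complex.I • fderiv ℝ (gaugeForm G) z (Complex.I • w) (Complex.I • v)) -
        (1 / 4 : ℂ) • (gaugeForm G z (Complex.I • v) * gaugeForm G z (Complex.I • w) -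
          gaugeForm G z (Complex.I • w) * gaugeForm G z (Complex.I • v))) *ᵥ u z := by
  have hev := eventually_differentiableAt hG
  have hGd := hG.differentiableAt (by simp)
  have h0 : DifferentiableAt ℝ (gaugeForm G) z :=
    (contDiffAt_gaugeForm hG hu).differentiableAt (by simp)
  have hud := hs.differentiableAt (by simp)
  have h1 : DifferentiableAt ℝ (fderiv ℝ u) z :=
    (hs.fderiv_right (m := 1) (by norm_cast)).differentiableAt (by simp)
  have hsymm : ∀ v w, fderiv ℝ (fderiv ℝ u) z v w = fderiv ℝ (fderiv ℝ u) z w v := fun v w =>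
    (hs.isSymmSndFDerivAt (by simp; norm_cast)) v w
  have h1c : ∀ w, DifferentiableAt ℝ (fun y => fderiv ℝ u y w) z := fun w =>
    h1.clm_apply (differentiableAt_const w)
  have hdel : ∀ w, HasFDerivAt (fun y => delbar u y w)
      ((1 / 2 : ℂ) • (fderiv ℝ (fun y => fderiv ℝ u y w) z +
        Complex.I • fderiv ℝ (fun y => fderiv ℝ u y (Complex.I • w)) z)) z := fun w =>
    ((h1c w).hasFDerivAt.add ((h1c _).hasFDerivAt.const_smul Complex.I)).const_smul (1 / 2 : ℂ)
  have hB : ∀ w, DifferentiableAt ℝ (fun y => gaugeForm G y w) z := fun w =>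
    h0.clm_apply (differentiableAt_const w)
  have hmv : ∀ w, HasFDerivAt (fun y => gaugeForm G y w *ᵥ u y) _ z := fun w =>
    (mulVecL n).hasFDerivAt_of_bilinear (hB w).hasFDerivAt hud.hasFDerivAt
  have hhiggs : ∀ v w, fderiv ℝ (fun y => higgs G u y w) z v =
      (1 / 2 : ℂ) • (fderiv ℝ (fderiv ℝ u) z v w +
        Complex.I • fderiv ℝ (fderiv ℝ u) z v (Complex.I • w)) +
      (Complex.I / 2) • (gaugeForm G z (Complex.I • w) *ᵥ fderiv ℝ u z v +
        fderiv ℝ (gaugeForm G) z v (Complex.I • w) *ᵥ u z) := by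
    intro v w
    have he : (fun y => higgs G u y w) =ᶠ[𝓝 z] fun y => delbar u y w +
        (Complex.I / 2) • (gaugeForm G y (Complex.I • w) *ᵥ u y) := by
      filter_upwards [hev] with y hy using higgs_eq hy u w
    rw [he.fderiv_eq, ((hdel w).fun_add ((hmv (Complex.I • w)).fun_const_smul _)).fderiv]
    simp only [add_apply, smul_apply, fderiv_clm_const h1, fderiv_clm_const h0,
      ContinuousLinearMap.precompR_apply, ContinuousLinearMap.precompL_apply, mulVecL_apply]
    rfl
  rw [pseudoCurvature, higgs₁_eq hGd, higgs_eq hGd, higgs_eq hGd, delbar₁, delbar, delbar,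
    hhiggs, hhiggs, hhiggs, hhiggs, hsymm w v, hsymm (Complex.I • w) v, hsymm w (Complex.I • v),
    hsymm (Complex.I • w) (Complex.I • v), delbar, delbar]
  simp only [Matrix.smul_mulVec, Matrix.add_mulVec, Matrix.sub_mulVec, Matrix.mulVec_add,
    Matrix.mulVec_smul, Matrix.mulVec_mulVec]
  match_scalars <;> ring_nf <;> rw [Complex.I_sq] <;> norm_num

/-- `ΛG_K` is a multiple of the Euler–Lagrange expression: the commutator terms of the
pseudo-curvature cancel against those of the antisymmetric part of `∂_a B_b`, since `d + B` is
flat. -/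
theorem Lam_pseudoCurvature {g : Cm m → Cm m → Cm m → ℝ} {G : Cm m → Matrix (Fin n) (Fin n) ℂ}
    {z : Cm m} (hg : IsInner (g z))
    (hJ : ∀ v w, g z (Complex.I • v) (Complex.I • w) = g z v w)
    (hG : ContDiffAt ℝ ∞ G z) (hu : IsUnit (G z).det) {u : Cm m → Fin n → ℂ}
    (hs : ContDiffAt ℝ ∞ u z) :
    Lam (g z) (pseudoCurvature G u z) =
      (-Complex.I / 2 : ℂ) • (eulerLagrange g G z *ᵥ u z) := by
  obtain ⟨L, hL⟩ := isRealBilin_clm (fderiv ℝ (gaugeForm G) z)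
  have hb : IsRealBilin (fun v w => fderiv ℝ (gaugeForm G) z v w *ᵥ u z) := by
    simp only [hL]
    exact .mk' (fun a b c => by simp [Matrix.add_mulVec])
      (fun r b c => by simp [Matrix.smul_mulVec]) (fun a b c => by simp [Matrix.add_mulVec])
      (fun r b c => by simp [Matrix.smul_mulVec])
  have key := Lam_of_apply_I hg hJ hb (β := pseudoCurvature G u z) (fun v w => by
    rw [pseudoCurvature_eq hG hu hs]
    have hf := gaugeForm_flat hG hu (Complex.I • v) w
    simp only [hL] at hf
    simp only [hL]
    simp only [I_smul_I_smul, map_neg, LinearMap.neg_apply, hf, mul_neg, neg_mul]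
    simp only [Matrix.smul_mulVec, Matrix.add_mulVec, Matrix.sub_mulVec, Matrix.neg_mulVec]
    match_scalars <;> ring_nf <;> rw [Complex.I_sq] <;> norm_num)
  have e := metricTrace_map (g z) (fun v w => fderiv ℝ (gaugeForm G) z v w)
    ((mulVecL n).flip (u z)).toLinearMap
  rw [key, eulerLagrange_eq hg hJ hG hu, Matrix.smul_mulVec]
  refine (congrArg _ e).trans ?_
  change _ • (metricTrace (g z) (fun v w => fderiv ℝ (gaugeForm G) z v w) *ᵥ u z) = _
  module

theorem isHermitian_fderiv {E : Type*} [NormedAddCommGroup E] [NormedSpace ℝ E]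
    {G : E → Matrix (Fin n) (Fin n) ℂ} {z : E} (hG : DifferentiableAt ℝ G z)
    (hh : ∀ᶠ y in 𝓝 z, (G y).IsHermitian) (v : E) :
    (fderiv ℝ G z v : Matrix (Fin n) (Fin n) ℂ).IsHermitian := by
  have e : (fun y => star (G y)) =ᶠ[𝓝 z] G := by
    filter_upwards [hh] with y hy using hy
  have h2 := e.fderiv_eq (𝕜 := ℝ)
  rw [hG.hasFDerivAt.star.fderiv] at h2
  exact congrArg (fun L : E →L[ℝ] _ => L v) h2

/-- `B = G⁻¹ dG` is self-adjoint with respect to `G`. -/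
theorem adj_gaugeForm {E : Type*} [NormedAddCommGroup E] [NormedSpace ℝ E]
    {G : E → Matrix (Fin n) (Fin n) ℂ} {z : E} (hG : DifferentiableAt ℝ G z)
    (hu : IsUnit (G z).det) (hh : ∀ᶠ y in 𝓝 z, (G y).IsHermitian) (v : E) :
    adj (G z) (gaugeForm G z v) = gaugeForm G z v := by
  have h0 : (G z)ᴴ = G z := hh.self_of_nhds
  rw [adj, gaugeForm_apply, Matrix.conjTranspose_mul, (isHermitian_fderiv hG hh v).eq,
    Matrix.conjTranspose_nonsing_inv, h0, mul_assoc, mul_assoc, Matrix.nonsing_inv_mul _ hu,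
    mul_one]

/-- The energy density `¼ g^{ab} tr(B_a B_b)` of a Gram matrix, where `B = G⁻¹ dG`. -/
def localDensity (g : Cm m → Cm m → ℝ) (G : Cm m → Matrix (Fin n) (Fin n) ℂ) (z : Cm m) : ℝ :=
  metricTrace g fun v w => 1 / 4 * (Matrix.trace (gaugeForm G z v * gaugeForm G z w)).re

theorem normSqForm_eq {g : Cm m → Cm m → ℝ} {G : Cm m → Matrix (Fin n) (Fin n) ℂ}
    {z : Cm m} (hG : DifferentiableAt ℝ G z)
    (hu : IsUnit (G z).det) (hh : ∀ᶠ y in 𝓝 z, (G y).IsHermitian) :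
    normSqForm g (G z) (fun v => theta G z v + thetaBar G z v) = localDensity g G z := by
  have h1 : ∀ v, theta G z v + thetaBar G z v = (-(1 / 2) : ℂ) • gaugeForm G z v := fun v => by
    rw [theta_gauge hG, thetaBar_gauge hG]; module
  have h2 : ∀ v, adj (G z) (theta G z v + thetaBar G z v) = (-(1 / 2) : ℂ) • gaugeForm G z v :=
    fun v => by
      conv_rhs => rw [← adj_gaugeForm hG hu hh v]
      rw [h1, adj, adj]; simp
  rw [normSqForm, localDensity, metricTrace]
  refine Finset.sum_congr rfl fun a _ => Finset.sum_congr rfl fun b _ => ?_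
  rw [h2, h1, smul_eq_mul, smul_mul_smul_comm, Matrix.trace_smul, smul_eq_mul]
  congr 1
  rw [show (-(1 / 2) * -(1 / 2) : ℂ) = ((1 / 4 : ℝ) : ℂ) by norm_num, Complex.re_ofReal_mul]

end Operators

/-! ### The divergence theorem in Kähler coordinates -/

section Kahler

variable {m : ℕ}

theorem contDiff_det {ι : Type*} [Fintype ι] [DecidableEq ι] :
    ContDiff ℝ ∞ (fun A : Matrix ι ι ℝ => A.det) := by
  have h : ∀ i j, ContDiff ℝ ∞ (fun A : Matrix ι ι ℝ => A i j) := fun i j =>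
    (LinearMap.toContinuousLinearMap (Matrix.entryLinearMap ℝ ℝ i j)).contDiff
  simp only [Matrix.det_apply]
  exact ContDiff.sum fun σ _ => (contDiff_prod fun i _ => h _ _).const_smul _

/-- Jacobi's formula. -/
theorem fderiv_det {ι : Type*} [Fintype ι] [DecidableEq ι] {A : Matrix ι ι ℝ}
    (hA : IsUnit A.det) (H : Matrix ι ι ℝ) :
    fderiv ℝ (fun A : Matrix ι ι ℝ => A.det) A H = A.det * (A⁻¹ * H).trace := by
  have hd : DifferentiableAt ℝ (fun A : Matrix ι ι ℝ => A.det) A :=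
    contDiff_det.contDiffAt.differentiableAt (by simp)
  have h1 := hd.hasFDerivAt.hasLineDerivAt H
  have h2 : HasDerivAt (fun t : ℝ => (A + t • H).det) (A.det * (A⁻¹ * H).trace) 0 := by
    have e : ∀ t : ℝ, (A + t • H).det = A.det * (1 + (A⁻¹ * H).trace * t +
        (Matrix.det (1 + (Polynomial.X : Polynomial ℝ) •
          (A⁻¹ * H).map Polynomial.C)).divX.divX.eval t * t ^ 2) := fun t => by
      rw [← Matrix.det_one_add_smul, ← Matrix.det_mul, mul_add, mul_one, Matrix.mul_smul,
        Matrix.mul_nonsing_inv_cancel_left _ _ hA]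
    simp only [e]
    have p := (Polynomial.hasDerivAt (Matrix.det (1 + (Polynomial.X : Polynomial ℝ) •
          (A⁻¹ * H).map Polynomial.C)).divX.divX (0 : ℝ)).mul ((hasDerivAt_id (0 : ℝ)).pow 2)
    have q := ((((hasDerivAt_id (0 : ℝ)).const_mul (A⁻¹ * H).trace).const_add 1).add p).const_mul
      A.det
    exact q.congr_deriv (by simp)
  exact h1.unique h2

/-- The properties at `z` of the coefficients of a Kähler metric in holomorphic coordinates. -/
structure IsKahlerAt (γ : Cm m → Cm m → Cm m → ℝ) (z : Cm m) : Prop where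
  inner : ∀ᶠ y in 𝓝 z, IsInner (γ y)
  invariant : ∀ᶠ y in 𝓝 z, ∀ v w, γ y (Complex.I • v) (Complex.I • w) = γ y v w
  smooth : ∀ v w, ContDiffAt ℝ ∞ (fun y => γ y v w) z
  closed : ∀ u v w : Cm m,
    fderiv ℝ (fun y => fundamentalForm (γ y) v w) z u +
      fderiv ℝ (fun y => fundamentalForm (γ y) w u) z v +
      fderiv ℝ (fun y => fundamentalForm (γ y) u v) z w = 0

variable {γ : Cm m → Cm m → Cm m → ℝ} {z : Cm m}

theorem IsRealBilin.of_fderiv (hb : ∀ᶠ y in 𝓝 z, IsRealBilin (γ y))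
    (hs : ∀ v w, DifferentiableAt ℝ (fun y => γ y v w) z) (u : Cm m) :
    IsRealBilin (fun v w => fderiv ℝ (fun y => γ y v w) z u) := by
  refine .mk' (fun a b c => ?_) (fun r b c => ?_) (fun a b c => ?_) (fun r b c => ?_)
  · have e : (fun y => γ y (a + b) c) =ᶠ[𝓝 z] fun y => γ y a c + γ y b c := by
      filter_upwards [hb] with y ⟨L, hL⟩
      simp [hL]
    rw [e.fderiv_eq, fderiv_fun_add (hs _ _) (hs _ _)]; rfl
  · have e : (fun y => γ y (r • b) c) =ᶠ[𝓝 z] fun y => r • γ y b c := by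
      filter_upwards [hb] with y ⟨L, hL⟩
      simp [hL]
    rw [e.fderiv_eq, fderiv_fun_const_smul (hs _ _)]; rfl
  · have e : (fun y => γ y a (b + c)) =ᶠ[𝓝 z] fun y => γ y a b + γ y a c := by
      filter_upwards [hb] with y ⟨L, hL⟩
      simp [hL]
    rw [e.fderiv_eq, fderiv_fun_add (hs _ _) (hs _ _)]; rfl
  · have e : (fun y => γ y b (r • c)) =ᶠ[𝓝 z] fun y => r • γ y b c := by
      filter_upwards [hb] with y ⟨L, hL⟩
      simp [hL]
    rw [e.fderiv_eq, fderiv_fun_const_smul (hs _ _)]; rfl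

theorem IsKahlerAt.differentiableAt (h : IsKahlerAt γ z) (v w : Cm m) :
    DifferentiableAt ℝ (fun y => γ y v w) z := (h.smooth v w).differentiableAt (by simp)

theorem IsKahlerAt.inner' (h : IsKahlerAt γ z) : IsInner (γ z) := h.inner.self_of_nhds

theorem IsKahlerAt.bilin (h : IsKahlerAt γ z) (u : Cm m) :
    IsRealBilin (fun v w => fderiv ℝ (fun y => γ y v w) z u) :=
  .of_fderiv (h.inner.mono fun _ hy => hy.bilin) h.differentiableAt u

/-- Closedness of the fundamental form in terms of the derivatives of the metric. -/
theorem IsKahlerAt.fderiv_eq (h : IsKahlerAt γ z) (u v w : Cm m) :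
    fderiv ℝ (fun y => γ y v w) z u = fderiv ℝ (fun y => γ y w u) z v +
      fderiv ℝ (fun y => γ y (Complex.I • v) u) z (Complex.I • w) := by
  have hI : ∀ x a b, fderiv ℝ (fun y => γ y (Complex.I • a) (Complex.I • b)) z x =
      fderiv ℝ (fun y => γ y a b) z x := fun x a b => by
    have e : (fun y => γ y (Complex.I • a) (Complex.I • b)) =ᶠ[𝓝 z] fun y => γ y a b := by
      filter_upwards [h.invariant] with y hy using hy a b
    rw [e.fderiv_eq]
  have hsymm : ∀ x a b, fderiv ℝ (fun y => γ y a b) z x = fderiv ℝ (fun y => γ y b a) z x :=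
    fun x a b => by
      have e : (fun y => γ y a b) =ᶠ[𝓝 z] fun y => γ y b a := by
        filter_upwards [h.inner] with y hy using hy.symm a b
      rw [e.fderiv_eq]
  have hneg : ∀ x a b, fderiv ℝ (fun y => γ y (-a) b) z x = -fderiv ℝ (fun y => γ y a b) z x :=
    fun x a b => by
      obtain ⟨L, hL⟩ := h.bilin x
      beta_reduce at hL
      rw [hL, hL]; simp
  have hc := h.closed u v (Complex.I • w)
  simp only [fundamentalForm, I_smul_I_smul, hI] at hc
  have h3 : fderiv ℝ (fun y => γ y (Complex.I • u) v) z (Complex.I • w) =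
      -fderiv ℝ (fun y => γ y (Complex.I • v) u) z (Complex.I • w) := by
    rw [← hI, I_smul_I_smul, hneg, hsymm]
  rw [hneg, h3] at hc
  linarith

/-- The contraction `g^{vw} ∂_u g_{vw} = 2 g^{vw} ∂_v g_{wu}` of the closedness of `ω`, by
invariance of the trace under `J`. -/
theorem IsKahlerAt.trace_eq (h : IsKahlerAt γ z) (u : Cm m) :
    metricTrace (γ z) (fun v w => fderiv ℝ (fun y => γ y v w) z u) =
      2 * metricTrace (γ z) (fun v w => fderiv ℝ (fun y => γ y w u) z v) := by
  rw [metricTrace_congr (h.fderiv_eq u), metricTrace_add, two_mul]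
  congr 1
  have hb : IsRealBilin (fun v w => fderiv ℝ (fun y => γ y v u) z w) := by
    refine .mk' (fun a b c => ?_) (fun r b c => ?_) (fun a b c => by simp) (fun r b c => by simp)
    · obtain ⟨L, hL⟩ := h.bilin c
      simp only [hL]; simp
    · obtain ⟨L, hL⟩ := h.bilin c
      simp only [hL]; simp
  rw [metricTrace_I h.inner' h.invariant.self_of_nhds hb]
  exact metricTrace_swap h.inner' (fun v w => fderiv ℝ (fun y => γ y w u) z v)

theorem IsKahlerAt.contDiffAt_metricMatrix (h : IsKahlerAt γ z) :
    ContDiffAt ℝ ∞ (fun y => metricMatrix (γ y)) z := by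
  have e : (fun y => metricMatrix (γ y)) = fun y => ∑ a, ∑ b,
      γ y (realBasis m a) (realBasis m b) • Matrix.single a b (1 : ℝ) := by
    ext1 y
    conv_lhs => rw [Matrix.matrix_eq_sum_single (metricMatrix (γ y))]
    simp [metricMatrix]
  rw [e]
  exact ContDiffAt.sum fun a _ => ContDiffAt.sum fun b _ => (h.smooth _ _).smul contDiffAt_const

theorem fderiv_real_entry {E ι : Type*} [NormedAddCommGroup E] [NormedSpace ℝ E]
    [Fintype ι] [DecidableEq ι]
    {F : E → Matrix ι ι ℝ} {z : E} (hF : DifferentiableAt ℝ F z)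
    (v : E) (i j : ι) : fderiv ℝ (fun y => F y i j) z v = fderiv ℝ F z v i j := by
  let L : Matrix ι ι ℝ →L[ℝ] ℝ :=
    LinearMap.toContinuousLinearMap (Matrix.entryLinearMap ℝ ℝ i j)
  have h := (L.hasFDerivAt (x := F z)).comp z hF.hasFDerivAt
  change fderiv ℝ (L ∘ F) z v = _
  rw [h.fderiv]
  rfl

theorem _root_.ContDiffAt.real_entry {E ι : Type*} [NormedAddCommGroup E] [NormedSpace ℝ E]
    [Fintype ι] [DecidableEq ι] {k : WithTop ℕ∞}
    {F : E → Matrix ι ι ℝ} {z : E} (hF : ContDiffAt ℝ k F z) (i j : ι) :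
    ContDiffAt ℝ k (fun y => F y i j) z :=
  (LinearMap.toContinuousLinearMap (Matrix.entryLinearMap ℝ ℝ i j)).contDiff.contDiffAt.comp z hF

theorem IsKahlerAt.contDiffAt_inv (h : IsKahlerAt γ z) (a b : Fin 2 × Fin m) :
    ContDiffAt ℝ ∞ (fun y => (metricMatrix (γ y))⁻¹ a b) z := by
  have e : ContDiffAt ℝ ∞ (fun y => (metricMatrix (γ y))⁻¹) z := by
    simp only [Matrix.nonsing_inv_eq_ringInverse]
    exact contDiffAt_ringInverse_comp h.contDiffAt_metricMatrix
      ((Matrix.isUnit_iff_isUnit_det _).2 h.inner'.isUnit_det)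
  exact ContDiffAt.real_entry e a b

/-- The Riemannian density `√det (g_ab)`. -/
def volumeDensity (g : Cm m → Cm m → ℝ) : ℝ := Real.sqrt (metricMatrix g).det

theorem IsInner.volumeDensity_pos {g : Cm m → Cm m → ℝ} (hg : IsInner g) :
    0 < volumeDensity g := Real.sqrt_pos.2 hg.posDef.det_pos

theorem IsKahlerAt.contDiffAt_volumeDensity (h : IsKahlerAt γ z) :
    ContDiffAt ℝ ∞ (fun y => volumeDensity (γ y)) z :=
  (contDiff_det.contDiffAt.comp z h.contDiffAt_metricMatrix).sqrt h.inner'.isUnit_det.ne_zero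

theorem IsKahlerAt.fderiv_metricMatrix (h : IsKahlerAt γ z) (u : Cm m) (a b : Fin 2 × Fin m) :
    (fderiv ℝ (fun y => metricMatrix (γ y)) z u :
      Matrix (Fin 2 × Fin m) (Fin 2 × Fin m) ℝ) a b =
      fderiv ℝ (fun y => γ y (realBasis m a) (realBasis m b)) z u :=
  (fderiv_real_entry (h.contDiffAt_metricMatrix.differentiableAt (by simp)) u a b).symm

theorem IsKahlerAt.fderiv_volumeDensity (h : IsKahlerAt γ z) (u : Cm m) :
    fderiv ℝ (fun y => volumeDensity (γ y)) z u = volumeDensity (γ z) *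
      metricTrace (γ z) (fun v w => fderiv ℝ (fun y => γ y w u) z v) := by
  have hM := h.contDiffAt_metricMatrix.differentiableAt (by simp)
  have hdet := h.inner'.posDef.det_pos
  have hd : DifferentiableAt ℝ (fun A : Matrix (Fin 2 × Fin m) (Fin 2 × Fin m) ℝ => A.det)
      (metricMatrix (γ z)) := contDiff_det.contDiffAt.differentiableAt (by simp)
  have h1 : HasFDerivAt (fun y => (metricMatrix (γ y)).det) _ z :=
    HasFDerivAt.comp z hd.hasFDerivAt hM.hasFDerivAt
  have h2 := h1.sqrt hdet.ne'
  have h3 : fderiv ℝ (fun y => volumeDensity (γ y)) z = _ := h2.fderiv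
  have h4 : ((metricMatrix (γ z))⁻¹ * fderiv ℝ (fun y => metricMatrix (γ y)) z u).trace =
      metricTrace (γ z) (fun v w => fderiv ℝ (fun y => γ y v w) z u) := by
    rw [← metricTrace_swap h.inner' (fun v w => fderiv ℝ (fun y => γ y v w) z u)]
    simp only [Matrix.trace, Matrix.diag, Matrix.mul_apply, metricTrace, h.fderiv_metricMatrix,
      smul_eq_mul]
  rw [h3, smul_apply, ContinuousLinearMap.comp_apply, fderiv_det h.inner'.isUnit_det, h4,
    h.trace_eq, volumeDensity, smul_eq_mul]
  have h5 := Real.mul_self_sqrt hdet.le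
  have h6 := Real.sqrt_pos.2 hdet
  field_simp
  rw [Real.sq_sqrt hdet.le]

/-- Holomorphic coordinates of a Kähler manifold are harmonic: `∂_b (√g g^{ab}) = 0`. The
derivatives of `√g` and of `g^{ab}` are contractions of `∂g`, and they cancel by
`IsKahlerAt.trace_eq`. -/
theorem IsKahlerAt.sum_fderiv_eq_zero (h : IsKahlerAt γ z) (a : Fin 2 × Fin m) :
    ∑ b, fderiv ℝ (fun y => volumeDensity (γ y) * (metricMatrix (γ y))⁻¹ a b) z
      (realBasis m b) = 0 := by
  have hM := h.contDiffAt_metricMatrix.differentiableAt (by simp)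
  have hu : IsUnit (metricMatrix (γ z)) :=
    (Matrix.isUnit_iff_isUnit_det _).2 h.inner'.isUnit_det
  have hinv : ∀ b u, fderiv ℝ (fun y => (metricMatrix (γ y))⁻¹ a b) z u =
      -∑ d, ∑ c, (metricMatrix (γ z))⁻¹ a c *
        fderiv ℝ (fun y => γ y (realBasis m c) (realBasis m d)) z u *
        (metricMatrix (γ z))⁻¹ d b := fun b u => by
    have e : DifferentiableAt ℝ (fun y => (metricMatrix (γ y))⁻¹) z := by
      simp only [Matrix.nonsing_inv_eq_ringInverse]
      exact (contDiffAt_ringInverse_comp h.contDiffAt_metricMatrix hu).differentiableAt (by simp)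
    have e2 := fderiv_ringInverse_comp hM hu u
    simp only [← Matrix.nonsing_inv_eq_ringInverse] at e2
    rw [fderiv_real_entry e, e2, Matrix.neg_apply, Matrix.mul_apply]
    simp only [Matrix.mul_apply, h.fderiv_metricMatrix, Finset.sum_mul]
  have hsymm : ∀ x a b, fderiv ℝ (fun y => γ y a b) z x = fderiv ℝ (fun y => γ y b a) z x :=
    fun x a b => by
      have e : (fun y => γ y a b) =ᶠ[𝓝 z] fun y => γ y b a := by
        filter_upwards [h.inner] with y hy using hy.symm a b
      rw [e.fderiv_eq]
  have h1 : ∀ b, fderiv ℝ (fun y => volumeDensity (γ y) * (metricMatrix (γ y))⁻¹ a b) z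
      (realBasis m b) = volumeDensity (γ z) *
        ((∑ d, ∑ e, (metricMatrix (γ z))⁻¹ a b * ((metricMatrix (γ z))⁻¹ d e *
          fderiv ℝ (fun y => γ y (realBasis m e) (realBasis m b)) z (realBasis m d))) -
        ∑ e, ∑ c, (metricMatrix (γ z))⁻¹ a c * ((metricMatrix (γ z))⁻¹ b e *
          fderiv ℝ (fun y => γ y (realBasis m e) (realBasis m c)) z (realBasis m b))) := fun b => by
    rw [fderiv_fun_mul (h.contDiffAt_volumeDensity.differentiableAt (by simp))
      ((h.contDiffAt_inv a b).differentiableAt (by simp))]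
    simp only [add_apply, smul_apply, smul_eq_mul, hinv, h.fderiv_volumeDensity, metricTrace]
    rw [mul_sub, sub_eq_neg_add, ← mul_neg]
    congr 1
    · congr 2
      refine Finset.sum_congr rfl fun e _ => Finset.sum_congr rfl fun c _ => ?_
      rw [hsymm, h.inner'.inv_symm e b]
      ring
    · rw [mul_left_comm, Finset.mul_sum]
      simp only [Finset.mul_sum]
  simp only [h1, ← Finset.mul_sum, Finset.sum_sub_distrib]
  rw [mul_eq_zero, sub_eq_zero]
  right
  simp only [Finset.mul_sum]
  rw [Finset.sum_comm]
  refine Finset.sum_congr rfl fun d _ => ?_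
  rw [Finset.sum_comm]

/-- The divergence theorem for a compactly supported covector field `A` on a domain of Kähler
coordinates: `∫ g^{ab} ∂_b A_a √g = 0`. -/
theorem integral_divergence_eq_zero {U S : Set (Cm m)} (hS : IsCompact S)
    (hSU : S ⊆ U) (h : ∀ z ∈ U, IsKahlerAt γ z) {A : Fin 2 × Fin m → Cm m → ℝ}
    (hA : ∀ a, ∀ z ∈ U, ContDiffAt ℝ 1 (A a) z) (h0 : ∀ a, ∀ z ∉ S, A a z = 0)
    (μ : Measure (Cm m)) [μ.IsAddHaarMeasure] :
    ∫ z, volumeDensity (γ z) *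
      (∑ a, ∑ b, (metricMatrix (γ z))⁻¹ a b * fderiv ℝ (A a) z (realBasis m b)) ∂μ = 0 := by
  let F : Fin 2 × Fin m → Fin 2 × Fin m → Cm m → ℝ := fun a b z =>
    (volumeDensity (γ z) * (metricMatrix (γ z))⁻¹ a b) * A a z
  have hoff : ∀ z ∉ S, Sᶜ ∈ 𝓝 z := fun z hz => hS.isClosed.isOpen_compl.mem_nhds hz
  have hA0 : ∀ a, ∀ z ∉ S, A a =ᶠ[𝓝 z] fun _ => 0 := fun a z hz => by
    filter_upwards [hoff z hz] with y hy using h0 a y hy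
  have hF0 : ∀ a b, ∀ z ∉ S, F a b =ᶠ[𝓝 z] fun _ => 0 := fun a b z hz => by
    filter_upwards [hA0 a z hz] with y hy
    simp only [F, hy, mul_zero]
  have hF : ∀ a b, ContDiff ℝ 1 (F a b) := fun a b => contDiff_iff_contDiffAt.2 fun z => by
    by_cases hz : z ∈ S
    · have hk := h z (hSU hz)
      exact ((hk.contDiffAt_volumeDensity.of_le (by norm_cast)).mul
        ((hk.contDiffAt_inv a b).of_le (by norm_cast))).mul (hA a z (hSU hz))
    · exact contDiffAt_const.congr_of_eventuallyEq (hF0 a b z hz)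
  have hcs : ∀ a b, HasCompactSupport (F a b) := fun a b =>
    HasCompactSupport.intro hS fun z hz => (hF0 a b z hz).eq_of_nhds
  have hint : ∀ a b v, Integrable (fun z => fderiv ℝ (F a b) z v) μ := fun a b v =>
    (((hF a b).continuous_fderiv (by simp)).clm_apply
      continuous_const).integrable_of_hasCompactSupport
      ((hcs a b).fderiv_apply ℝ v)
  have hzero : ∀ a b v, ∫ z, fderiv ℝ (F a b) z v ∂μ = 0 := fun a b v => by
    have e := integral_mul_fderiv_eq_neg_fderiv_mul_of_integrable (μ := μ) (𝕜 := ℝ)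
      (f := fun _ => (1 : ℝ)) (g := F a b) (v := v) (by simp) (by simpa using hint a b v)
      (by simpa using (hF a b).continuous.integrable_of_hasCompactSupport (hcs a b))
      (fun x _ => differentiableAt_const _) (fun x _ => (hF a b).differentiable (by simp) x)
    simpa using e
  have hpt : ∀ z, volumeDensity (γ z) *
      (∑ a, ∑ b, (metricMatrix (γ z))⁻¹ a b * fderiv ℝ (A a) z (realBasis m b)) =
      ∑ a, ∑ b, fderiv ℝ (F a b) z (realBasis m b) := fun z => by
    by_cases hz : z ∈ S
    · have hk := h z (hSU hz)
      have e : ∀ a b, fderiv ℝ (F a b) z (realBasis m b) =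
          volumeDensity (γ z) * ((metricMatrix (γ z))⁻¹ a b * fderiv ℝ (A a) z (realBasis m b)) +
          A a z * fderiv ℝ (fun y => volumeDensity (γ y) * (metricMatrix (γ y))⁻¹ a b) z
            (realBasis m b) := fun a b => by
        have e1 : DifferentiableAt ℝ
            (fun y => volumeDensity (γ y) * (metricMatrix (γ y))⁻¹ a b) z :=
          (hk.contDiffAt_volumeDensity.mul (hk.contDiffAt_inv a b)).differentiableAt (by simp)
        rw [fderiv_fun_mul e1 ((hA a z (hSU hz)).differentiableAt (by simp))]
        simp only [add_apply, smul_apply, smul_eq_mul]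
        ring
      simp only [e, Finset.sum_add_distrib, ← Finset.mul_sum, hk.sum_fderiv_eq_zero, mul_zero,
        add_zero]
    · have e1 : ∀ a, fderiv ℝ (A a) z = 0 := fun a => by rw [(hA0 a z hz).fderiv_eq]; simp
      have e2 : ∀ a b, fderiv ℝ (F a b) z = 0 := fun a b => by rw [(hF0 a b z hz).fderiv_eq]; simp
      simp [e1, e2]
  simp only [hpt]
  rw [integral_finsetSum _ fun a _ => integrable_finsetSum _ fun b _ => hint a b _]
  refine Finset.sum_eq_zero fun a _ => ?_
  rw [integral_finsetSum _ fun b _ => hint a b _]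
  exact Finset.sum_eq_zero fun b _ => hzero a b _

end Kahler

/-! ### Coordinate changes and the coefficients of the metric -/

section Charts

variable {m : ℕ} {X : Type*} [TopologicalSpace X] [ChartedSpace (Cm m) X]
  [IsManifold 𝓘(ℂ, Cm m) ω X] {φ φ' : OpenPartialHomeomorph X (Cm m)}

theorem contMDiffAt_chart (hφ : φ ∈ atlas (Cm m) X) {x : X} (hx : x ∈ φ.source) :
    ContMDiffAt 𝓘(ℝ, Cm m) 𝓘(ℝ, Cm m) ∞ φ x :=
  contMDiffAt_of_mem_maximalAtlas (StructureGroupoid.subset_maximalAtlas _ hφ) hx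

theorem contMDiffAt_chart_symm (hφ : φ ∈ atlas (Cm m) X) {z : Cm m} (hz : z ∈ φ.target) :
    ContMDiffAt 𝓘(ℝ, Cm m) 𝓘(ℝ, Cm m) ∞ φ.symm z :=
  contMDiffAt_symm_of_mem_maximalAtlas (StructureGroupoid.subset_maximalAtlas _ hφ) hz

/-- The coordinate vector fields of a chart are smooth. -/
theorem contMDiffAt_mfderiv_chart_symm (hφ : φ ∈ atlas (Cm m) X) {z : Cm m} (hz : z ∈ φ.target)
    (v : Cm m) : ContMDiffAt 𝓘(ℝ, Cm m) (𝓘(ℝ, Cm m).prod 𝓘(ℝ, Cm m)) ∞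
      (fun y => TotalSpace.mk' (Cm m) (E := fun x : X => TangentSpace 𝓘(ℝ, Cm m) x) (φ.symm y)
        (mfderiv 𝓘(ℝ, Cm m) 𝓘(ℝ, Cm m) φ.symm y v)) z := by
  have h1 : ContMDiffOn 𝓘(ℝ, Cm m) 𝓘(ℝ, Cm m) ∞ φ.symm φ.target :=
    contMDiffOn_symm_of_mem_maximalAtlas (StructureGroupoid.subset_maximalAtlas _ hφ)
  have h2 := h1.contMDiffOn_tangentMapWithin (m := ∞) (by simp) φ.open_target.uniqueMDiffOn
  have h3 : ContMDiffAt 𝓘(ℝ, Cm m) 𝓘(ℝ, Cm m).tangent ∞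
      (fun y => (⟨y, v⟩ : TangentBundle 𝓘(ℝ, Cm m) (Cm m))) z :=
    contMDiffAt_vectorSpace_iff_contDiffAt.2 contDiffAt_const
  have h4 := (h2.contMDiffAt (x := (⟨z, v⟩ : TangentBundle 𝓘(ℝ, Cm m) (Cm m)))
    ((φ.open_target.preimage (FiberBundle.continuous_proj (Cm m) _)).mem_nhds hz)).comp z h3
  refine h4.congr_of_eventuallyEq ?_
  filter_upwards [φ.open_target.mem_nhds hz] with y hy
  change _ = tangentMapWithin 𝓘(ℝ, Cm m) 𝓘(ℝ, Cm m) φ.symm φ.target ⟨y, v⟩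
  rw [tangentMapWithin, mfderivWithin_of_mem_nhds (φ.open_target.mem_nhds hy)]

theorem contDiffAt_localMetric (g : ContMDiffRiemannianMetric 𝓘(ℝ, Cm m) ∞ (Cm m)
      (fun x : X => TangentSpace 𝓘(ℝ, Cm m) x))
    (hφ : φ ∈ atlas (Cm m) X) {z : Cm m} (hz : z ∈ φ.target) (v w : Cm m) :
    ContDiffAt ℝ ∞ (fun y => localMetric g φ y v w) z := by
  have h1 := g.contMDiff.contMDiffAt.comp z (contMDiffAt_chart_symm hφ hz)
  have h2 := ContMDiffAt.clm_bundle_apply₂ (F₁ := Cm m) (F₂ := Cm m) (F₃ := ℝ)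
    (E₃ := Bundle.Trivial X ℝ) h1
    (contMDiffAt_mfderiv_chart_symm hφ hz v) (contMDiffAt_mfderiv_chart_symm hφ hz w)
  rw [contMDiffAt_totalSpace] at h2
  exact h2.2.contDiffAt

theorem isRealBilin_pullback (B : Cm m →L[ℝ] Cm m →L[ℝ] ℝ) (D : Cm m →L[ℝ] Cm m) :
    IsRealBilin (fun v w => B (D v) (D w)) :=
  .mk' (fun u v w => by simp) (fun r v w => by simp) (fun u v w => by simp) (fun r v w => by simp)

theorem isInner_localMetric (g : ContMDiffRiemannianMetric 𝓘(ℝ, Cm m) ∞ (Cm m)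
      (fun x : X => TangentSpace 𝓘(ℝ, Cm m) x))
    (hφ : φ ∈ atlas (Cm m) X) {z : Cm m} (hz : z ∈ φ.target) : IsInner (localMetric g φ z) where
  bilin := isRealBilin_pullback (g.inner (φ.symm z)) (mfderiv 𝓘(ℝ, Cm m) 𝓘(ℝ, Cm m) φ.symm z)
  symm v w := g.symm _ _ _
  pos v hv := by
    refine g.pos _ _ fun h0 => hv ?_
    have hd : φ.MDifferentiable 𝓘(ℝ, Cm m) 𝓘(ℝ, Cm m) := mdifferentiable_of_mem_atlas hφ
    exact hd.symm.mfderiv_injective hz (h0.trans (map_zero _).symm)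

theorem KahlerMetric.isKahlerAt (g : KahlerMetric m X)
    (hφ : φ ∈ atlas (Cm m) X) {z : Cm m} (hz : z ∈ φ.target) : IsKahlerAt (g.coeff φ) z where
  inner := by
    filter_upwards [φ.open_target.mem_nhds hz] with y hy using isInner_localMetric _ hφ hy
  invariant := by
    filter_upwards [φ.open_target.mem_nhds hz] with y hy using g.invariant φ hφ y hy
  smooth := contDiffAt_localMetric _ hφ hz
  closed := g.closed φ hφ z hz

/-- Coordinate changes are holomorphic. -/
theorem contDiffAt_transition (hφ : φ ∈ atlas (Cm m) X) (hφ' : φ' ∈ atlas (Cm m) X)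
    {y : Cm m} (hy : y ∈ φ'.target) (hy' : φ'.symm y ∈ φ.source) :
    ContDiffAt ℂ ∞ (φ ∘ φ'.symm) y := by
  have h1 : ContMDiffAt 𝓘(ℂ, Cm m) 𝓘(ℂ, Cm m) ∞ φ'.symm y :=
    contMDiffAt_symm_of_mem_maximalAtlas (StructureGroupoid.subset_maximalAtlas _ hφ') hy
  have h2 : ContMDiffAt 𝓘(ℂ, Cm m) 𝓘(ℂ, Cm m) ∞ φ (φ'.symm y) :=
    contMDiffAt_of_mem_maximalAtlas (StructureGroupoid.subset_maximalAtlas _ hφ) hy'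
  exact (h2.comp y h1).contDiffAt

theorem eventually_mem_overlap {X : Type*} [TopologicalSpace X]
    {φ φ' : OpenPartialHomeomorph X (Cm m)} {y : Cm m}
    (hy : y ∈ φ'.target) (hy' : φ'.symm y ∈ φ.source) :
    ∀ᶠ x in 𝓝 y, x ∈ φ'.target ∧ φ'.symm x ∈ φ.source :=
  (φ'.open_target.eventually_mem hy).and
    ((φ'.continuousAt_symm hy).eventually (φ.open_source.mem_nhds hy'))

theorem fderiv_transition_I (hφ : φ ∈ atlas (Cm m) X) (hφ' : φ' ∈ atlas (Cm m) X)
    {y : Cm m} (hy : y ∈ φ'.target) (hy' : φ'.symm y ∈ φ.source) (v : Cm m) :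
    fderiv ℝ (φ ∘ φ'.symm) y (Complex.I • v) = Complex.I • fderiv ℝ (φ ∘ φ'.symm) y v := by
  have h := (contDiffAt_transition hφ hφ' hy hy').differentiableAt (by simp)
  rw [h.fderiv_restrictScalars ℝ]
  simp

/-- The second derivative of a holomorphic map is complex bilinear. -/
theorem fderiv_fderiv_transition_I (hφ : φ ∈ atlas (Cm m) X) (hφ' : φ' ∈ atlas (Cm m) X)
    {y : Cm m} (hy : y ∈ φ'.target) (hy' : φ'.symm y ∈ φ.source) (v w : Cm m) :
    fderiv ℝ (fderiv ℝ (φ ∘ φ'.symm)) y (Complex.I • v) (Complex.I • w) =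
      -fderiv ℝ (fderiv ℝ (φ ∘ φ'.symm)) y v w := by
  set τ : Cm m → Cm m := φ ∘ φ'.symm with hτdef
  have hτ : ContDiffAt ℝ ∞ τ y := (contDiffAt_transition hφ hφ' hy hy').restrict_scalars ℝ
  have hd : DifferentiableAt ℝ (fderiv ℝ τ) y :=
    (hτ.fderiv_right (m := 1) (by norm_cast)).differentiableAt (by simp)
  have hs : ∀ v w, fderiv ℝ (fderiv ℝ τ) y v w = fderiv ℝ (fderiv ℝ τ) y w v := fun v w =>
    (hτ.isSymmSndFDerivAt (by simp; norm_cast)) v w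
  have hI : ∀ v w, fderiv ℝ (fderiv ℝ τ) y v (Complex.I • w) =
      Complex.I • fderiv ℝ (fderiv ℝ τ) y v w := fun v w => by
    have e : (fun x => fderiv ℝ τ x (Complex.I • w)) =ᶠ[𝓝 y]
        fun x => Complex.I • fderiv ℝ τ x w := by
      filter_upwards [eventually_mem_overlap hy hy'] with x hx
      exact fderiv_transition_I hφ hφ' hx.1 hx.2 w
    rw [← fderiv_clm_const hd, e.fderiv_eq,
      fderiv_fun_const_smul (hd.clm_apply (differentiableAt_const w)), ← fderiv_clm_const hd]
    rfl
  rw [hI, hs, hI, hs w v, I_smul_I_smul]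

theorem localMetric_transition (g : ContMDiffRiemannianMetric 𝓘(ℝ, Cm m) ∞ (Cm m)
      (fun x : X => TangentSpace 𝓘(ℝ, Cm m) x))
    (hφ : φ ∈ atlas (Cm m) X) (hφ' : φ' ∈ atlas (Cm m) X)
    {y : Cm m} (hy : y ∈ φ'.target) (hy' : φ'.symm y ∈ φ.source) (v w : Cm m) :
    localMetric g φ' y v w = localMetric g φ (φ (φ'.symm y))
      (fderiv ℝ (φ ∘ φ'.symm) y v) (fderiv ℝ (φ ∘ φ'.symm) y w) := by
  have hτ : DifferentiableAt ℝ (φ ∘ φ'.symm) y :=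
    ((contDiffAt_transition hφ hφ' hy hy').restrict_scalars ℝ).differentiableAt (by simp)
  have e : φ'.symm =ᶠ[𝓝 y] φ.symm ∘ (φ ∘ φ'.symm) := by
    filter_upwards [eventually_mem_overlap hy hy'] with x hx
    exact (φ.left_inv hx.2).symm
  have hm : MDifferentiableAt 𝓘(ℝ, Cm m) 𝓘(ℝ, Cm m) φ.symm ((φ ∘ φ'.symm) y) :=
    (contMDiffAt_chart_symm hφ (φ.map_source hy')).mdifferentiableAt (by simp)
  have h1 := (hm.hasMFDerivAt.comp y hτ.mdifferentiableAt.hasMFDerivAt).congr_of_eventuallyEq e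
  have h2 : ∀ u : Cm m, (mfderiv 𝓘(ℝ, Cm m) 𝓘(ℝ, Cm m) φ'.symm y u : Cm m) =
      (mfderiv 𝓘(ℝ, Cm m) 𝓘(ℝ, Cm m) φ.symm (φ (φ'.symm y))
        (fderiv ℝ (φ ∘ φ'.symm) y u) : Cm m) := fun u => by
    rw [h1.mfderiv, mfderiv_eq_fderiv]; rfl
  have h3 : ∀ x x' : X, x = x' → ∀ a b : Cm m, (g.inner x : Cm m →L[ℝ] Cm m →L[ℝ] ℝ) a b =
      (g.inner x' : Cm m →L[ℝ] Cm m →L[ℝ] ℝ) a b := by rintro x _ rfl a b; rfl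
  have h4 := h3 _ _ (φ.left_inv hy').symm
  refine (h4 _ _).trans ?_
  rw [h2, h2]
  rfl

theorem isUnit_det_transition (hφ : φ ∈ atlas (Cm m) X) (hφ' : φ' ∈ atlas (Cm m) X)
    {y : Cm m} (hy : y ∈ φ'.target) (hy' : φ'.symm y ∈ φ.source) :
    IsUnit (LinearMap.det (fderiv ℝ (φ ∘ φ'.symm) y : Cm m →ₗ[ℝ] Cm m)) := by
  have hτ : DifferentiableAt ℝ (φ ∘ φ'.symm) y :=
    ((contDiffAt_transition hφ hφ' hy hy').restrict_scalars ℝ).differentiableAt (by simp)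
  have hτ' : DifferentiableAt ℝ (φ' ∘ φ.symm) ((φ ∘ φ'.symm) y) := by
    refine ((contDiffAt_transition hφ' hφ (φ.map_source hy') ?_).restrict_scalars
      ℝ).differentiableAt (by simp)
    rw [φ.left_inv hy']; exact φ'.map_target hy
  have e : (φ' ∘ φ.symm) ∘ (φ ∘ φ'.symm) =ᶠ[𝓝 y] id := by
    filter_upwards [eventually_mem_overlap hy hy'] with x hx
    simp [φ.left_inv hx.2, φ'.right_inv hx.1]
  have h := hτ'.hasFDerivAt.comp y hτ.hasFDerivAt
  have h2 : (fderiv ℝ (φ' ∘ φ.symm) ((φ ∘ φ'.symm) y)).comp (fderiv ℝ (φ ∘ φ'.symm) y) =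
      ContinuousLinearMap.id ℝ (Cm m) := h.unique ((hasFDerivAt_id y).congr_of_eventuallyEq e)
  have h3 := congrArg (fun L : Cm m →L[ℝ] Cm m => LinearMap.det (L : Cm m →ₗ[ℝ] Cm m)) h2
  simp only [ContinuousLinearMap.toLinearMap_comp, LinearMap.det_comp,
    ContinuousLinearMap.coe_id, LinearMap.det_id] at h3
  exact IsUnit.of_mul_eq_one_right _ h3

end Charts

/-! ### The Riemannian measure -/

section Volume

variable {m : ℕ} {X : Type*} [TopologicalSpace X] [ChartedSpace (Cm m) X]
  [IsManifold 𝓘(ℂ, Cm m) ω X] {φ φ' : OpenPartialHomeomorph X (Cm m)}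

theorem continuousOn_volumeDensity (g : KahlerMetric m X) (hφ : φ ∈ atlas (Cm m) X) :
    ContinuousOn (fun z => volumeDensity (g.coeff φ z)) φ.target := fun _ hz =>
  (g.isKahlerAt hφ hz).contDiffAt_volumeDensity.continuousAt.continuousWithinAt

/-- The densities of two charts differ by the Jacobian determinant of the coordinate change. -/
theorem volumeDensity_transition (g : KahlerMetric m X) (hφ : φ ∈ atlas (Cm m) X)
    (hφ' : φ' ∈ atlas (Cm m) X) {y : Cm m} (hy : y ∈ φ'.target) (hy' : φ'.symm y ∈ φ.source) :
    volumeDensity (g.coeff φ' y) = |(fderiv ℝ (φ ∘ φ'.symm) y).det| *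
      volumeDensity (g.coeff φ (φ (φ'.symm y))) := by
  have e : g.coeff φ' y = fun v w => g.coeff φ (φ (φ'.symm y))
      ((fderiv ℝ (φ ∘ φ'.symm) y : Cm m →ₗ[ℝ] Cm m) v)
      ((fderiv ℝ (φ ∘ φ'.symm) y : Cm m →ₗ[ℝ] Cm m) w) := by
    ext v w; exact localMetric_transition g.metric hφ hφ' hy hy' v w
  have hb := (g.isKahlerAt hφ (φ.map_source hy')).inner'.bilin
  rw [volumeDensity, e, metricMatrix_comp hb, Matrix.det_mul, Matrix.det_mul,
    Matrix.det_transpose, LinearMap.det_toMatrix, mul_right_comm, Real.sqrt_mul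
      (mul_self_nonneg _), Real.sqrt_mul_self_eq_abs]
  rfl

variable [MeasurableSpace X] [BorelSpace X]

theorem measurableSet_chart_inter {X : Type*} [TopologicalSpace X] [MeasurableSpace X]
    [BorelSpace X] {φ : OpenPartialHomeomorph X (Cm m)} {A : Set X} (hA : MeasurableSet A) :
    MeasurableSet (φ.target ∩ φ.symm ⁻¹' A) := by
  have h : Measurable (φ.target.domRestrict φ.symm) :=
    (continuousOn_iff_continuous_domRestrict.1 φ.continuousOn_symm).measurable
  have e : φ.target ∩ φ.symm ⁻¹' A = Subtype.val '' (φ.target.domRestrict φ.symm ⁻¹' A) := by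
    ext z; simp [Set.domRestrict, and_comm]
  rw [e]
  exact φ.open_target.measurableSet.subtype_image (h hA)

theorem aemeasurable_chart_symm (g : KahlerMetric m X) :
    AEMeasurable φ.symm (((realBasis m).addHaar.restrict φ.target).withDensity fun z =>
      ENNReal.ofReal (volumeDensity (g.coeff φ z))) :=
  (φ.continuousOn_symm.aemeasurable φ.open_target.measurableSet).mono_ac
    (withDensity_absolutelyContinuous _ _)

theorem chartVolume_apply (g : KahlerMetric m X) {A : Set X} (hA : MeasurableSet A) :
    g.chartVolume φ A = ∫⁻ z in φ.target ∩ φ.symm ⁻¹' A,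
      ENNReal.ofReal (volumeDensity (g.coeff φ z)) ∂(realBasis m).addHaar := by
  change Measure.map φ.symm (((realBasis m).addHaar.restrict φ.target).withDensity fun z =>
      ENNReal.ofReal (volumeDensity (g.coeff φ z))) A = _
  rw [Measure.map_apply_of_aemeasurable (aemeasurable_chart_symm g) hA, withDensity_apply',
    Measure.restrict_restrict' φ.open_target.measurableSet, inter_comm]

theorem chartVolume_inter_source (g : KahlerMetric m X) {A : Set X} (hA : MeasurableSet A) :
    g.chartVolume φ (A ∩ φ.source) = g.chartVolume φ A := by
  rw [chartVolume_apply g hA, chartVolume_apply g (hA.inter φ.open_source.measurableSet)]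
  congr 2
  ext z
  simp only [mem_inter_iff, mem_preimage]
  exact ⟨fun h => ⟨h.1, h.2.1⟩, fun h => ⟨h.1, h.2, φ.map_target h.1⟩⟩

/-- The measures of two charts agree on the intersection of their domains: the change of variables
formula, with `volumeDensity_transition`. -/
theorem chartVolume_eq (g : KahlerMetric m X) (hφ : φ ∈ atlas (Cm m) X)
    (hφ' : φ' ∈ atlas (Cm m) X) {A : Set X} (hA : MeasurableSet A) (h1 : A ⊆ φ.source)
    (h2 : A ⊆ φ'.source) : g.chartVolume φ' A = g.chartVolume φ A := by
  have himg : (φ ∘ φ'.symm) '' (φ'.target ∩ φ'.symm ⁻¹' A) = φ.target ∩ φ.symm ⁻¹' A := by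
    ext z
    constructor
    · rintro ⟨y, ⟨_, hy2⟩, rfl⟩
      exact ⟨φ.map_source (h1 hy2), by simpa [φ.left_inv (h1 hy2)] using hy2⟩
    · rintro ⟨hz1, hz2⟩
      refine ⟨φ' (φ.symm z), ⟨φ'.map_source (h2 hz2), ?_⟩, ?_⟩
      · simpa [φ'.left_inv (h2 hz2)] using hz2
      · simp [φ'.left_inv (h2 hz2), φ.right_inv hz1]
  have hinj : InjOn (φ ∘ φ'.symm) (φ'.target ∩ φ'.symm ⁻¹' A) := fun y hy y' hy' h =>
    φ'.symm.injOn hy.1 hy'.1 (φ.injOn (h1 hy.2) (h1 hy'.2) h)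
  have hd : ∀ y ∈ φ'.target ∩ φ'.symm ⁻¹' A, HasFDerivWithinAt (φ ∘ φ'.symm)
      (fderiv ℝ (φ ∘ φ'.symm) y) (φ'.target ∩ φ'.symm ⁻¹' A) y := fun y hy =>
    (((contDiffAt_transition hφ hφ' hy.1 (h1 hy.2)).restrict_scalars ℝ).differentiableAt
      (by simp)).hasFDerivAt.hasFDerivWithinAt
  rw [chartVolume_apply g hA, chartVolume_apply g hA, ← himg,
    lintegral_image_eq_lintegral_abs_det_fderiv_mul _ (measurableSet_chart_inter hA) hd hinj]
  refine setLIntegral_congr_fun (measurableSet_chart_inter hA) fun y hy => ?_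
  beta_reduce
  rw [volumeDensity_transition g hφ hφ' hy.1 (h1 hy.2), ENNReal.ofReal_mul (abs_nonneg _)]
  rfl

/-- The Riemannian measure restricts to the measure of a chart on its domain. -/
theorem volume_restrict_source (g : KahlerMetric m X) (hφ : φ ∈ atlas (Cm m) X) :
    g.volume.restrict φ.source = g.chartVolume φ := by
  have hs := φ.open_source.measurableSet
  have hle : ∀ φ' ∈ atlas (Cm m) X, g.chartVolume φ' ≤ g.volume := fun φ' hφ' =>
    le_iSup₂ (f := fun φ (_ : φ ∈ atlas (Cm m) X) => g.chartVolume φ) φ' hφ'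
  -- The sum on the right dominates the measure of every chart `φ'`: inside the domain of `φ` the
  -- two chart measures agree, and outside of it `φ'` is bounded by the supremum.
  have hub : g.volume ≤ g.chartVolume φ + g.volume.restrict φ.sourceᶜ := by
    refine iSup₂_le fun φ' hφ' => Measure.le_iff.2 fun A hA => ?_
    rw [← measure_inter_add_sdiff A hs, Measure.add_apply, Measure.restrict_apply hA]
    refine add_le_add ?_ (hle φ' hφ' _)
    rw [← chartVolume_inter_source g (hA.inter hs), chartVolume_eq g hφ hφ'
      ((hA.inter hs).inter φ'.open_source.measurableSet)
      (inter_subset_left.trans inter_subset_right) inter_subset_right]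
    exact measure_mono (inter_subset_left.trans inter_subset_left)
  refine le_antisymm (Measure.le_iff.2 fun A hA => ?_) (Measure.le_iff.2 fun A hA => ?_)
  · rw [Measure.restrict_apply hA]
    refine (hub _).trans ?_
    rw [Measure.add_apply, Measure.restrict_apply (hA.inter hs), chartVolume_inter_source g hA]
    simp [inter_assoc]
  · rw [Measure.restrict_apply hA, ← chartVolume_inter_source g hA]
    exact hle φ hφ _

theorem integral_volume_eq (g : KahlerMetric m X) (hφ : φ ∈ atlas (Cm m) X) {f : X → ℝ}
    (hf : Continuous f) (h0 : ∀ x ∉ φ.source, f x = 0) :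
    ∫ x, f x ∂g.volume = ∫ z in φ.target, volumeDensity (g.coeff φ z) * f (φ.symm z)
      ∂(realBasis m).addHaar := by
  rw [← setIntegral_eq_integral_of_forall_compl_eq_zero h0, volume_restrict_source g hφ]
  change ∫ x, f x ∂Measure.map φ.symm (((realBasis m).addHaar.restrict φ.target).withDensity
    fun z => ENNReal.ofReal (volumeDensity (g.coeff φ z))) = _
  rw [integral_map (aemeasurable_chart_symm g) hf.measurable.aestronglyMeasurable,
    integral_withDensity_eq_integral_toReal_smul₀ _ (by simp)]
  · refine integral_congr_ae (.of_forall fun z => ?_)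
    simp only [smul_eq_mul]
    rw [ENNReal.toReal_ofReal (show 0 ≤ volumeDensity _ from Real.sqrt_nonneg _)]
  · exact ((continuousOn_volumeDensity g hφ).aemeasurable
      φ.open_target.measurableSet).ennreal_ofReal

instance (g : KahlerMetric m X) : IsLocallyFiniteMeasure g.volume where
  finiteAtNhds x := by
    set φ := chartAt (Cm m) x with hφdef
    have hφ : φ ∈ atlas (Cm m) X := chart_mem_atlas _ _
    have hx : x ∈ φ.source := mem_chart_source _ _
    obtain ⟨C, hC, hxC, hCt⟩ := exists_compact_subset φ.open_target (φ.map_source hx)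
    have ho : IsOpen (φ.source ∩ φ ⁻¹' interior C) :=
      φ.isOpen_inter_preimage isOpen_interior
    refine ⟨_, ho.mem_nhds ⟨hx, hxC⟩, ?_⟩
    obtain ⟨M, hM⟩ := hC.bddAbove_image ((continuousOn_volumeDensity g hφ).mono hCt)
    have h1 : g.volume (φ.source ∩ φ ⁻¹' interior C) =
        g.chartVolume φ (φ.source ∩ φ ⁻¹' interior C) := by
      rw [← volume_restrict_source g hφ, Measure.restrict_apply ho.measurableSet]
      congr 1
      ext y; simp; tauto
    rw [h1, chartVolume_apply g ho.measurableSet]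
    refine lt_of_le_of_lt (lintegral_mono_set (t := C) ?_) ?_
    · rintro z ⟨hz1, hz2⟩
      have := hz2.2
      simp only [mem_preimage, φ.right_inv hz1] at this
      exact interior_subset this
    · refine lt_of_le_of_lt (setLIntegral_mono (g := fun _ => ENNReal.ofReal M) (by fun_prop)
        fun z hz => ENNReal.ofReal_le_ofReal (hM (mem_image_of_mem _ hz))) ?_
      rw [setLIntegral_const]
      exact ENNReal.mul_lt_top (by simp) hC.measure_lt_top

end Volume

/-! ### Flat frames -/

section Frames

variable {n : ℕ} {X : Type*} [TopologicalSpace X]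
  {V : X → Type*} [∀ x, AddCommGroup (V x)] [∀ x, Module ℂ (V x)]
  [∀ x, TopologicalSpace (V x)] [TopologicalSpace (TotalSpace (Fin n → ℂ) V)]
  [FiberBundle (Fin n → ℂ) V] [VectorBundle ℂ (Fin n → ℂ) V]

/-- The coordinates in a frame, as a linear equivalence. -/
def frameEquiv (e : Frame n V) [MemTrivializationAtlas e] {y : X} (hy : y ∈ e.baseSet) :
    V y ≃ₗ[ℂ] (Fin n → ℂ) :=
  e.linearEquivAt ℂ y hy

theorem frameEquiv_apply (e : Frame n V) [MemTrivializationAtlas e] {y : X} (hy : y ∈ e.baseSet)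
    (v : V y) : frameEquiv e hy v = (e ⟨y, v⟩).2 := rfl

theorem frameEquiv_symm_apply (e : Frame n V) [MemTrivializationAtlas e] {y : X}
    (hy : y ∈ e.baseSet) (w : Fin n → ℂ) : (frameEquiv e hy).symm w = e.symm y w := rfl

theorem endMatrix_eq (h : ∀ x, V x →ₗ[ℂ] V x) (e : Frame n V) [MemTrivializationAtlas e] {y : X}
    (hy : y ∈ e.baseSet) :
    endMatrix h e y = LinearMap.toMatrix' ((frameEquiv e hy).conj (h y)) := by
  ext i j
  simp [endMatrix, LinearMap.toMatrix'_apply, LinearEquiv.conj_apply, frameEquiv_apply,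
    frameEquiv_symm_apply]

theorem pairing_frame (K : ∀ x, V x →ₗ[ℂ] V x →ₗ⋆[ℂ] ℂ) (e : Frame n V)
    [MemTrivializationAtlas e] {y : X} (hy : y ∈ e.baseSet) (a b : Fin n → ℂ) :
    K y ((frameEquiv e hy).symm a) ((frameEquiv e hy).symm b) = star b ⬝ᵥ (gram K e y *ᵥ a) := by
  have h : ∀ a : Fin n → ℂ, (frameEquiv e hy).symm a =
      ∑ j, a j • (frameEquiv e hy).symm (Pi.single j 1) := fun a => by
    have e1 : a = ∑ j, a j • (Pi.single j 1 : Fin n → ℂ) := by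
      ext i; simp [Finset.sum_apply, Pi.single_apply]
    conv_lhs => rw [e1]
    simp only [map_sum, map_smul]
  rw [h a, h b]
  simp only [map_sum, LinearMap.sum_apply, map_smul, LinearMap.map_smulₛₗ, LinearMap.smul_apply,
    frameEquiv_symm_apply, smul_eq_mul, dotProduct, Matrix.mulVec, gram, Matrix.of_apply,
    Finset.mul_sum, Pi.star_apply]
  refine Finset.sum_congr rfl fun i _ => Finset.sum_congr rfl fun j _ => ?_
  simp only [starRingEnd_apply]
  ring

theorem gram_comp (K : ∀ x, V x →ₗ[ℂ] V x →ₗ⋆[ℂ] ℂ) (A : ∀ x, V x →ₗ[ℂ] V x) (e : Frame n V)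
    [MemTrivializationAtlas e] {y : X} (hy : y ∈ e.baseSet) :
    gram (fun x => (K x).comp (A x)) e y = gram K e y * endMatrix A e y := by
  ext i j
  have h1 : A y ((frameEquiv e hy).symm (Pi.single j 1)) =
      (frameEquiv e hy).symm (fun k => endMatrix A e y k j) := by
    rw [LinearEquiv.eq_symm_apply]; rfl
  have h2 := pairing_frame K e hy (fun k => endMatrix A e y k j) (Pi.single i 1)
  rw [← h1] at h2
  change K y (A y ((frameEquiv e hy).symm (Pi.single j 1)))
    ((frameEquiv e hy).symm (Pi.single i 1)) = _
  rw [h2, Matrix.mul_apply, ← Pi.single_star, star_one, single_one_dotProduct]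
  rfl

/-- The exponential of an endomorphism of a fiber, defined in the preferred frame, is the
exponential of the matrix in every frame. -/
theorem endMatrix_fiberExp (h : ∀ x, V x →ₗ[ℂ] V x) (e : Frame n V) [MemTrivializationAtlas e]
    {y : X} (hy : y ∈ e.baseSet) :
    endMatrix (fun x => fiberExp (n := n) x (h x)) e y = NormedSpace.exp (endMatrix h e y) := by
  have hy0 := FiberBundle.mem_baseSet_trivializationAt' (F := Fin n → ℂ) (E := V) y
  rw [endMatrix_eq _ e hy, endMatrix_eq _ e hy]
  set L := frameEquiv e hy
  set L₀ := frameEquiv (trivializationAt (Fin n → ℂ) V y) hy0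
  have h0 : fiberExp (n := n) y (h y) = L₀.symm.conj (Matrix.toLin' (NormedSpace.exp
      (LinearMap.toMatrix' (L₀.conj (h y))))) := rfl
  set Q : Matrix (Fin n) (Fin n) ℂ := LinearMap.toMatrix' (L₀.symm.trans L).toLinearMap
  set Q' : Matrix (Fin n) (Fin n) ℂ := LinearMap.toMatrix' (L.symm.trans L₀).toLinearMap
  have hQQ' : Q * Q' = 1 := by
    rw [← LinearMap.toMatrix'_comp, ← LinearMap.toMatrix'_id]
    congr 1; ext; simp
  have hQ'Q : Q' * Q = 1 := mul_eq_one_comm.1 hQQ'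
  have hQ : Q⁻¹ = Q' := Matrix.inv_eq_right_inv hQQ'
  have hu : IsUnit Q := ⟨⟨Q, Q', hQQ', hQ'Q⟩, rfl⟩
  have hconj : ∀ B : Matrix (Fin n) (Fin n) ℂ,
      LinearMap.toMatrix' (L.conj (L₀.symm.conj (Matrix.toLin' B))) = Q * B * Q⁻¹ := fun B => by
    rw [hQ]
    conv_rhs => rw [← LinearMap.toMatrix'_toLin' B]
    rw [← LinearMap.toMatrix'_comp, ← LinearMap.toMatrix'_comp]
    congr 1
  have h2 : L.conj (h y) = L.conj (L₀.symm.conj (Matrix.toLin' (LinearMap.toMatrix'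
      (L₀.conj (h y))))) := by
    rw [Matrix.toLin'_toMatrix']
    congr 1
    ext v; simp [LinearEquiv.conj_apply]
  rw [h0, hconj, h2, hconj, Matrix.exp_conj _ _ hu]

theorem gram_expVariation (K : ∀ x, V x →ₗ[ℂ] V x →ₗ⋆[ℂ] ℂ) (h : ∀ x, V x →ₗ[ℂ] V x) (t : ℝ)
    (e : Frame n V) [MemTrivializationAtlas e] {y : X} (hy : y ∈ e.baseSet) :
    gram (expVariation n K h t) e y = gram K e y * NormedSpace.exp (t • endMatrix h e y) := by
  have h1 : endMatrix (fun x => (t : ℂ) • h x) e y = t • endMatrix h e y := by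
    rw [endMatrix_eq _ e hy, endMatrix_eq _ e hy, map_smul, map_smul]
    exact Complex.coe_smul _ _
  rw [← h1, ← endMatrix_fiberExp _ e hy]
  exact gram_comp K _ e hy

variable [IsFlatBundle n V]

/-- Any two flat frames differ, near each point, by a constant matrix. -/
theorem exists_frame_change (e e' : Frame n V) [MemTrivializationAtlas e]
    [MemTrivializationAtlas e'] {x : X} (hx : x ∈ e.baseSet) (hx' : x ∈ e'.baseSet) :
    ∃ P : Matrix (Fin n) (Fin n) ℂ, IsUnit P.det ∧ ∀ᶠ y in 𝓝 x,
      (∀ K : ∀ x, V x →ₗ[ℂ] V x →ₗ⋆[ℂ] ℂ, gram K e' y = Pᴴ * gram K e y * P) ∧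
      (∀ h : ∀ x, V x →ₗ[ℂ] V x, endMatrix h e' y = P⁻¹ * endMatrix h e y * P) := by
  set T := ((frameEquiv e' hx').symm.trans (frameEquiv e hx)) with hT
  set P : Matrix (Fin n) (Fin n) ℂ := LinearMap.toMatrix' T.toLinearMap with hP
  set P' : Matrix (Fin n) (Fin n) ℂ := LinearMap.toMatrix' T.symm.toLinearMap with hP'
  have hPP' : P * P' = 1 := by
    rw [← LinearMap.toMatrix'_comp, ← LinearMap.toMatrix'_id]
    congr 1; ext; simp
  have hu : IsUnit P.det := by
    rw [← Matrix.isUnit_iff_isUnit_det]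
    exact ⟨⟨P, P', hPP', mul_eq_one_comm.1 hPP'⟩, rfl⟩
  refine ⟨P, hu, ?_⟩
  filter_upwards [IsFlatBundle.locally_constant (n := n) (V := V) e' e x ⟨hx', hx⟩,
    e.open_baseSet.mem_nhds hx, e'.open_baseSet.mem_nhds hx'] with y hy hye hye'
  have h1 : ∀ w, (frameEquiv e' hye').symm w = (frameEquiv e hye).symm (P *ᵥ w) := fun w => by
    rw [LinearEquiv.eq_symm_apply]
    refine (hy w).trans ?_
    rw [hP, ← Matrix.toLin'_apply, Matrix.toLin'_toMatrix']
    rfl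
  refine ⟨fun K => ?_, fun h => ?_⟩
  · ext i j
    have h2 : gram K e' y i j = K y ((frameEquiv e' hye').symm (Pi.single j 1))
      ((frameEquiv e' hye').symm (Pi.single i 1)) := rfl
    rw [h2, h1, h1, pairing_frame, Matrix.star_mulVec, ← Matrix.dotProduct_mulVec,
      Matrix.mulVec_mulVec, Matrix.mulVec_mulVec, ← Pi.single_star, star_one,
      single_one_dotProduct, Matrix.mulVec_single_one]
    rw [mul_assoc]
    rfl
  · have h3 : P * endMatrix h e' y = endMatrix h e y * P := by
      have h4 : ∀ w, (frameEquiv e' hye').symm w = (frameEquiv e hye).symm (T w) := fun w => by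
        rw [h1, hP, ← Matrix.toLin'_apply, Matrix.toLin'_toMatrix']; rfl
      have h5 : ∀ v, T (frameEquiv e' hye' v) = frameEquiv e hye v := fun v => by
        rw [← LinearEquiv.symm_apply_eq, ← h4, LinearEquiv.symm_apply_apply]
      rw [endMatrix_eq h e hye, endMatrix_eq h e' hye', hP, ← LinearMap.toMatrix'_comp,
        ← LinearMap.toMatrix'_comp]
      congr 1
      refine LinearMap.ext fun w => ?_
      change T (frameEquiv e' hye' (h y ((frameEquiv e' hye').symm w))) =
        frameEquiv e hye (h y ((frameEquiv e hye).symm (T w)))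
      rw [h5, h4]
    rw [mul_assoc, ← h3, ← mul_assoc, Matrix.nonsing_inv_mul _ hu, one_mul]

end Frames

/-! ### Hermitian metrics in charts and flat frames -/

section Hermitian

open scoped ComplexOrder

variable {m n : ℕ} {X : Type*} [TopologicalSpace X]
  {V : X → Type*} [∀ x, AddCommGroup (V x)] [∀ x, Module ℂ (V x)]
  [∀ x, TopologicalSpace (V x)] [TopologicalSpace (TotalSpace (Fin n → ℂ) V)]
  [FiberBundle (Fin n → ℂ) V] [VectorBundle ℂ (Fin n → ℂ) V]

theorem contMDiffOn_matrix [ChartedSpace (Cm m) X] {F : X → Matrix (Fin n) (Fin n) ℂ} {s : Set X}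
    (hF : ∀ i j, ContMDiffOn 𝓘(ℝ, Cm m) 𝓘(ℝ, ℂ) ∞ (fun x => F x i j) s) :
    ContMDiffOn 𝓘(ℝ, Cm m) 𝓘(ℝ, Matrix (Fin n) (Fin n) ℂ) ∞ F s := by
  have h1 : ContDiff ℝ ∞ fun f : Fin n → Fin n → ℂ => Matrix.of f :=
    (LinearMap.toContinuousLinearMap
      (Matrix.ofLinearEquiv ℝ (m := Fin n) (n := Fin n) (α := ℂ)).toLinearMap).contDiff
  have h2 : ContMDiffOn 𝓘(ℝ, Cm m) 𝓘(ℝ, Fin n → Fin n → ℂ) ∞ (fun x i j => F x i j) s :=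
    contMDiffOn_pi_space.2 fun i => contMDiffOn_pi_space.2 (hF i)
  exact h1.contMDiff.comp_contMDiffOn h2

theorem contDiff_matrix_exp : ContDiff ℝ ∞ (NormedSpace.exp : Matrix (Fin n) (Fin n) ℂ → _) :=
  contDiff_iff_contDiffAt.2 fun A => (NormedSpace.exp_analytic (𝕂 := ℝ) A).contDiffAt

variable [ChartedSpace (Cm m) X] {K : ∀ x, V x →ₗ[ℂ] V x →ₗ⋆[ℂ] ℂ} {h : ∀ x, V x →ₗ[ℂ] V x}
  {φ φ' : OpenPartialHomeomorph X (Cm m)}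

theorem IsHermitianMetric.posDef (hK : IsHermitianMetric m n K) (e : Frame n V)
    [MemTrivializationAtlas e] {y : X} (hy : y ∈ e.baseSet) : (gram K e y).PosDef := by
  refine Matrix.PosDef.of_dotProduct_mulVec_pos ?_ fun a ha => ?_
  · ext i j
    exact (hK.symm y _ _).symm
  · rw [← pairing_frame K e hy]
    set v := (frameEquiv e hy).symm a
    have hv : v ≠ 0 := fun h0 => ha ((LinearEquiv.map_eq_zero_iff _).1 h0)
    rw [Complex.pos_iff]
    exact ⟨hK.pos y v hv, (Complex.conj_eq_iff_im.1 (hK.symm y v v).symm).symm⟩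

theorem IsHermitianMetric.isUnit_det (hK : IsHermitianMetric m n K) (e : Frame n V)
    [MemTrivializationAtlas e] {y : X} (hy : y ∈ e.baseSet) : IsUnit (gram K e y).det :=
  isUnit_iff_ne_zero.2 (hK.posDef e hy).det_pos.ne'

theorem symm_of_posDef {x : X} (e : Frame n V) [MemTrivializationAtlas e] (hx : x ∈ e.baseSet)
    (hp : (gram K e x).PosDef) (u w : V x) : K x w u = star (K x u w) := by
  obtain ⟨a, rfl⟩ := (frameEquiv e hx).symm.surjective u
  obtain ⟨b, rfl⟩ := (frameEquiv e hx).symm.surjective w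
  rw [pairing_frame, pairing_frame, ← Matrix.star_dotProduct_star, star_star,
    Matrix.star_mulVec, hp.isHermitian.eq, Matrix.dotProduct_mulVec]

theorem pos_of_posDef {x : X} (e : Frame n V) [MemTrivializationAtlas e] (hx : x ∈ e.baseSet)
    (hp : (gram K e x).PosDef) (u : V x) (hu : u ≠ 0) : 0 < (K x u u).re := by
  obtain ⟨a, rfl⟩ := (frameEquiv e hx).symm.surjective u
  rw [pairing_frame]
  have ha : a ≠ 0 := fun h0 => hu (by rw [h0, map_zero])
  exact (Complex.pos_iff.1 (hp.dotProduct_mulVec_pos ha)).1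

/-- In a frame, `K`-self-adjointness of `H` says `G H = Hᴴ G`. -/
theorem IsVariation.gram_mul (hh : IsVariation m n K h) (e : Frame n V)
    [MemTrivializationAtlas e] {y : X} (hy : y ∈ e.baseSet) :
    gram K e y * endMatrix h e y = (endMatrix h e y)ᴴ * gram K e y := by
  rw [← gram_comp K h e hy]
  ext i j
  have h1 : h y ((frameEquiv e hy).symm (Pi.single i 1)) =
      (frameEquiv e hy).symm (fun k => endMatrix h e y k i) := by
    rw [LinearEquiv.eq_symm_apply]; rfl
  change K y (h y ((frameEquiv e hy).symm (Pi.single j 1)))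
    ((frameEquiv e hy).symm (Pi.single i 1)) = _
  rw [hh.selfAdjoint, h1, pairing_frame, Matrix.mulVec_single_one]
  rfl

theorem IsVariation.adj_eq (hh : IsVariation m n K h) (hK : IsHermitianMetric m n K)
    (e : Frame n V) [MemTrivializationAtlas e] {y : X} (hy : y ∈ e.baseSet) :
    adj (gram K e y) (endMatrix h e y) = endMatrix h e y := by
  rw [adj, mul_assoc, ← hh.gram_mul e hy, Matrix.nonsing_inv_mul_cancel_left _ _
    (hK.isUnit_det e hy)]

/-- If `H` is self-adjoint with respect to `G`, then `G exp(tH) = exp(tH/2)ᴴ G exp(tH/2)` is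
positive definite. -/
theorem posDef_mul_exp {G H : Matrix (Fin n) (Fin n) ℂ} (hG : G.PosDef) (hH : G * H = Hᴴ * G)
    (t : ℝ) : (G * NormedSpace.exp (t • H)).PosDef := by
  have hu : IsUnit G := (Matrix.isUnit_iff_isUnit_det _).2 (isUnit_iff_ne_zero.2 hG.det_pos.ne')
  have hd : IsUnit G.det := isUnit_iff_ne_zero.2 hG.det_pos.ne'
  have h1 : Hᴴ = G * H * G⁻¹ := by rw [hH, Matrix.mul_nonsing_inv_cancel_right _ _ hd]
  have h2 : ∀ s : ℝ, (NormedSpace.exp (s • H))ᴴ * G = G * NormedSpace.exp (s • H) := fun s => by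
    rw [← Matrix.exp_conjTranspose, Matrix.conjTranspose_smul, star_trivial, h1,
      ← Matrix.smul_mul, ← Matrix.mul_smul, Matrix.exp_conj _ _ hu,
      Matrix.nonsing_inv_mul_cancel_right _ _ hd]
  have h3 : G * NormedSpace.exp (t • H) = (NormedSpace.exp ((t / 2) • H))ᴴ * G *
      NormedSpace.exp ((t / 2) • H) := by
    rw [h2, mul_assoc, ← Matrix.exp_add_of_commute _ _ (Commute.refl _), ← add_smul, add_halves]
  rw [h3]
  exact hG.conjTranspose_mul_mul_same (Matrix.mulVec_injective_of_isUnit (Matrix.isUnit_exp _))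

theorem IsHermitianMetric.expVariation (hK : IsHermitianMetric m n K) (hh : IsVariation m n K h)
    (t : ℝ) : IsHermitianMetric m n (expVariation n K h t) := by
  have hp : ∀ (e : Frame n V) [MemTrivializationAtlas e] (y : X), y ∈ e.baseSet →
      (gram (FlatKahler.expVariation n K h t) e y).PosDef := fun e _ y hy => by
    rw [gram_expVariation K h t e hy]
    exact posDef_mul_exp (hK.posDef e hy) (hh.gram_mul e hy) t
  have hb := fun x : X => FiberBundle.mem_baseSet_trivializationAt' (F := Fin n → ℂ) (E := V) x
  refine ⟨fun x u w => symm_of_posDef _ (hb x) (hp _ x (hb x)) u w,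
    fun x u hu => pos_of_posDef _ (hb x) (hp _ x (hb x)) u hu, fun e _ i j => ?_⟩
  have h1 : ContDiff ℝ ∞ (fun p : Matrix (Fin n) (Fin n) ℂ × Matrix (Fin n) (Fin n) ℂ =>
      p.1 * NormedSpace.exp (t • p.2)) :=
    contDiff_fst.mul (contDiff_matrix_exp.comp (contDiff_snd.const_smul t))
  have h2 : ContDiff ℝ ∞ (fun A : Matrix (Fin n) (Fin n) ℂ => A i j) :=
    (LinearMap.toContinuousLinearMap (Matrix.entryLinearMap ℝ ℂ i j)).contDiff
  have h3 := (h2.comp h1).contMDiff.comp_contMDiffOn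
    ((contMDiffOn_matrix (hK.smooth e)).prodMk_space (contMDiffOn_matrix (hh.smooth e)))
  refine h3.congr fun x hx => ?_
  rw [gram_expVariation K h t e hx]
  rfl

variable [IsManifold 𝓘(ℂ, Cm m) ω X]

/-- The matrix of an endomorphism field, in a frame, as a function of the coordinates of a chart. -/
def localEnd (h : ∀ x, V x →ₗ[ℂ] V x) (e : Frame n V) (φ : OpenPartialHomeomorph X (Cm m))
    (z : Cm m) : Matrix (Fin n) (Fin n) ℂ :=
  endMatrix h e (φ.symm z)

theorem contDiffAt_of_contMDiffOn {F : X → Matrix (Fin n) (Fin n) ℂ} {s : Set X} (hs : IsOpen s)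
    (hF : ∀ i j, ContMDiffOn 𝓘(ℝ, Cm m) 𝓘(ℝ, ℂ) ∞ (fun x => F x i j) s)
    (hφ : φ ∈ atlas (Cm m) X) {z : Cm m} (hz : z ∈ φ.target) (hze : φ.symm z ∈ s) :
    ContDiffAt ℝ ∞ (fun y => F (φ.symm y)) z :=
  (((contMDiffOn_matrix hF).contMDiffAt (hs.mem_nhds hze)).comp z
    (contMDiffAt_chart_symm hφ hz)).contDiffAt

theorem IsHermitianMetric.contDiffAt (hK : IsHermitianMetric m n K) (hφ : φ ∈ atlas (Cm m) X)
    (e : Frame n V) [MemTrivializationAtlas e] {z : Cm m} (hz : z ∈ φ.target)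
    (hze : φ.symm z ∈ e.baseSet) : ContDiffAt ℝ ∞ (localGram K e φ) z :=
  contDiffAt_of_contMDiffOn e.open_baseSet (hK.smooth e) hφ hz hze

theorem IsVariation.contDiffAt (hh : IsVariation m n K h) (hφ : φ ∈ atlas (Cm m) X)
    (e : Frame n V) [MemTrivializationAtlas e] {z : Cm m} (hz : z ∈ φ.target)
    (hze : φ.symm z ∈ e.baseSet) : ContDiffAt ℝ ∞ (localEnd h e φ) z :=
  contDiffAt_of_contMDiffOn e.open_baseSet (hh.smooth e) hφ hz hze

theorem eventually_mem_frame (e : Frame n V) {z : Cm m} (hz : z ∈ φ.target)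
    (hze : φ.symm z ∈ e.baseSet) : ∀ᶠ y in 𝓝 z, y ∈ φ.target ∧ φ.symm y ∈ e.baseSet :=
  (φ.open_target.eventually_mem hz).and
    ((φ.continuousAt_symm hz).eventually (e.open_baseSet.mem_nhds hze))

theorem IsHermitianMetric.eventually_isHermitian (hK : IsHermitianMetric m n K)
    (e : Frame n V) [MemTrivializationAtlas e] {z : Cm m} (hz : z ∈ φ.target)
    (hze : φ.symm z ∈ e.baseSet) : ∀ᶠ y in 𝓝 z, (localGram K e φ y).IsHermitian := by
  filter_upwards [eventually_mem_frame e hz hze] with y hy using (hK.posDef e hy.2).isHermitian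

variable [IsFlatBundle n V]

/-- The Gram matrices with respect to two charts and two flat frames. -/
theorem exists_localGram_change (e e' : Frame n V) [MemTrivializationAtlas e]
    [MemTrivializationAtlas e'] {x : X}
    (hx : x ∈ φ.source) (hx' : x ∈ φ'.source) (hxe : x ∈ e.baseSet) (hxe' : x ∈ e'.baseSet) :
    ∃ P : Matrix (Fin n) (Fin n) ℂ, IsUnit P.det ∧
      (∀ K : ∀ x, V x →ₗ[ℂ] V x →ₗ⋆[ℂ] ℂ, localGram K e' φ' =ᶠ[𝓝 (φ' x)]
        fun y => Pᴴ * localGram K e φ ((φ ∘ φ'.symm) y) * P) ∧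
      ∀ h : ∀ x, V x →ₗ[ℂ] V x, endMatrix h e' x = P⁻¹ * endMatrix h e x * P := by
  obtain ⟨P, hP, hev⟩ := exists_frame_change e e' hxe hxe'
  refine ⟨P, hP, fun K => ?_, hev.self_of_nhds.2⟩
  have hy := φ'.map_source hx'
  have hy' : φ'.symm (φ' x) ∈ φ.source := by rwa [φ'.left_inv hx']
  have hc : Filter.Tendsto φ'.symm (𝓝 (φ' x)) (𝓝 x) := by
    have := φ'.continuousAt_symm hy
    rwa [ContinuousAt, φ'.left_inv hx'] at this
  filter_upwards [hc.eventually hev, eventually_mem_overlap hy hy'] with y h1 h2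
  simp only [localGram, Function.comp_apply, φ.left_inv h2.2]
  exact h1.1 K

theorem coeff_transition (g : KahlerMetric m X) (hφ : φ ∈ atlas (Cm m) X)
    (hφ' : φ' ∈ atlas (Cm m) X) {y : Cm m} (hy : y ∈ φ'.target) (hy' : φ'.symm y ∈ φ.source) :
    g.coeff φ' y = fun v w => g.coeff φ (φ (φ'.symm y))
      ((fderiv ℝ (φ ∘ φ'.symm) y : Cm m →ₗ[ℝ] Cm m) v)
      ((fderiv ℝ (φ ∘ φ'.symm) y : Cm m →ₗ[ℝ] Cm m) w) := by
  ext v w; exact localMetric_transition g.metric hφ hφ' hy hy' v w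

/-- The energy density does not depend on the chart and the flat frame. -/
theorem localDensity_transition (g : KahlerMetric m X) (hK : IsHermitianMetric m n K)
    (hφ : φ ∈ atlas (Cm m) X) (hφ' : φ' ∈ atlas (Cm m) X)
    (e e' : Frame n V) [MemTrivializationAtlas e] [MemTrivializationAtlas e'] {x : X}
    (hx : x ∈ φ.source) (hx' : x ∈ φ'.source) (hxe : x ∈ e.baseSet) (hxe' : x ∈ e'.baseSet) :
    localDensity (g.coeff φ' (φ' x)) (localGram K e' φ') (φ' x) =
      localDensity (g.coeff φ (φ x)) (localGram K e φ) (φ x) := by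
  obtain ⟨P, hP, hG, -⟩ := exists_localGram_change e e' hx hx' hxe hxe'
  have hy := φ'.map_source hx'
  have hl := φ'.left_inv hx'
  have hy' : φ'.symm (φ' x) ∈ φ.source := by rwa [hl]
  have hτy : (φ ∘ φ'.symm) (φ' x) = φ x := congrArg φ hl
  have hτ : DifferentiableAt ℝ (φ ∘ φ'.symm) (φ' x) :=
    ((contDiffAt_transition hφ hφ' hy hy').restrict_scalars ℝ).differentiableAt (by simp)
  have hGd : DifferentiableAt ℝ (localGram K e φ) ((φ ∘ φ'.symm) (φ' x)) := by
    rw [hτy]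
    exact (hK.contDiffAt hφ e (φ.map_source hx) (by rwa [φ.left_inv hx])).differentiableAt
      (by simp)
  have hB := gaugeForm_pullback hP hτ hGd (hG K)
  have hg := coeff_transition g hφ hφ' hy hy'
  rw [hl] at hg
  rw [hτy] at hB
  have hQ : IsRealBilin (fun v w => 1 / 4 * (Matrix.trace (gaugeForm (localGram K e φ) (φ x) v *
      gaugeForm (localGram K e φ) (φ x) w)).re) :=
    .mk' (fun u v w => by simp [add_mul, mul_add]) (fun r v w => by simp; ring)
      (fun u v w => by simp [mul_add]) (fun r v w => by simp; ring)
  rw [localDensity, localDensity, hg, ← metricTrace_comp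
    (g.isKahlerAt hφ (φ.map_source hx)).inner' hQ _ (isUnit_det_transition hφ hφ' hy hy')]
  refine metricTrace_congr fun v w => ?_
  rw [hB, hB]
  simp only [ContinuousLinearMap.coe_coe]
  congr 2
  rw [show ∀ A B : Matrix (Fin n) (Fin n) ℂ, P⁻¹ * A * P * (P⁻¹ * B * P) = P⁻¹ * (A * B * P) by
    intro A B
    simp only [mul_assoc, Matrix.mul_nonsing_inv_cancel_left _ _ hP], Matrix.trace_mul_comm,
    mul_assoc, Matrix.mul_nonsing_inv _ hP, mul_one]

/-- The Euler–Lagrange expression is a well-defined endomorphism. Under a coordinate change `τ` the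
derivative of `B` acquires the term `B(D²τ)`; as `τ` is holomorphic, `D²τ` is complex bilinear and
this term has trace zero. -/
theorem eulerLagrange_transition (g : KahlerMetric m X) (hK : IsHermitianMetric m n K)
    (hφ : φ ∈ atlas (Cm m) X) (hφ' : φ' ∈ atlas (Cm m) X)
    (e e' : Frame n V) [MemTrivializationAtlas e] [MemTrivializationAtlas e'] {x : X}
    (hx : x ∈ φ.source) (hx' : x ∈ φ'.source) (hxe : x ∈ e.baseSet) (hxe' : x ∈ e'.baseSet) :
    ∃ P : Matrix (Fin n) (Fin n) ℂ, IsUnit P.det ∧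
      eulerLagrange (g.coeff φ') (localGram K e' φ') (φ' x) =
        P⁻¹ * eulerLagrange (g.coeff φ) (localGram K e φ) (φ x) * P ∧
      ∀ h : ∀ x, V x →ₗ[ℂ] V x, endMatrix h e' x = P⁻¹ * endMatrix h e x * P := by
  obtain ⟨P, hP, hG, hE⟩ := exists_localGram_change e e' hx hx' hxe hxe'
  refine ⟨P, hP, ?_, hE⟩
  have hz := φ.map_source hx
  have hy := φ'.map_source hx'
  have hl := φ'.left_inv hx'
  have hze : φ.symm (φ x) ∈ e.baseSet := by rwa [φ.left_inv hx]
  have hye : φ'.symm (φ' x) ∈ e'.baseSet := by rwa [hl]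
  have hy' : φ'.symm (φ' x) ∈ φ.source := by rwa [hl]
  have hτy : (φ ∘ φ'.symm) (φ' x) = φ x := congrArg φ hl
  have hτ : ContDiffAt ℝ ∞ (φ ∘ φ'.symm) (φ' x) :=
    (contDiffAt_transition hφ hφ' hy hy').restrict_scalars ℝ
  have hGd := hK.contDiffAt hφ e hz hze
  have hb := fderiv_gaugeForm_pullback hP hτ (by rwa [hτy]) (by
    rw [hτy]; exact hK.isUnit_det e hze) (hG K)
  have hg := coeff_transition g hφ hφ' hy hy'
  rw [hl] at hg
  rw [hτy] at hb
  have hk := g.isKahlerAt hφ hz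
  have hk' := g.isKahlerAt hφ' hy
  rw [eulerLagrange_eq hk'.inner' hk'.invariant.self_of_nhds (hK.contDiffAt hφ' e' hy hye)
    (hK.isUnit_det e' hye), eulerLagrange_eq hk.inner' hk.invariant.self_of_nhds hGd
    (hK.isUnit_det e hze)]
  have h2 : metricTrace (g.coeff φ' (φ' x)) (fun v w => gaugeForm (localGram K e φ) (φ x)
      (fderiv ℝ (fderiv ℝ (φ ∘ φ'.symm)) (φ' x) v w)) = 0 := by
    refine metricTrace_eq_zero hk'.inner' hk'.invariant.self_of_nhds ?_ fun v w => ?_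
    · exact .mk' (fun u v w => by simp) (fun r v w => by simp) (fun u v w => by simp)
        (fun r v w => by simp)
    · rw [fderiv_fderiv_transition_I hφ hφ' hy hy', map_neg]
  have h1 := metricTrace_comp hk.inner'
    (isRealBilin_clm (fderiv ℝ (gaugeForm (localGram K e φ)) (φ x))) _
    (isUnit_det_transition hφ hφ' hy hy')
  rw [← hg] at h1
  rw [metricTrace_congr hb, ← h1]
  have h3 := metricTrace_map (g.coeff φ' (φ' x)) (fun v w =>
    fderiv ℝ (gaugeForm (localGram K e φ)) (φ x) (fderiv ℝ (φ ∘ φ'.symm) (φ' x) v)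
      (fderiv ℝ (φ ∘ φ'.symm) (φ' x) w) + gaugeForm (localGram K e φ) (φ x)
      (fderiv ℝ (fderiv ℝ (φ ∘ φ'.symm)) (φ' x) v w))
    ((LinearMap.mulLeft ℝ P⁻¹).comp (LinearMap.mulRight ℝ P))
  rw [metricTrace_add, h2, add_zero] at h3
  simp only [LinearMap.comp_apply, LinearMap.mulLeft_apply, LinearMap.mulRight_apply,
    ← mul_assoc] at h3
  rw [h3]
  simp [mul_assoc]

theorem energyDensity_eq (g : KahlerMetric m X) (hK : IsHermitianMetric m n K)
    (hφ : φ ∈ atlas (Cm m) X) (e : Frame n V) [MemTrivializationAtlas e] {x : X}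
    (hx : x ∈ φ.source) (hxe : x ∈ e.baseSet) :
    energyDensity n g K x = localDensity (g.coeff φ (φ x)) (localGram K e φ) (φ x) := by
  have hx' := mem_chart_source (Cm m) x
  have hb := FiberBundle.mem_baseSet_trivializationAt' (F := Fin n → ℂ) (E := V) x
  have hze : (chartAt (Cm m) x).symm (chartAt (Cm m) x x) ∈
      (trivializationAt (Fin n → ℂ) V x).baseSet := by
    rwa [(chartAt (Cm m) x).left_inv hx']
  have hz := (chartAt (Cm m) x).map_source hx'
  rw [← localDensity_transition g hK hφ (chart_mem_atlas (Cm m) x) e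
    (trivializationAt (Fin n → ℂ) V x) hx hx' hxe hb]
  exact normSqForm_eq ((hK.contDiffAt (chart_mem_atlas (Cm m) x) _ hz hze).differentiableAt
    (by simp)) (hK.isUnit_det _ hze) (hK.eventually_isHermitian _ hz hze)

theorem gradientPairing_eq (g : KahlerMetric m X) (hK : IsHermitianMetric m n K)
    (hh : IsVariation m n K h)
    (hφ : φ ∈ atlas (Cm m) X) (e : Frame n V) [MemTrivializationAtlas e] {x : X}
    (hx : x ∈ φ.source) (hxe : x ∈ e.baseSet) :
    gradientPairing n g K h x = (Matrix.trace (eulerLagrange (g.coeff φ) (localGram K e φ) (φ x) *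
      endMatrix h e x)).re := by
  have hx' := mem_chart_source (Cm m) x
  have hb := FiberBundle.mem_baseSet_trivializationAt' (F := Fin n → ℂ) (E := V) x
  obtain ⟨P, hP, h1, h2⟩ := eulerLagrange_transition g hK hφ (chart_mem_atlas (Cm m) x) e
    (trivializationAt (Fin n → ℂ) V x) hx hx' hxe hb
  have h3 : adj (localGram K (trivializationAt (Fin n → ℂ) V x) (chartAt (Cm m) x)
      (chartAt (Cm m) x x)) (endMatrix h (trivializationAt (Fin n → ℂ) V x) x) =
      endMatrix h (trivializationAt (Fin n → ℂ) V x) x := by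
    rw [localGram, (chartAt (Cm m) x).left_inv hx']
    exact hh.adj_eq hK _ hb
  rw [gradientPairing]
  simp only [h3]
  rw [h1, h2]
  congr 1
  rw [show ∀ A B : Matrix (Fin n) (Fin n) ℂ, P⁻¹ * A * P * (P⁻¹ * B * P) = P⁻¹ * (A * B * P) by
    intro A B
    simp only [mul_assoc, Matrix.mul_nonsing_inv_cancel_left _ _ hP], Matrix.trace_mul_comm,
    mul_assoc, Matrix.mul_nonsing_inv _ hP, mul_one]

end Hermitian

/-! ### The first variation of the energy density in coordinates -/

section Variation

variable {m n : ℕ}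

/-- The real part of the trace of a complex matrix. -/
def reTrace (n : ℕ) : Matrix (Fin n) (Fin n) ℂ →L[ℝ] ℝ :=
  LinearMap.toContinuousLinearMap (Complex.reLm.comp (Matrix.traceLinearMap (Fin n) ℝ ℂ))

theorem reTrace_apply (A : Matrix (Fin n) (Fin n) ℂ) : reTrace n A = A.trace.re := rfl

theorem reTrace_mul_comm (A B : Matrix (Fin n) (Fin n) ℂ) :
    reTrace n (A * B) = reTrace n (B * A) := by
  rw [reTrace_apply, Matrix.trace_mul_comm, reTrace_apply]

/-- The family of Gram matrices `G exp(tH)`, as a function of `(t, z)`. -/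
def gramPath (G H : Cm m → Matrix (Fin n) (Fin n) ℂ) (p : ℝ × Cm m) : Matrix (Fin n) (Fin n) ℂ :=
  G p.2 * NormedSpace.exp (p.1 • H p.2)

/-- The energy density of `G exp(tH)`, as a function of `(t, z)`. Differentiation is in both
variables, but only tangent vectors `(0, v)` enter, so that this is the density for fixed `t`
(`localDensity_gramPath`), while smoothness in `(t, z)` is evident. -/
def pathDensity (γ : Cm m → Cm m → Cm m → ℝ) (G H : Cm m → Matrix (Fin n) (Fin n) ℂ)
    (p : ℝ × Cm m) : ℝ :=
  metricTrace (γ p.2) fun v w => 1 / 4 * reTrace n (gaugeForm (gramPath G H) p (0, v) *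
    gaugeForm (gramPath G H) p (0, w))

variable {γ : Cm m → Cm m → Cm m → ℝ} {G H : Cm m → Matrix (Fin n) (Fin n) ℂ} {z : Cm m}

theorem gramPath_zero (G H : Cm m → Matrix (Fin n) (Fin n) ℂ) :
    (fun y => gramPath G H (0, y)) = G := by
  ext1 y; simp [gramPath]

theorem contDiffAt_gramPath (hG : ContDiffAt ℝ ∞ G z) (hH : ContDiffAt ℝ ∞ H z) (t : ℝ) :
    ContDiffAt ℝ ∞ (gramPath G H) (t, z) :=
  (hG.comp (t, z) contDiffAt_snd).mul (contDiff_matrix_exp.contDiffAt.comp (t, z)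
    (contDiffAt_fst.smul (hH.comp (t, z) contDiffAt_snd)))

theorem isUnit_det_gramPath (hu : IsUnit (G z).det) (t : ℝ) :
    IsUnit (gramPath G H (t, z)).det := by
  rw [gramPath, Matrix.det_mul]
  exact hu.mul ((Matrix.isUnit_iff_isUnit_det _).1 (Matrix.isUnit_exp _))

theorem gaugeForm_gramPath_time {t : ℝ} (hd : DifferentiableAt ℝ (gramPath G H) (t, z))
    (hu : IsUnit (G z).det) : gaugeForm (gramPath G H) (t, z) (1, 0) = H z := by
  have h1 : HasDerivAt (fun s : ℝ => gramPath G H (s, z))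
      (fderiv ℝ (gramPath G H) (t, z) (1, 0)) t :=
    HasFDerivAt.comp_hasDerivAt (f := fun s : ℝ => (s, z)) t hd.hasFDerivAt
      ((hasDerivAt_id t).prodMk (hasDerivAt_const t z))
  have h2 : HasDerivAt (fun s : ℝ => gramPath G H (s, z))
      (G z * (NormedSpace.exp (t • H z) * H z)) t :=
    (hasDerivAt_exp_smul_const (H z) t).const_mul (G z)
  rw [gaugeForm_apply, h1.unique h2, ← mul_assoc (G z)]
  exact Matrix.nonsing_inv_mul_cancel_left _ _ (isUnit_det_gramPath (H := H) hu t)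

theorem gaugeForm_gramPath_space {t : ℝ} (hd : DifferentiableAt ℝ (gramPath G H) (t, z))
    (v : Cm m) : gaugeForm (gramPath G H) (t, z) (0, v) =
      gaugeForm (fun y => gramPath G H (t, y)) z v := by
  have h1 : HasFDerivAt (fun y => gramPath G H (t, y)) _ z :=
    hd.hasFDerivAt.comp z (hasFDerivAt_prodMk_right t z)
  rw [gaugeForm_apply, gaugeForm_apply, h1.fderiv]
  rfl

/-- `d/dt (G_t⁻¹ dG_t) = dH + [B, H]` at `t = 0`: the flatness of the connection form of the family
on `ℝ × ℂ^m`, whose `dt`-component is `H`. -/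
theorem fderiv_gaugeForm_gramPath (hG : ContDiffAt ℝ ∞ G z) (hH : ContDiffAt ℝ ∞ H z)
    (hu : IsUnit (G z).det) (w : Cm m) :
    fderiv ℝ (gaugeForm (gramPath G H)) (0, z) (1, 0) (0, w) =
      fderiv ℝ H z w - (H z * gaugeForm G z w - gaugeForm G z w * H z) := by
  have hc := contDiffAt_gramPath hG hH 0
  have hu' := isUnit_det_gramPath (H := H) hu 0
  have hB : DifferentiableAt ℝ (gaugeForm (gramPath G H)) (0, z) :=
    (contDiffAt_gaugeForm hc hu').differentiableAt (by simp)
  have hev : (fun p => gaugeForm (gramPath G H) p (1, 0)) =ᶠ[𝓝 ((0 : ℝ), z)] fun p => H p.2 := by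
    have e1 := (hc.of_le (m := 1) (by norm_cast)).eventually (by simp)
    have e2 : ∀ᶠ p : ℝ × Cm m in 𝓝 (0, z), IsUnit (G p.2).det :=
      continuousAt_snd.eventually (eventually_isUnit_det hG.continuousAt hu)
    filter_upwards [e1, e2] with p h1 h2
    exact gaugeForm_gramPath_time (h1.differentiableAt (by simp)) h2
  have hd := hc.differentiableAt (by simp)
  rw [gaugeForm_flat hc hu', ← fderiv_clm_const hB, hev.fderiv_eq,
    gaugeForm_gramPath_time hd hu, gaugeForm_gramPath_space hd, gramPath_zero]
  congr 1
  have h3 : HasFDerivAt (fun p : ℝ × Cm m => H p.2) _ (0, z) :=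
    HasFDerivAt.comp (g := H) (0, z) (hH.differentiableAt (by simp)).hasFDerivAt hasFDerivAt_snd
  rw [h3.fderiv]
  rfl

theorem localDensity_gramPath {t : ℝ} (hd : DifferentiableAt ℝ (gramPath G H) (t, z)) :
    localDensity (γ z) (fun y => gramPath G H (t, y)) z = pathDensity γ G H (t, z) := by
  rw [localDensity, pathDensity]
  refine metricTrace_congr fun v w => ?_
  rw [gaugeForm_gramPath_space hd, gaugeForm_gramPath_space hd]
  rfl

theorem contDiffAt_pathDensity (hγ : IsKahlerAt γ z) (hG : ContDiffAt ℝ ∞ G z)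
    (hH : ContDiffAt ℝ ∞ H z) (hu : IsUnit (G z).det) (t : ℝ) :
    ContDiffAt ℝ ∞ (pathDensity γ G H) (t, z) := by
  have hB := contDiffAt_gaugeForm (contDiffAt_gramPath hG hH t) (isUnit_det_gramPath (H := H) hu t)
  have hB' : ∀ v : Cm m, ContDiffAt ℝ ∞ (fun p => gaugeForm (gramPath G H) p (0, v)) (t, z) :=
    fun v => hB.clm_apply contDiffAt_const
  have hQ : ∀ v w : Cm m, ContDiffAt ℝ ∞ (fun p => 1 / 4 * reTrace n
      (gaugeForm (gramPath G H) p (0, v) * gaugeForm (gramPath G H) p (0, w))) (t, z) := fun v w =>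
    contDiffAt_const.mul ((reTrace n).contDiff.contDiffAt.comp (t, z) ((hB' v).mul (hB' w)))
  have h : ∀ a b, ContDiffAt ℝ ∞ (fun p : ℝ × Cm m => (metricMatrix (γ p.2))⁻¹ a b •
      (1 / 4 * reTrace n (gaugeForm (gramPath G H) p (0, realBasis m a) *
        gaugeForm (gramPath G H) p (0, realBasis m b)))) (t, z) := fun a b =>
    ContDiffAt.smul (ContDiffAt.comp (t, z) (hγ.contDiffAt_inv a b) contDiffAt_snd)
      (hQ (realBasis m a) (realBasis m b))
  unfold pathDensity metricTrace
  exact ContDiffAt.sum fun a _ => ContDiffAt.sum fun b _ => h a b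

/-- The first variation of the energy density is `½ g^{ab} Re tr(B_a ∂_b H)`. -/
theorem fderiv_pathDensity (hγ : IsKahlerAt γ z) (hG : ContDiffAt ℝ ∞ G z)
    (hH : ContDiffAt ℝ ∞ H z) (hu : IsUnit (G z).det) :
    fderiv ℝ (pathDensity γ G H) (0, z) (1, 0) =
      1 / 2 * metricTrace (γ z) fun v w => reTrace n (gaugeForm G z v * fderiv ℝ H z w) := by
  have hc := contDiffAt_gramPath hG hH 0
  have hd := hc.differentiableAt (by simp)
  have hB : DifferentiableAt ℝ (gaugeForm (gramPath G H)) (0, z) :=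
    (contDiffAt_gaugeForm hc (isUnit_det_gramPath (H := H) hu 0)).differentiableAt (by simp)
  have hl : HasDerivAt (fun s : ℝ => (s, z)) ((1 : ℝ), (0 : Cm m)) 0 :=
    (hasDerivAt_id 0).prodMk (hasDerivAt_const 0 z)
  have h1 : HasDerivAt (fun s : ℝ => pathDensity γ G H (s, z))
      (fderiv ℝ (pathDensity γ G H) (0, z) (1, 0)) 0 :=
    HasFDerivAt.comp_hasDerivAt (f := fun s : ℝ => (s, z)) 0
      ((contDiffAt_pathDensity hγ hG hH hu 0).differentiableAt (by simp)).hasFDerivAt hl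
  have hB' : ∀ v : Cm m, HasDerivAt (fun s : ℝ => gaugeForm (gramPath G H) (s, z) (0, v))
      (fderiv ℝ H z v - (H z * gaugeForm G z v - gaugeForm G z v * H z)) 0 := fun v => by
    have hBv : DifferentiableAt ℝ (fun p => gaugeForm (gramPath G H) p (0, v)) (0, z) :=
      hB.clm_apply (differentiableAt_const _)
    rw [← fderiv_gaugeForm_gramPath hG hH hu, ← fderiv_clm_const hB]
    exact HasFDerivAt.comp_hasDerivAt (f := fun s : ℝ => (s, z)) 0 hBv.hasFDerivAt hl
  have hB0 : ∀ v : Cm m, gaugeForm (gramPath G H) (0, z) (0, v) = gaugeForm G z v := fun v => by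
    rw [gaugeForm_gramPath_space hd, gramPath_zero]
  have h2 := HasDerivAt.fun_sum (u := Finset.univ) fun a _ =>
    HasDerivAt.fun_sum (u := Finset.univ) fun b _ =>
      ((((reTrace n).hasFDerivAt.comp_hasDerivAt (0 : ℝ) ((hB' (realBasis m a)).mul
        (hB' (realBasis m b)))).const_mul (1 / 4 : ℝ)).const_smul ((metricMatrix (γ z))⁻¹ a b))
  rw [h1.unique h2]
  change metricTrace (γ z) (fun v w => 1 / 4 * reTrace n
    ((fderiv ℝ H z v - (H z * gaugeForm G z v - gaugeForm G z v * H z)) *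
      gaugeForm (gramPath G H) (0, z) (0, w) + gaugeForm (gramPath G H) (0, z) (0, v) *
      (fderiv ℝ H z w - (H z * gaugeForm G z w - gaugeForm G z w * H z)))) = _
  -- The commutators cancel under the trace.
  have h3 : ∀ v w, 1 / 4 * reTrace n
    ((fderiv ℝ H z v - (H z * gaugeForm G z v - gaugeForm G z v * H z)) *
      gaugeForm (gramPath G H) (0, z) (0, w) + gaugeForm (gramPath G H) (0, z) (0, v) *
      (fderiv ℝ H z w - (H z * gaugeForm G z w - gaugeForm G z w * H z))) =
      1 / 4 * reTrace n (gaugeForm G z w * fderiv ℝ H z v) +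
      1 / 4 * reTrace n (gaugeForm G z v * fderiv ℝ H z w) := fun v w => by
    rw [hB0, hB0]
    have e1 : reTrace n (H z * gaugeForm G z v * gaugeForm G z w) =
        reTrace n (gaugeForm G z v * gaugeForm G z w * H z) := by
      rw [mul_assoc, reTrace_mul_comm]
    simp only [sub_mul, mul_sub, map_add, map_sub, e1, ← mul_assoc]
    rw [reTrace_mul_comm (fderiv ℝ H z v)]
    ring
  rw [metricTrace_congr h3, metricTrace_add, metricTrace_swap hγ.inner'
    (fun v w => 1 / 4 * reTrace n (gaugeForm G z v * fderiv ℝ H z w))]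
  have h4 := metricTrace_map (γ z) (fun v w => reTrace n (gaugeForm G z v * fderiv ℝ H z w))
    (LinearMap.mulLeft ℝ (1 / 4 : ℝ))
  simp only [LinearMap.mulLeft_apply] at h4
  rw [h4]
  ring

end Variation

/-! ### Differentiation of the energy under the integral sign -/

section FirstVariation

variable {m n : ℕ} {X : Type*} [TopologicalSpace X]
  {V : X → Type*} [∀ x, AddCommGroup (V x)] [∀ x, Module ℂ (V x)]
  [∀ x, TopologicalSpace (V x)] [TopologicalSpace (TotalSpace (Fin n → ℂ) V)]
  [FiberBundle (Fin n → ℂ) V] [VectorBundle ℂ (Fin n → ℂ) V] [ChartedSpace (Cm m) X]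
  {K : ∀ x, V x →ₗ[ℂ] V x →ₗ⋆[ℂ] ℂ} {h : ∀ x, V x →ₗ[ℂ] V x}
  {φ : OpenPartialHomeomorph X (Cm m)}

theorem localDensity_congr {γ : Cm m → Cm m → ℝ} {G G' : Cm m → Matrix (Fin n) (Fin n) ℂ}
    {z : Cm m} (hG : G =ᶠ[𝓝 z] G') : localDensity γ G z = localDensity γ G' z := by
  simp only [localDensity, gaugeForm_apply, hG.eq_of_nhds, hG.fderiv_eq]

theorem endMatrix_eq_zero (h : ∀ x, V x →ₗ[ℂ] V x) (e : Frame n V) [MemTrivializationAtlas e]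
    {y : X} (hy : y ∈ e.baseSet) (h0 : h y = 0) : endMatrix h e y = 0 := by
  rw [endMatrix_eq h e hy, h0, map_zero, map_zero]

variable [IsManifold 𝓘(ℂ, Cm m) ω X]

variable [IsFlatBundle n V] (g : KahlerMetric m X)

theorem localGram_expVariation (K : ∀ x, V x →ₗ[ℂ] V x →ₗ⋆[ℂ] ℂ) (h : ∀ x, V x →ₗ[ℂ] V x)
    (e : Frame n V) [MemTrivializationAtlas e] (t : ℝ) {z : Cm m} (hz : z ∈ φ.target)
    (hze : φ.symm z ∈ e.baseSet) :
    localGram (expVariation n K h t) e φ =ᶠ[𝓝 z]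
      fun y => gramPath (localGram K e φ) (localEnd h e φ) (t, y) := by
  filter_upwards [eventually_mem_frame e hz hze] with y hy using gram_expVariation K h t e hy.2

theorem energyDensity_expVariation (hK : IsHermitianMetric m n K) (hh : IsVariation m n K h)
    (hφ : φ ∈ atlas (Cm m) X) (e : Frame n V) [MemTrivializationAtlas e] {x : X}
    (hx : x ∈ φ.source) (hxe : x ∈ e.baseSet) (t : ℝ) :
    energyDensity n g (expVariation n K h t) x =
      pathDensity (g.coeff φ) (localGram K e φ) (localEnd h e φ) (t, φ x) := by
  have hz := φ.map_source hx
  have hze : φ.symm (φ x) ∈ e.baseSet := by rwa [φ.left_inv hx]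
  rw [energyDensity_eq g (hK.expVariation hh t) hφ e hx hxe,
    localDensity_congr (localGram_expVariation K h e t hz hze)]
  exact localDensity_gramPath ((contDiffAt_gramPath (hK.contDiffAt hφ e hz hze)
    (hh.contDiffAt hφ e hz hze) t).differentiableAt (by simp))

theorem energyDensity_expVariation_zero (hK : IsHermitianMetric m n K)
    (hh : IsVariation m n K h) (x : X) :
    energyDensity n g (expVariation n K h 0) x = energyDensity n g K x := by
  have hb := FiberBundle.mem_baseSet_trivializationAt' (F := Fin n → ℂ) (E := V) x
  have hx := mem_chart_source (Cm m) x
  have hφ := chart_mem_atlas (Cm m) x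
  rw [energyDensity_eq g (hK.expVariation hh 0) hφ _ hx hb, energyDensity_eq g hK hφ _ hx hb,
    localDensity_congr (localGram_expVariation K h _ 0 ((chartAt (Cm m) x).map_source hx)
      (by rwa [(chartAt (Cm m) x).left_inv hx])), gramPath_zero]

theorem energyDensity_expVariation_of_notMem (hK : IsHermitianMetric m n K)
    (hh : IsVariation m n K h) {x : X} (hxS : x ∉ closure {x | h x ≠ 0}) (t : ℝ) :
    energyDensity n g (expVariation n K h t) x = energyDensity n g K x := by
  have hb := FiberBundle.mem_baseSet_trivializationAt' (F := Fin n → ℂ) (E := V) x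
  have hx := mem_chart_source (Cm m) x
  have hφ := chart_mem_atlas (Cm m) x
  set φ := chartAt (Cm m) x
  have hz := φ.map_source hx
  have hze : φ.symm (φ x) ∈ (trivializationAt (Fin n → ℂ) V x).baseSet := by rwa [φ.left_inv hx]
  rw [energyDensity_eq g (hK.expVariation hh t) hφ _ hx hb, energyDensity_eq g hK hφ _ hx hb]
  refine localDensity_congr ?_
  have hc : ∀ᶠ y in 𝓝 (φ x), h (φ.symm y) = 0 := by
    have h1 : ∀ᶠ y in 𝓝 (φ.symm (φ x)), y ∉ closure {x | h x ≠ 0} :=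
      isClosed_closure.isOpen_compl.eventually_mem (by rwa [φ.left_inv hx])
    filter_upwards [(φ.continuousAt_symm hz).eventually h1] with y hy
    by_contra h0
    exact hy (subset_closure h0)
  filter_upwards [localGram_expVariation K h _ t hz hze, hc,
    eventually_mem_frame _ hz hze] with y h1 h2 hy
  rw [h1]
  simp [gramPath, localEnd, endMatrix_eq_zero h _ hy.2 h2]

/-- The density of `K` is the density of the constant path `K exp(t0)`, so this is a case of the
smoothness of `pathDensity`. -/
theorem continuous_energyDensity (hK : IsHermitianMetric m n K) :
    Continuous (energyDensity n g K) := by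
  refine continuous_iff_continuousAt.2 fun x => ?_
  have hb := FiberBundle.mem_baseSet_trivializationAt' (F := Fin n → ℂ) (E := V) x
  have hx := mem_chart_source (Cm m) x
  have hφ := chart_mem_atlas (Cm m) x
  set φ := chartAt (Cm m) x
  set e := trivializationAt (Fin n → ℂ) V x
  have hz := φ.map_source hx
  have hze : φ.symm (φ x) ∈ e.baseSet := by rwa [φ.left_inv hx]
  have hG := hK.contDiffAt hφ e hz hze
  have hc := contDiffAt_pathDensity (H := fun _ => 0) (g.isKahlerAt hφ hz) hG contDiffAt_const
    (hK.isUnit_det e hze) 0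
  have h1 : ContinuousAt (fun y => pathDensity (g.coeff φ) (localGram K e φ) (fun _ => 0)
      ((0 : ℝ), φ y)) x :=
    ContinuousAt.comp (f := fun y => ((0 : ℝ), φ y)) hc.continuousAt
      (continuousAt_const.prodMk (φ.continuousAt hx))
  refine h1.congr ?_
  filter_upwards [φ.open_source.mem_nhds hx, e.open_baseSet.mem_nhds hb] with y hy hye
  have hy' := φ.map_source hy
  have hye' : φ.symm (φ y) ∈ e.baseSet := by rwa [φ.left_inv hy]
  rw [energyDensity_eq g hK hφ e hy hye, ← localDensity_gramPath, gramPath_zero]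
  exact (contDiffAt_gramPath (hK.contDiffAt hφ e hy' hye') contDiffAt_const 0).differentiableAt
    (by simp)

theorem hasDerivAt_energyDensity (hK : IsHermitianMetric m n K) (hh : IsVariation m n K h)
    (hφ : φ ∈ atlas (Cm m) X) (e : Frame n V) [MemTrivializationAtlas e] {x : X}
    (hx : x ∈ φ.source) (hxe : x ∈ e.baseSet) (t : ℝ) :
    HasDerivAt (fun s => energyDensity n g (expVariation n K h s) x)
      (fderiv ℝ (pathDensity (g.coeff φ) (localGram K e φ) (localEnd h e φ)) (t, φ x) (1, 0))
      t := by
  have hz := φ.map_source hx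
  have hze : φ.symm (φ x) ∈ e.baseSet := by rwa [φ.left_inv hx]
  simp only [energyDensity_expVariation g hK hh hφ e hx hxe]
  exact HasFDerivAt.comp_hasDerivAt (f := fun s : ℝ => (s, φ x)) t
    ((contDiffAt_pathDensity (g.isKahlerAt hφ hz) (hK.contDiffAt hφ e hz hze)
      (hh.contDiffAt hφ e hz hze) (hK.isUnit_det e hze) t).differentiableAt (by simp)).hasFDerivAt
    ((hasDerivAt_id t).prodMk (hasDerivAt_const t (φ x)))

variable (n) in
/-- The derivative in `t` of the energy density of `K_t`. -/
def densityDeriv (g : KahlerMetric m X) (K : ∀ x, V x →ₗ[ℂ] V x →ₗ⋆[ℂ] ℂ)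
    (h : ∀ x, V x →ₗ[ℂ] V x) (t : ℝ) (x : X) : ℝ :=
  deriv (fun s => energyDensity n g (expVariation n K h s) x) t

theorem hasDerivAt_densityDeriv (hK : IsHermitianMetric m n K) (hh : IsVariation m n K h)
    (t : ℝ) (x : X) : HasDerivAt (fun s => energyDensity n g (expVariation n K h s) x)
      (densityDeriv n g K h t x) t :=
  (hasDerivAt_energyDensity g hK hh (chart_mem_atlas (Cm m) x) _ (mem_chart_source (Cm m) x)
    (FiberBundle.mem_baseSet_trivializationAt' x) t).differentiableAt.hasDerivAt

theorem densityDeriv_of_notMem (hK : IsHermitianMetric m n K) (hh : IsVariation m n K h) {x : X}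
    (hxS : x ∉ closure {x | h x ≠ 0}) (t : ℝ) : densityDeriv n g K h t x = 0 := by
  simp only [densityDeriv, energyDensity_expVariation_of_notMem g hK hh hxS, deriv_const]

theorem continuous_densityDeriv (hK : IsHermitianMetric m n K) (hh : IsVariation m n K h) :
    Continuous (fun p : ℝ × X => densityDeriv n g K h p.1 p.2) := by
  refine continuous_iff_continuousAt.2 fun ⟨t, x⟩ => ?_
  have hb := FiberBundle.mem_baseSet_trivializationAt' (F := Fin n → ℂ) (E := V) x
  have hx := mem_chart_source (Cm m) x
  have hφ := chart_mem_atlas (Cm m) x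
  set φ := chartAt (Cm m) x
  set e := trivializationAt (Fin n → ℂ) V x
  have hz := φ.map_source hx
  have hze : φ.symm (φ x) ∈ e.baseSet := by rwa [φ.left_inv hx]
  have hc := contDiffAt_pathDensity (g.isKahlerAt hφ hz) (hK.contDiffAt hφ e hz hze)
    (hh.contDiffAt hφ e hz hze) (hK.isUnit_det e hze) t
  have hc' : ContinuousAt (fun p => fderiv ℝ (pathDensity (g.coeff φ) (localGram K e φ)
      (localEnd h e φ)) p (1, 0)) (t, φ x) :=
    (hc.fderiv_right (m := 0) (by norm_cast)).continuousAt.clm_apply continuousAt_const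
  have h1 : ContinuousAt (fun p : ℝ × X => fderiv ℝ (pathDensity (g.coeff φ) (localGram K e φ)
      (localEnd h e φ)) (p.1, φ p.2) (1, 0)) (t, x) :=
    ContinuousAt.comp (f := fun p : ℝ × X => (p.1, φ p.2)) (x := (t, x)) hc'
      (continuousAt_fst.prodMk (ContinuousAt.comp (f := Prod.snd) (φ.continuousAt hx)
        continuousAt_snd))
  refine h1.congr ?_
  filter_upwards [continuousAt_snd.eventually (φ.open_source.mem_nhds hx),
    continuousAt_snd.eventually (e.open_baseSet.mem_nhds hb)] with p hy hye
  exact (hasDerivAt_energyDensity g hK hh hφ e hy hye p.1).deriv.symm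

/-- Differentiation under the integral: on the support of `h`, for `|t| ≤ 1`, the derivative of the
density is bounded by compactness, and off the support it is zero. -/
theorem hasDerivAt_energy [MeasurableSpace X] [BorelSpace X] (hK : IsHermitianMetric m n K)
    (hh : IsVariation m n K h) {A : Set X} (hSA : closure {x | h x ≠ 0} ⊆ A)
    (hA : IntegrableOn (energyDensity n g K) A g.volume) :
    HasDerivAt (fun t : ℝ => energy n g (expVariation n K h t) A)
      (∫ x, densityDeriv n g K h 0 x ∂g.volume) 0 := by
  have hS := hh.compactSupport
  obtain ⟨C, hC⟩ := ((isCompact_Icc (a := (-1 : ℝ)) (b := 1)).prod hS).exists_bound_of_continuousOn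
    (continuous_densityDeriv g hK hh).continuousOn
  have hfin : g.volume (closure {x | h x ≠ 0}) < ⊤ := hS.measure_lt_top
  have hSm : MeasurableSet (closure {x | h x ≠ 0}) := isClosed_closure.measurableSet
  have hcont := fun t => (continuous_densityDeriv g hK hh).comp (Continuous.prodMk_right t)
  have h1 := hasDerivAt_integral_of_dominated_loc_of_deriv_le (μ := g.volume.restrict A)
    (F := fun t x => energyDensity n g (expVariation n K h t) x) (F' := densityDeriv n g K h)
    (x₀ := (0 : ℝ)) (s := Metric.ball 0 1) (bound := (closure {x | h x ≠ 0}).indicator fun _ => C)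
    (Metric.ball_mem_nhds _ one_pos)
    (.of_forall fun t =>
      (continuous_energyDensity g (hK.expVariation hh t)).measurable.aestronglyMeasurable)
    (by simp only [energyDensity_expVariation_zero g hK hh]; exact hA)
    (hcont 0).measurable.aestronglyMeasurable
    (.of_forall fun x t ht => ?_)
    (((integrable_indicator_iff hSm).2 (integrableOn_const hfin.ne)).restrict)
    (.of_forall fun x t _ => hasDerivAt_densityDeriv g hK hh t x)
  · rw [← setIntegral_eq_integral_of_forall_compl_eq_zero
      (fun x hx => densityDeriv_of_notMem g hK hh (fun h => hx (hSA h)) 0)]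
    exact h1.2
  · by_cases hx : x ∈ closure {x | h x ≠ 0}
    · rw [indicator_of_mem hx]
      rw [Metric.mem_ball, dist_zero_right, Real.norm_eq_abs, abs_lt] at ht
      exact hC (t, x) ⟨⟨ht.1.le, ht.2.le⟩, hx⟩
    · rw [indicator_of_notMem hx, densityDeriv_of_notMem g hK hh hx, norm_zero]

end FirstVariation

/-! ### Integration by parts -/

section Parts

variable {m n : ℕ} {X : Type*} [TopologicalSpace X]
  {V : X → Type*} [∀ x, AddCommGroup (V x)] [∀ x, Module ℂ (V x)]
  [∀ x, TopologicalSpace (V x)] [TopologicalSpace (TotalSpace (Fin n → ℂ) V)]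
  [FiberBundle (Fin n → ℂ) V] [VectorBundle ℂ (Fin n → ℂ) V] [ChartedSpace (Cm m) X]
  {K : ∀ x, V x →ₗ[ℂ] V x →ₗ⋆[ℂ] ℂ} {h : ∀ x, V x →ₗ[ℂ] V x}
  {φ : OpenPartialHomeomorph X (Cm m)}

theorem metricTrace_sum {ι W : Type*} [AddCommGroup W] [Module ℝ W] (γ : Cm m → Cm m → ℝ)
    (T : Finset ι) (Q : ι → Cm m → Cm m → W) :
    metricTrace γ (fun v w => ∑ i ∈ T, Q i v w) = ∑ i ∈ T, metricTrace γ (Q i) := by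
  classical
  induction T using Finset.induction_on with
  | empty => simp [metricTrace]
  | insert i T hi ih => simp only [Finset.sum_insert hi, metricTrace_add, ih]

theorem contDiffAt_eulerLagrange {γ : Cm m → Cm m → Cm m → ℝ} {G : Cm m → Matrix (Fin n) (Fin n) ℂ}
    {z : Cm m} (hγ : IsKahlerAt γ z) (hG : ∀ᶠ y in 𝓝 z, ContDiffAt ℝ ∞ G y)
    (hu : IsUnit (G z).det) : ContDiffAt ℝ ∞ (eulerLagrange γ G) z := by
  have h1 : eulerLagrange γ G =ᶠ[𝓝 z] fun y => (1 / 2 : ℂ) • metricTrace (γ y)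
      (fun v w => fderiv ℝ (fun y' => gaugeForm G y' w) y v) := by
    filter_upwards [hγ.inner, hγ.invariant, hG,
      eventually_isUnit_det hG.self_of_nhds.continuousAt hu] with y h1 h2 h3 h4
    rw [eulerLagrange_eq h1 h2 h3 h4]
    congr 1
    exact metricTrace_congr fun v w => (fderiv_clm_const
      ((contDiffAt_gaugeForm h3 h4).differentiableAt (by simp)) v w).symm
  refine ContDiffAt.congr_of_eventuallyEq ?_ h1
  have h2 : ∀ w : Cm m, ContDiffAt ℝ ∞ (fun y => gaugeForm G y w) z := fun w =>
    (contDiffAt_gaugeForm hG.self_of_nhds hu).clm_apply contDiffAt_const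
  have h3 : ∀ v w : Cm m, ContDiffAt ℝ ∞ (fun y => fderiv ℝ (fun y' => gaugeForm G y' w) y v) z :=
    fun v w => ((h2 w).fderiv_right (m := ∞) (by simp)).clm_apply contDiffAt_const
  refine ContDiffAt.const_smul _ ?_
  unfold metricTrace
  exact ContDiffAt.sum fun a _ => ContDiffAt.sum fun b _ =>
    ContDiffAt.smul (hγ.contDiffAt_inv a b) (h3 (realBasis m a) (realBasis m b))

/-- The divergence `g^{ab} ∂_b Re tr(B_a H)` of the covector field `Re tr(B H)`. -/
theorem divergence_eq {γ : Cm m → Cm m → ℝ} (hγ : IsInner γ)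
    {B : Cm m → Cm m →L[ℝ] Matrix (Fin n) (Fin n) ℂ} {H : Cm m → Matrix (Fin n) (Fin n) ℂ}
    {z : Cm m} (hB : DifferentiableAt ℝ B z) (hH : DifferentiableAt ℝ H z) :
    ∑ a, ∑ b, (metricMatrix γ)⁻¹ a b *
      fderiv ℝ (fun y => reTrace n (B y (realBasis m a) * H y)) z (realBasis m b) =
      reTrace n (metricTrace γ (fun v w => fderiv ℝ B z v w) * H z) +
      metricTrace γ (fun v w => reTrace n (B z v * fderiv ℝ H z w)) := by
  have h1 : ∀ v w : Cm m, fderiv ℝ (fun y => reTrace n (B y v * H y)) z w =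
      reTrace n (fderiv ℝ B z w v * H z) + reTrace n (B z v * fderiv ℝ H z w) := fun v w => by
    have hBv : DifferentiableAt ℝ (fun y => B y v) z := hB.clm_apply (differentiableAt_const v)
    have h2 := (reTrace n).hasFDerivAt.comp z (hBv.hasFDerivAt.mul' hH.hasFDerivAt)
    have h3 : fderiv ℝ (fun y => reTrace n (B y v * H y)) z = _ := h2.fderiv
    rw [h3, ← fderiv_clm_const hB, ← map_add, add_comm]
    rfl
  have h4 := metricTrace_map γ (fun v w => fderiv ℝ B z v w)
    ((reTrace n : Matrix (Fin n) (Fin n) ℂ →ₗ[ℝ] ℝ).comp (LinearMap.mulRight ℝ (H z)))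
  simp only [LinearMap.comp_apply, LinearMap.mulRight_apply, ContinuousLinearMap.coe_coe] at h4
  rw [← h4, ← metricTrace_swap hγ, ← metricTrace_add]
  simp only [h1]
  rfl

variable [IsManifold 𝓘(ℂ, Cm m) ω X]

variable [IsFlatBundle n V] (g : KahlerMetric m X)

theorem IsHermitianMetric.eventually_contDiffAt (hK : IsHermitianMetric m n K)
    (hφ : φ ∈ atlas (Cm m) X) (e : Frame n V) [MemTrivializationAtlas e] {z : Cm m}
    (hz : z ∈ φ.target) (hze : φ.symm z ∈ e.baseSet) :
    ∀ᶠ y in 𝓝 z, ContDiffAt ℝ ∞ (localGram K e φ) y := by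
  filter_upwards [eventually_mem_frame e hz hze] with y hy using hK.contDiffAt hφ e hy.1 hy.2

theorem continuous_gradientPairing (hK : IsHermitianMetric m n K) (hh : IsVariation m n K h) :
    Continuous (gradientPairing n g K h) := by
  refine continuous_iff_continuousAt.2 fun x => ?_
  have hb := FiberBundle.mem_baseSet_trivializationAt' (F := Fin n → ℂ) (E := V) x
  have hx := mem_chart_source (Cm m) x
  have hφ := chart_mem_atlas (Cm m) x
  set φ := chartAt (Cm m) x
  set e := trivializationAt (Fin n → ℂ) V x
  have hz := φ.map_source hx
  have hze : φ.symm (φ x) ∈ e.baseSet := by rwa [φ.left_inv hx]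
  have h1 := (contDiffAt_eulerLagrange (g.isKahlerAt hφ hz)
    (hK.eventually_contDiffAt hφ e hz hze) (hK.isUnit_det e hze)).continuousAt
  have h2 := (hh.contDiffAt hφ e hz hze).continuousAt
  have h3 : ContinuousAt (fun y => reTrace n (eulerLagrange (g.coeff φ) (localGram K e φ) y *
      localEnd h e φ y)) (φ x) := (reTrace n).continuous.continuousAt.comp (h1.mul h2)
  refine (ContinuousAt.comp (f := φ) h3 (φ.continuousAt hx)).congr ?_
  filter_upwards [φ.open_source.mem_nhds hx, e.open_baseSet.mem_nhds hb] with y hy hye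
  rw [gradientPairing_eq g hK hh hφ e hy hye, Function.comp_apply, localEnd, φ.left_inv hy]
  rfl

theorem gradientPairing_of_eq_zero (hK : IsHermitianMetric m n K) (hh : IsVariation m n K h)
    {x : X} (h0 : h x = 0) : gradientPairing n g K h x = 0 := by
  have hb := FiberBundle.mem_baseSet_trivializationAt' (F := Fin n → ℂ) (E := V) x
  rw [gradientPairing_eq g hK hh (chart_mem_atlas (Cm m) x) _ (mem_chart_source (Cm m) x) hb,
    endMatrix_eq_zero h _ hb h0]
  simp

theorem densityDeriv_eq (hK : IsHermitianMetric m n K) (hh : IsVariation m n K h)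
    (hφ : φ ∈ atlas (Cm m) X) (e : Frame n V) [MemTrivializationAtlas e] {x : X}
    (hx : x ∈ φ.source) (hxe : x ∈ e.baseSet) :
    densityDeriv n g K h 0 x = 1 / 2 * metricTrace (g.coeff φ (φ x)) fun v w =>
      reTrace n (gaugeForm (localGram K e φ) (φ x) v * fderiv ℝ (localEnd h e φ) (φ x) w) := by
  have hz := φ.map_source hx
  have hze : φ.symm (φ x) ∈ e.baseSet := by rwa [φ.left_inv hx]
  rw [densityDeriv, (hasDerivAt_energyDensity g hK hh hφ e hx hxe 0).deriv]
  exact fderiv_pathDensity (g.isKahlerAt hφ hz) (hK.contDiffAt hφ e hz hze)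
    (hh.contDiffAt hφ e hz hze) (hK.isUnit_det e hze)

/-- In coordinates, the first variation of the density plus its pairing with the gradient is half
the divergence of `Re tr(B H)`. -/
theorem divergence_eq_densityDeriv (hK : IsHermitianMetric m n K) (hh : IsVariation m n K h)
    (hφ : φ ∈ atlas (Cm m) X) (e : Frame n V) [MemTrivializationAtlas e] {z : Cm m}
    (hz : z ∈ φ.target) (hze : φ.symm z ∈ e.baseSet) :
    ∑ a, ∑ b, (metricMatrix (g.coeff φ z))⁻¹ a b *
      fderiv ℝ (fun y => reTrace n (gaugeForm (localGram K e φ) y (realBasis m a) *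
        localEnd h e φ y)) z (realBasis m b) =
      2 * (densityDeriv n g K h 0 (φ.symm z) + gradientPairing n g K h (φ.symm z)) := by
  have hk := g.isKahlerAt hφ hz
  have hG := hK.contDiffAt hφ e hz hze
  have hu : IsUnit (localGram K e φ z).det := hK.isUnit_det e hze
  have hx := φ.map_target hz
  rw [divergence_eq hk.inner' ((contDiffAt_gaugeForm hG hu).differentiableAt (by simp))
    ((hh.contDiffAt hφ e hz hze).differentiableAt (by simp)),
    densityDeriv_eq g hK hh hφ e hx hze, gradientPairing_eq g hK hh hφ e hx hze, φ.right_inv hz,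
    eulerLagrange_eq hk.inner' hk.invariant.self_of_nhds hG hu]
  have h1 : ∀ A B : Matrix (Fin n) (Fin n) ℂ,
      (Matrix.trace (((1 / 2 : ℂ) • A) * B)).re = 1 / 2 * reTrace n (A * B) := fun A B => by
    rw [Matrix.smul_mul, Matrix.trace_smul, reTrace_apply, smul_eq_mul,
      show (1 / 2 : ℂ) = ((1 / 2 : ℝ) : ℂ) by push_cast; rfl, Complex.re_ofReal_mul]
  rw [h1, localEnd]
  ring

variable [MeasurableSpace X] [BorelSpace X]

/-- The first variation formula for variations supported in one chart and one flat frame, by the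
divergence theorem. -/
theorem integral_densityDeriv_add_of_subset [T2Space X] (hK : IsHermitianMetric m n K)
    (hh : IsVariation m n K h)
    (hφ : φ ∈ atlas (Cm m) X) (e : Frame n V) [MemTrivializationAtlas e]
    (hs : closure {x | h x ≠ 0} ⊆ φ.source ∩ e.baseSet) :
    ∫ x, densityDeriv n g K h 0 x + gradientPairing n g K h x ∂g.volume = 0 := by
  set S := closure {x | h x ≠ 0}
  have h0 : ∀ x ∉ S, densityDeriv n g K h 0 x + gradientPairing n g K h x = 0 := fun x hx => by
    rw [densityDeriv_of_notMem g hK hh hx, gradientPairing_of_eq_zero g hK hh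
      (by by_contra h1; exact hx (subset_closure h1)), add_zero]
  have hcont : Continuous fun x => densityDeriv n g K h 0 x + gradientPairing n g K h x :=
    ((continuous_densityDeriv g hK hh).comp (Continuous.prodMk_right 0)).add
      (continuous_gradientPairing g hK hh)
  rw [integral_volume_eq g hφ hcont fun x hx => h0 x fun h1 => hx (hs h1).1]
  set U := φ.target ∩ φ.symm ⁻¹' e.baseSet with hU
  have hUo : IsOpen U := φ.isOpen_inter_preimage_symm e.open_baseSet
  have hS : IsCompact (φ '' S) :=
    hh.compactSupport.image_of_continuousOn (φ.continuousOn.mono fun x hx => (hs hx).1)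
  have hSU : φ '' S ⊆ U := by
    rintro _ ⟨x, hx, rfl⟩
    exact ⟨φ.map_source (hs hx).1, by rw [mem_preimage, φ.left_inv (hs hx).1]; exact (hs hx).2⟩
  have hnot : ∀ z ∈ φ.target, z ∉ φ '' S → φ.symm z ∉ S := fun z hz hzS h1 =>
    hzS ⟨φ.symm z, h1, φ.right_inv hz⟩
  -- The covector field `Re tr(B H)`. Outside of `U` its formula has no meaning, and it is extended
  -- by zero.
  let A : Fin 2 × Fin m → Cm m → ℝ := fun a y =>
    reTrace n (gaugeForm (localGram K e φ) y (realBasis m a) * localEnd h e φ y)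
  have hA0 : ∀ a, ∀ z ∉ φ '' S, U.indicator (A a) z = 0 := fun a z hz => by
    by_cases hzU : z ∈ U
    · have h1 : h (φ.symm z) = 0 := by
        by_contra h1
        exact hnot z hzU.1 hz (subset_closure h1)
      simp [A, localEnd, endMatrix_eq_zero h e hzU.2 h1]
    · exact indicator_of_notMem hzU _
  have hev : ∀ a, ∀ z ∈ U, U.indicator (A a) =ᶠ[𝓝 z] A a := fun a z hz => by
    filter_upwards [hUo.mem_nhds hz] with y hy using indicator_of_mem hy _
  have hA : ∀ a, ∀ z ∈ U, ContDiffAt ℝ 1 (U.indicator (A a)) z := fun a z hz => by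
    have hB := contDiffAt_gaugeForm (hK.contDiffAt hφ e hz.1 hz.2)
      (hK.isUnit_det e hz.2 : IsUnit (localGram K e φ z).det)
    have hB' : ContDiffAt ℝ ∞ (fun y => gaugeForm (localGram K e φ) y (realBasis m a)) z :=
      hB.clm_apply contDiffAt_const
    have h1 : ContDiffAt ℝ ∞ (A a) z := (reTrace n).contDiff.contDiffAt.comp z
      (hB'.mul (hh.contDiffAt hφ e hz.1 hz.2))
    exact (h1.of_le (by norm_cast)).congr_of_eventuallyEq (hev a z hz)
  have hdiv := integral_divergence_eq_zero hS hSU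
    (fun z hz => g.isKahlerAt hφ hz.1) hA hA0 (realBasis m).addHaar
  have hz0 : ∀ z ∉ φ.target, volumeDensity (g.coeff φ z) * (∑ a, ∑ b,
      (metricMatrix (g.coeff φ z))⁻¹ a b *
        fderiv ℝ (U.indicator (A a)) z (realBasis m b)) = 0 := fun z hz => by
    have h1 : ∀ a, fderiv ℝ (U.indicator (A a)) z = 0 := fun a => by
      have h2 : U.indicator (A a) =ᶠ[𝓝 z] fun _ => 0 := by
        filter_upwards [hS.isClosed.isOpen_compl.mem_nhds fun h3 => hz (hSU h3).1] with y hy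
          using hA0 a y hy
      rw [h2.fderiv_eq, fderiv_const_apply]
    simp [h1]
  rw [← setIntegral_eq_integral_of_forall_compl_eq_zero hz0] at hdiv
  have h2 : (2 : ℝ) * ∫ z in φ.target, volumeDensity (g.coeff φ z) *
      (densityDeriv n g K h 0 (φ.symm z) + gradientPairing n g K h (φ.symm z))
      ∂(realBasis m).addHaar = 0 := by
    rw [← integral_const_mul]
    refine Eq.trans ?_ hdiv
    refine setIntegral_congr_fun φ.open_target.measurableSet fun z hz => ?_
    by_cases hzU : z ∈ U
    · have h3 := divergence_eq_densityDeriv g hK hh hφ e hzU.1 hzU.2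
      have h4 : ∑ a, ∑ b, (metricMatrix (g.coeff φ z))⁻¹ a b *
          fderiv ℝ (U.indicator (A a)) z (realBasis m b) =
          2 * (densityDeriv n g K h 0 (φ.symm z) + gradientPairing n g K h (φ.symm z)) := by
        rw [← h3]
        exact Finset.sum_congr rfl fun a _ => Finset.sum_congr rfl fun b _ => by
          rw [(hev a z hzU).fderiv_eq]
      refine Eq.trans ?_ (congrArg (volumeDensity (g.coeff φ z) * ·) h4.symm)
      ring
    · have h1 : ∀ a, fderiv ℝ (U.indicator (A a)) z = 0 := fun a => by
        have h2 : U.indicator (A a) =ᶠ[𝓝 z] fun _ => 0 := by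
          filter_upwards [hS.isClosed.isOpen_compl.mem_nhds fun h3 => hzU (hSU h3)] with y hy
            using hA0 a y hy
        rw [h2.fderiv_eq, fderiv_const_apply]
      simp [h1, h0 _ (hnot z hz fun h3 => hzU (hSU h3))]
  simpa using h2

end Parts

/-! ### Cutting off variations -/

section Cutoff

variable {m n : ℕ} {X : Type*} [TopologicalSpace X]
  {V : X → Type*} [∀ x, AddCommGroup (V x)] [∀ x, Module ℂ (V x)]
  [∀ x, TopologicalSpace (V x)] [TopologicalSpace (TotalSpace (Fin n → ℂ) V)]
  [FiberBundle (Fin n → ℂ) V] [VectorBundle ℂ (Fin n → ℂ) V] [ChartedSpace (Cm m) X]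
  {K : ∀ x, V x →ₗ[ℂ] V x →ₗ⋆[ℂ] ℂ} {h : ∀ x, V x →ₗ[ℂ] V x}
  {φ : OpenPartialHomeomorph X (Cm m)}

theorem endMatrix_smul (h : ∀ x, V x →ₗ[ℂ] V x) (ρ : X → ℝ) (e : Frame n V)
    [MemTrivializationAtlas e] {y : X} (hy : y ∈ e.baseSet) :
    endMatrix (fun x => (ρ x : ℂ) • h x) e y = ρ y • endMatrix h e y := by
  rw [endMatrix_eq _ e hy, endMatrix_eq _ e hy, map_smul, map_smul]
  exact Complex.coe_smul _ _

theorem IsVariation.smul (hh : IsVariation m n K h) {ρ : X → ℝ}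
    (hρ : ContMDiff 𝓘(ℝ, Cm m) 𝓘(ℝ, ℝ) ∞ ρ) : IsVariation m n K fun x => (ρ x : ℂ) • h x where
  selfAdjoint x u w := by
    rw [LinearMap.smul_apply, LinearMap.smul_apply, map_smul, LinearMap.smul_apply,
      hh.selfAdjoint, LinearMap.map_smulₛₗ, Complex.conj_ofReal]
  smooth e _ i j := by
    refine (hρ.contMDiffOn.smul (hh.smooth e i j)).congr fun x hx => ?_
    rw [endMatrix_smul h ρ e hx]
    rfl
  compactSupport := hh.compactSupport.of_isClosed_subset isClosed_closure
    (closure_mono fun x hx h0 => hx (by simp [h0]))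

variable [IsManifold 𝓘(ℂ, Cm m) ω X] [IsFlatBundle n V] (g : KahlerMetric m X)

theorem densityDeriv_add_gradientPairing_sum (hK : IsHermitianMetric m n K)
    (hh : IsVariation m n K h) {ι : Type*} {T : Finset ι} {k : ι → ∀ x, V x →ₗ[ℂ] V x}
    (hk : ∀ i ∈ T, IsVariation m n K (k i)) (hs : ∀ x, h x = ∑ i ∈ T, k i x) (x : X) :
    densityDeriv n g K h 0 x + gradientPairing n g K h x =
      ∑ i ∈ T, (densityDeriv n g K (k i) 0 x + gradientPairing n g K (k i) x) := by
  have hxe := FiberBundle.mem_baseSet_trivializationAt' (F := Fin n → ℂ) (E := V) x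
  have hx := mem_chart_source (Cm m) x
  have hφ := chart_mem_atlas (Cm m) x
  set φ := chartAt (Cm m) x
  set e := trivializationAt (Fin n → ℂ) V x
  have hz := φ.map_source hx
  have hze : φ.symm (φ x) ∈ e.baseSet := by rwa [φ.left_inv hx]
  have hE : ∀ y ∈ e.baseSet, endMatrix h e y = ∑ i ∈ T, endMatrix (k i) e y := fun y hy => by
    simp only [endMatrix_eq _ e hy, hs, map_sum]
  have hL : localEnd h e φ =ᶠ[𝓝 (φ x)] fun y => ∑ i ∈ T, localEnd (k i) e φ y := by
    filter_upwards [eventually_mem_frame e hz hze] with y hy using hE _ hy.2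
  have hD : fderiv ℝ (localEnd h e φ) (φ x) = ∑ i ∈ T, fderiv ℝ (localEnd (k i) e φ) (φ x) := by
    rw [hL.fderiv_eq, fderiv_fun_sum fun i hi =>
      ((hk i hi).contDiffAt hφ e hz hze).differentiableAt (by simp)]
  rw [Finset.sum_add_distrib, densityDeriv_eq g hK hh hφ e hx hxe,
    gradientPairing_eq g hK hh hφ e hx hxe, hE x hxe, hD]
  congr 1
  · rw [Finset.sum_congr rfl fun i hi => densityDeriv_eq g hK (hk i hi) hφ e hx hxe,
      ← Finset.mul_sum, ← metricTrace_sum]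
    congr 1
    refine metricTrace_congr fun v w => ?_
    rw [sum_apply, Finset.mul_sum, map_sum]
  · rw [Finset.sum_congr rfl fun i hi => gradientPairing_eq g hK (hk i hi) hφ e hx hxe,
      Finset.mul_sum, Matrix.trace_sum, Complex.re_sum]

variable [MeasurableSpace X] [BorelSpace X] [T2Space X]

theorem integrable_densityDeriv (hK : IsHermitianMetric m n K) (hh : IsVariation m n K h) :
    Integrable (densityDeriv n g K h 0) g.volume :=
  ((continuous_densityDeriv g hK hh).comp
    (Continuous.prodMk_right 0)).integrable_of_hasCompactSupport
    (HasCompactSupport.intro hh.compactSupport fun _ hx => densityDeriv_of_notMem g hK hh hx 0)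

theorem hasCompactSupport_gradientPairing (hK : IsHermitianMetric m n K)
    (hh : IsVariation m n K h) : HasCompactSupport (gradientPairing n g K h) :=
  HasCompactSupport.intro hh.compactSupport fun x hx => gradientPairing_of_eq_zero g hK hh
    (by by_contra h1; exact hx (subset_closure h1))

theorem integrable_gradientPairing (hK : IsHermitianMetric m n K) (hh : IsVariation m n K h) :
    Integrable (gradientPairing n g K h) g.volume :=
  (continuous_gradientPairing g hK hh).integrable_of_hasCompactSupport
    (hasCompactSupport_gradientPairing g hK hh)

/-- The derivative of the energy in the direction `h` is minus the integral of the pairing of `h`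
with the gradient; a partition of unity reduces this to variations supported in one chart. -/
theorem integral_densityDeriv [SecondCountableTopology X] (hK : IsHermitianMetric m n K)
    (hh : IsVariation m n K h) :
    ∫ x, densityDeriv n g K h 0 x ∂g.volume = -∫ x, gradientPairing n g K h x ∂g.volume := by
  have : LocallyCompactSpace X := ChartedSpace.locallyCompactSpace (Cm m) X
  have : SigmaCompactSpace X := sigmaCompactSpace_of_locallyCompact_secondCountable
  have : IsManifold 𝓘(ℝ, Cm m) ∞ X := .of_le (n := ω) (by simp)
  rw [eq_neg_iff_add_eq_zero, ← integral_add (integrable_densityDeriv g hK hh)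
    (integrable_gradientPairing g hK hh)]
  set S := closure {x | h x ≠ 0}
  obtain ⟨ρ, hρ⟩ := SmoothPartitionOfUnity.exists_isSubordinate 𝓘(ℝ, Cm m)
    (isClosed_closure : IsClosed S)
    (fun x : X => (chartAt (Cm m) x).source ∩ (trivializationAt (Fin n → ℂ) V x).baseSet)
    (fun x => (chartAt (Cm m) x).open_source.inter
      (trivializationAt (Fin n → ℂ) V x).open_baseSet)
    (fun x _ => mem_iUnion.2 ⟨x, mem_chart_source _ x,
      FiberBundle.mem_baseSet_trivializationAt' x⟩)
  have hfin := ρ.locallyFinite.finite_nonempty_inter_compact hh.compactSupport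
  set T := hfin.toFinset
  have hk : ∀ i, IsVariation m n K fun x => (ρ i x : ℂ) • h x := fun i =>
    hh.smul (ρ i).contMDiff
  have hs : ∀ x, h x = ∑ i ∈ T, (ρ i x : ℂ) • h x := fun x => by
    by_cases hx : h x = 0
    · simp [hx]
    · have hxS : x ∈ S := subset_closure hx
      have h1 := ρ.sum_eq_one hxS
      rw [finsum_eq_sum_of_support_subset (s := T) _ fun i hi => by
        simpa [T] using ⟨x, hi, hxS⟩] at h1
      rw [← Finset.sum_smul, ← Complex.ofReal_sum, h1, Complex.ofReal_one, one_smul]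
  simp only [densityDeriv_add_gradientPairing_sum g hK hh (fun i _ => hk i) hs]
  have hint : ∀ i ∈ T, Integrable (fun x => densityDeriv n g K (fun x => (ρ i x : ℂ) • h x) 0 x +
      gradientPairing n g K (fun x => (ρ i x : ℂ) • h x) x) g.volume := fun i _ =>
    (integrable_densityDeriv g hK (hk i)).add (integrable_gradientPairing g hK (hk i))
  rw [integral_finsetSum _ hint]
  refine Finset.sum_eq_zero fun i _ => ?_
  refine integral_densityDeriv_add_of_subset g hK (hk i) (chart_mem_atlas (Cm m) i)
    (trivializationAt (Fin n → ℂ) V i) (Subset.trans (closure_mono fun x hx => ?_) (hρ i))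
  intro h0
  exact hx (by simp [h0])

end Cutoff

/-! ### The gradient as a variation -/

section Gradient

variable {m n : ℕ}

/-- The Euler–Lagrange expression `½ g^{ab} ∂_a B_b` is self-adjoint with respect to `G`: passing to
the adjoint of `G ∂_a B_b = ∂_a ∂_b G - (∂_a G) G⁻¹ (∂_b G)` exchanges `a` and `b`. -/
theorem eulerLagrange_gram_mul {γ : Cm m → Cm m → Cm m → ℝ} {G : Cm m → Matrix (Fin n) (Fin n) ℂ}
    {z : Cm m} (hγ : IsInner (γ z))
    (hJ : ∀ v w, γ z (Complex.I • v) (Complex.I • w) = γ z v w)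
    (hG : ContDiffAt ℝ ∞ G z) (hu : IsUnit (G z).det) (hh : ∀ᶠ y in 𝓝 z, (G y).IsHermitian) :
    G z * eulerLagrange γ G z = (eulerLagrange γ G z)ᴴ * G z := by
  have hd : DifferentiableAt ℝ G z := hG.differentiableAt (by simp)
  have hd2 : DifferentiableAt ℝ (fderiv ℝ G) z :=
    (hG.fderiv_right (m := 1) (by norm_cast)).differentiableAt (by simp)
  have h0 : (G z)ᴴ = G z := hh.self_of_nhds
  have h1 : ∀ w v, (fderiv ℝ (fderiv ℝ G) z v w : Matrix (Fin n) (Fin n) ℂ)ᴴ =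
      fderiv ℝ (fderiv ℝ G) z v w := fun w v => by
    have hw : DifferentiableAt ℝ (fun y => fderiv ℝ G y w) z :=
      hd2.clm_apply (differentiableAt_const w)
    have hhw : ∀ᶠ y in 𝓝 z, (fderiv ℝ G y w : Matrix (Fin n) (Fin n) ℂ).IsHermitian := by
      filter_upwards [eventually_differentiableAt hG, hh.eventually_nhds] with y h2 h3
        using isHermitian_fderiv h2 h3 w
    rw [← fderiv_clm_const hd2]
    exact isHermitian_fderiv hw hhw v
  have hQ : ∀ v w : Cm m, (G z * fderiv ℝ (gaugeForm G) z v w)ᴴ =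
      G z * fderiv ℝ (gaugeForm G) z w v := fun v w => by
    have h2 : fderiv ℝ (fderiv ℝ G) z v w = fderiv ℝ (fderiv ℝ G) z w v :=
      (hG.isSymmSndFDerivAt (by simp; norm_cast)) v w
    rw [fderiv_gaugeForm hG hu, fderiv_gaugeForm hG hu]
    simp only [mul_sub, gaugeForm_apply, mul_assoc,
      Matrix.mul_nonsing_inv_cancel_left _ _ hu, Matrix.conjTranspose_sub,
      Matrix.conjTranspose_mul, Matrix.conjTranspose_nonsing_inv, h0, h1,
      (isHermitian_fderiv hd hh _).eq]
    rw [h2]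
  have h3 : G z * eulerLagrange γ G z = (1 / 2 : ℂ) •
      metricTrace (γ z) (fun v w => G z * fderiv ℝ (gaugeForm G) z v w) := by
    rw [eulerLagrange_eq hγ hJ hG hu, Matrix.mul_smul]
    congr 1
    exact (metricTrace_map (γ z) (fun v w => fderiv ℝ (gaugeForm G) z v w)
      (LinearMap.mulLeft ℝ (G z))).symm
  have h4 : (G z * eulerLagrange γ G z)ᴴ = G z * eulerLagrange γ G z := by
    rw [h3, Matrix.conjTranspose_smul]
    congr 1
    · simp
    · conv_rhs => rw [← metricTrace_swap hγ]
      simp only [metricTrace, Matrix.conjTranspose_sum, Matrix.conjTranspose_smul, hQ,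
        star_trivial]
  rw [← h4, Matrix.conjTranspose_mul, h0]

open scoped MatrixOrder ComplexOrder in
/-- If `A` is self-adjoint with respect to `G = CᴴC`, then `C A C⁻¹` is Hermitian, and `tr(A A)` is
the square of its Frobenius norm. -/
theorem re_trace_mul_self_nonneg {G A : Matrix (Fin n) (Fin n) ℂ} (hG : G.PosDef)
    (hA : G * A = Aᴴ * G) :
    0 ≤ (Matrix.trace (A * A)).re ∧ ((Matrix.trace (A * A)).re = 0 → A = 0) := by
  obtain ⟨C, hC, rfl⟩ := CStarAlgebra.isStrictlyPositive_iff_eq_star_mul_self.1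
    hG.isStrictlyPositive
  have hd : IsUnit C.det := (Matrix.isUnit_iff_isUnit_det _).1 hC
  have hd' : IsUnit (Cᴴ).det := by rw [Matrix.det_conjTranspose]; exact hd.star
  set N := C * A * C⁻¹ with hN
  have h1 : Nᴴ = N := by
    have h2 : Cᴴ * (C * A) = Cᴴ * ((C * A * C⁻¹)ᴴ * C) := by
      rw [Matrix.conjTranspose_mul, Matrix.conjTranspose_mul, Matrix.conjTranspose_nonsing_inv,
        mul_assoc, Matrix.mul_nonsing_inv_cancel_left _ _ hd']
      simpa only [mul_assoc, Matrix.star_eq_conjTranspose] using hA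
    have h3 := congrArg (fun M => (Cᴴ)⁻¹ * M * C⁻¹) h2
    simp only [Matrix.nonsing_inv_mul_cancel_left _ _ hd',
      Matrix.mul_nonsing_inv_cancel_right _ _ hd] at h3
    exact h3.symm
  have h2 : Matrix.trace (A * A) = Matrix.trace (N * Nᴴ) := by
    rw [h1, hN, show C * A * C⁻¹ * (C * A * C⁻¹) = C * (A * (C⁻¹ * C) * A) * C⁻¹ by
      simp only [mul_assoc], Matrix.nonsing_inv_mul _ hd, mul_one, Matrix.trace_mul_comm _ C⁻¹,
      Matrix.nonsing_inv_mul_cancel_left _ _ hd]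
  have h3 : 0 ≤ Matrix.trace (N * Nᴴ) := (Matrix.posSemidef_self_mul_conjTranspose N).trace_nonneg
  rw [h2]
  refine ⟨(Complex.le_def.1 h3).1, fun h4 => ?_⟩
  have h5 : Matrix.trace (N * Nᴴ) = 0 := Complex.ext h4 (Complex.le_def.1 h3).2.symm
  have h6 : N = 0 := Matrix.trace_mul_conjTranspose_self_eq_zero_iff.1 h5
  have h7 : A = C⁻¹ * N * C := by
    rw [hN, mul_assoc, Matrix.nonsing_inv_mul_cancel_right _ _ hd,
      Matrix.nonsing_inv_mul_cancel_left _ _ hd]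
  rw [h7, h6, mul_zero, zero_mul]

variable {X : Type*} [TopologicalSpace X]
  {V : X → Type*} [∀ x, AddCommGroup (V x)] [∀ x, Module ℂ (V x)]
  [∀ x, TopologicalSpace (V x)] [TopologicalSpace (TotalSpace (Fin n → ℂ) V)]
  [FiberBundle (Fin n → ℂ) V] [VectorBundle ℂ (Fin n → ℂ) V] [ChartedSpace (Cm m) X]
  {K : ∀ x, V x →ₗ[ℂ] V x →ₗ⋆[ℂ] ℂ} {h : ∀ x, V x →ₗ[ℂ] V x}
  {φ : OpenPartialHomeomorph X (Cm m)}

open Classical in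
/-- The endomorphism field with matrix `M` in the frame `e`, and `0` off the domain of `e`. -/
def frameEnd (e : Frame n V) [MemTrivializationAtlas e] (M : X → Matrix (Fin n) (Fin n) ℂ)
    (x : X) : V x →ₗ[ℂ] V x :=
  if hx : x ∈ e.baseSet then (frameEquiv e hx).symm.conj (Matrix.toLin' (M x)) else 0

theorem endMatrix_frameEnd (e : Frame n V) [MemTrivializationAtlas e]
    (M : X → Matrix (Fin n) (Fin n) ℂ) {x : X} (hx : x ∈ e.baseSet) :
    endMatrix (frameEnd e M) e x = M x := by
  have h1 : ∀ f : (Fin n → ℂ) →ₗ[ℂ] (Fin n → ℂ),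
      (frameEquiv e hx).conj ((frameEquiv e hx).symm.conj f) = f := fun f => by
    ext; simp
  rw [endMatrix_eq _ e hx, frameEnd, dif_pos hx, h1, LinearMap.toMatrix'_toLin']

theorem frameEnd_eq_zero (e : Frame n V) [MemTrivializationAtlas e]
    {M : X → Matrix (Fin n) (Fin n) ℂ} {x : X} (hx : M x = 0) : frameEnd e M x = 0 := by
  by_cases h : x ∈ e.baseSet
  · rw [frameEnd, dif_pos h, hx, map_zero, map_zero]
  · rw [frameEnd, dif_neg h]

/-- The converse of `IsVariation.gram_mul`, at a point. -/
theorem selfAdjoint_of_gram_mul (e : Frame n V) [MemTrivializationAtlas e] {x : X}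
    (hx : x ∈ e.baseSet)
    (hG : gram K e x * endMatrix h e x = (endMatrix h e x)ᴴ * gram K e x) (u w : V x) :
    K x (h x u) w = K x u (h x w) := by
  have h1 : ∀ a, h x ((frameEquiv e hx).symm a) = (frameEquiv e hx).symm (endMatrix h e x *ᵥ a) :=
    fun a => by
      rw [LinearEquiv.eq_symm_apply, endMatrix_eq h e hx, ← Matrix.toLin'_apply,
        Matrix.toLin'_toMatrix', LinearEquiv.conj_apply_apply]
  obtain ⟨a, rfl⟩ := (frameEquiv e hx).symm.surjective u
  obtain ⟨b, rfl⟩ := (frameEquiv e hx).symm.surjective w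
  rw [h1, h1, pairing_frame, pairing_frame, Matrix.mulVec_mulVec, hG, Matrix.star_mulVec,
    ← Matrix.mulVec_mulVec, Matrix.dotProduct_mulVec, Matrix.dotProduct_mulVec]

variable [IsFlatBundle n V]

/-- A smooth self-adjoint matrix supported in a compact subset `S` of the domain of one flat frame
defines an admissible variation. Smoothness of `M` is required only at the points of `S`. -/
theorem isVariation_frameEnd [T2Space X] (e : Frame n V) [MemTrivializationAtlas e]
    {M : X → Matrix (Fin n) (Fin n) ℂ} (hM : ∀ x, gram K e x * M x = (M x)ᴴ * gram K e x)
    {S : Set X} (hS : IsCompact S) (hSe : S ⊆ e.baseSet) (h0 : ∀ x ∉ S, M x = 0)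
    (hs : ∀ x ∈ S, ContMDiffAt 𝓘(ℝ, Cm m) 𝓘(ℝ, Matrix (Fin n) (Fin n) ℂ) ∞ M x) :
    IsVariation m n K (frameEnd e M) where
  selfAdjoint x u w := by
    by_cases hx : x ∈ e.baseSet
    · exact selfAdjoint_of_gram_mul e hx (by rw [endMatrix_frameEnd e M hx]; exact hM x) u w
    · simp [frameEnd, dif_neg hx]
  smooth e' _ i j x hx := by
    refine ContMDiffAt.contMDiffWithinAt ?_
    by_cases hxS : x ∈ S
    · obtain ⟨P, hP, hev⟩ := exists_frame_change e e' (hSe hxS) hx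
      have h1 : ContDiff ℝ ∞ fun A : Matrix (Fin n) (Fin n) ℂ => (P⁻¹ * A * P) i j :=
        (LinearMap.toContinuousLinearMap (Matrix.entryLinearMap ℝ ℂ i j)).contDiff.comp
          ((contDiff_const.mul contDiff_id).mul contDiff_const)
      refine (h1.contMDiff.contMDiffAt.comp x (hs x hxS)).congr_of_eventuallyEq ?_
      filter_upwards [hev, e.open_baseSet.mem_nhds (hSe hxS)] with y h2 h3
      rw [h2.2, endMatrix_frameEnd e M h3]
      rfl
    · refine (contMDiffAt_const (c := (0 : ℂ))).congr_of_eventuallyEq ?_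
      filter_upwards [hS.isClosed.isOpen_compl.mem_nhds hxS, e'.open_baseSet.mem_nhds hx]
        with y h1 h2
      rw [endMatrix_eq_zero _ e' h2 (frameEnd_eq_zero e (h0 y h1))]
      rfl
  compactSupport := hS.of_isClosed_subset isClosed_closure (closure_minimal (fun x hx => by
    by_contra h1
    exact hx (frameEnd_eq_zero e (h0 x h1))) hS.isClosed)

end Gradient

/-! ### Critical points and harmonic metrics -/

section Critical

variable {m n : ℕ} {X : Type*} [TopologicalSpace X] [ChartedSpace (Cm m) X]
  [IsManifold 𝓘(ℂ, Cm m) ω X]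

instance [MeasurableSpace X] [BorelSpace X] (g : KahlerMetric m X) :
    g.volume.IsOpenPosMeasure where
  open_pos U hU hne h0 := by
    obtain ⟨x, hx⟩ := hne
    set φ := chartAt (Cm m) x
    have hφ : φ ∈ atlas (Cm m) X := chart_mem_atlas (Cm m) x
    have hxs : x ∈ φ.source := mem_chart_source (Cm m) x
    have h1 : g.chartVolume φ U = 0 := by
      rw [← volume_restrict_source g hφ, Measure.restrict_apply hU.measurableSet]
      exact measure_mono_null inter_subset_left h0
    set W := φ.target ∩ φ.symm ⁻¹' U
    have hWo : IsOpen W := φ.isOpen_inter_preimage_symm hU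
    have hW : φ x ∈ W := ⟨φ.map_source hxs, by rwa [mem_preimage, φ.left_inv hxs]⟩
    have hm : AEMeasurable (fun z => ENNReal.ofReal (volumeDensity (g.coeff φ z)))
        ((realBasis m).addHaar.restrict W) :=
      (((continuousOn_volumeDensity g hφ).mono inter_subset_left).aemeasurable
        hWo.measurableSet).ennreal_ofReal
    rw [chartVolume_apply g hU.measurableSet, lintegral_eq_zero_iff' hm,
      Filter.EventuallyEq, ae_restrict_iff' hWo.measurableSet] at h1
    refine (hWo.measure_pos (realBasis m).addHaar ⟨_, hW⟩).ne' (measure_mono_null ?_ h1)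
    intro z hz h2
    have h3 := (g.isKahlerAt hφ hz.1).inner'.volumeDensity_pos
    exact (ENNReal.ofReal_pos.2 h3).ne' (h2 hz)

variable {V : X → Type*} [∀ x, AddCommGroup (V x)] [∀ x, Module ℂ (V x)]
  [∀ x, TopologicalSpace (V x)] [TopologicalSpace (TotalSpace (Fin n → ℂ) V)]
  [FiberBundle (Fin n → ℂ) V] [VectorBundle ℂ (Fin n → ℂ) V] [IsFlatBundle n V]
  {K : ∀ x, V x →ₗ[ℂ] V x →ₗ⋆[ℂ] ℂ} {h : ∀ x, V x →ₗ[ℂ] V x}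
  (g : KahlerMetric m X)

/-- If the gradient of the energy is orthogonal to all variations, it is zero: this follows by
testing with the Euler–Lagrange expression itself, cut off by a bump function. -/
theorem solvesEulerLagrange_of_integral_eq_zero [MeasurableSpace X] [BorelSpace X] [T2Space X]
    (hK : IsHermitianMetric m n K)
    (hint : ∀ h : ∀ x, V x →ₗ[ℂ] V x, IsVariation m n K h →
      ∫ x, gradientPairing n g K h x ∂g.volume = 0) : SolvesEulerLagrange n g K := by
  have : IsManifold 𝓘(ℝ, Cm m) ∞ X := .of_le (n := ω) (by simp)
  intro φ hφ e _ z hz hze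
  set x₀ := φ.symm z
  have hx₀ : x₀ ∈ φ.source := φ.map_target hz
  obtain ⟨χ, -, hχ⟩ := (SmoothBumpFunction.nhds_basis_tsupport (I := 𝓘(ℝ, Cm m)) x₀).mem_iff.1
    ((φ.open_source.inter e.open_baseSet).mem_nhds ⟨hx₀, hze⟩)
  set L := eulerLagrange (g.coeff φ) (localGram K e φ) with hL
  have hU : ∀ x ∈ tsupport χ, φ x ∈ φ.target ∧ φ.symm (φ x) ∈ e.baseSet := fun x hx =>
    ⟨φ.map_source (hχ hx).1, by rw [φ.left_inv (hχ hx).1]; exact (hχ hx).2⟩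
  have hself : ∀ x ∈ tsupport χ, gram K e x * L (φ x) = (L (φ x))ᴴ * gram K e x := fun x hx => by
    have hk := g.isKahlerAt hφ (hU x hx).1
    have h1 := eulerLagrange_gram_mul hk.inner' hk.invariant.self_of_nhds
      (hK.contDiffAt hφ e (hU x hx).1 (hU x hx).2) (hK.isUnit_det e (hU x hx).2)
      (hK.eventually_isHermitian e (hU x hx).1 (hU x hx).2)
    rwa [localGram, φ.left_inv (hχ hx).1] at h1
  set M : X → Matrix (Fin n) (Fin n) ℂ := fun x => χ x • L (φ x) with hM
  have hM0 : ∀ x ∉ tsupport χ, M x = 0 := fun x hx => by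
    simp only [hM, image_eq_zero_of_notMem_tsupport hx, zero_smul]
  have hh : IsVariation m n K (frameEnd e M) := by
    refine isVariation_frameEnd e (fun x => ?_) χ.hasCompactSupport
      (fun x hx => (hχ hx).2) hM0 fun x hx => ?_
    · by_cases hx : x ∈ tsupport χ
      · simp only [hM, Matrix.mul_smul, Matrix.conjTranspose_smul, star_trivial, Matrix.smul_mul,
          hself x hx]
      · simp [hM0 x hx]
    · have h1 : ContMDiffAt 𝓘(ℝ, Cm m) 𝓘(ℝ, Matrix (Fin n) (Fin n) ℂ) ∞ L (φ x) :=
        (contDiffAt_eulerLagrange (g.isKahlerAt hφ (hU x hx).1)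
          (hK.eventually_contDiffAt hφ e (hU x hx).1 (hU x hx).2)
          (hK.isUnit_det e (hU x hx).2)).contMDiffAt
      exact χ.contMDiff.contMDiffAt.smul (h1.comp x (contMDiffAt_chart hφ (hχ hx).1))
  have hpair : ∀ x ∈ tsupport χ, gradientPairing n g K (frameEnd e M) x =
      χ x * (Matrix.trace (L (φ x) * L (φ x))).re := fun x hx => by
    rw [gradientPairing_eq g hK hh hφ e (hχ hx).1 (hχ hx).2, endMatrix_frameEnd e M (hχ hx).2]
    simp only [hM, ← hL, Matrix.mul_smul, Matrix.trace_smul, Complex.smul_re, smul_eq_mul]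
  have hnn : 0 ≤ gradientPairing n g K (frameEnd e M) := fun x => by
    by_cases hx : x ∈ tsupport χ
    · rw [hpair x hx]
      exact mul_nonneg χ.nonneg (re_trace_mul_self_nonneg (hK.posDef e (hχ hx).2) (hself x hx)).1
    · rw [gradientPairing_of_eq_zero g hK hh (frameEnd_eq_zero e (hM0 x hx))]
      rfl
  have h0 : gradientPairing n g K (frameEnd e M) x₀ = 0 := by
    by_contra hne
    exact ((continuous_gradientPairing g hK hh).integral_pos_of_hasCompactSupport_nonneg_nonzero
      (μ := g.volume) (hasCompactSupport_gradientPairing g hK hh) hnn hne).ne' (hint _ hh)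
  have hx₀' : x₀ ∈ tsupport χ := subset_tsupport _ (by simp)
  rw [hpair _ hx₀', χ.eq_one, one_mul] at h0
  have h1 := (re_trace_mul_self_nonneg (hK.posDef e hze) (hself _ hx₀')).2 h0
  rwa [φ.right_inv hz] at h1

theorem SolvesEulerLagrange.gradientPairing_eq_zero (hs : SolvesEulerLagrange n g K)
    (h : ∀ x, V x →ₗ[ℂ] V x) (x : X) : gradientPairing n g K h x = 0 := by
  have hx := mem_chart_source (Cm m) x
  have h1 := hs _ (chart_mem_atlas (Cm m) x) (trivializationAt (Fin n → ℂ) V x)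
    (chartAt (Cm m) x x) ((chartAt (Cm m) x).map_source hx)
    (by rw [(chartAt (Cm m) x).left_inv hx]; exact FiberBundle.mem_baseSet_trivializationAt' x)
  simp [gradientPairing, h1]

theorem solvesEulerLagrange_iff_isHarmonicMetric (hK : IsHermitianMetric m n K) :
    SolvesEulerLagrange n g K ↔ IsHarmonicMetric n g K := by
  have key : ∀ (φ : OpenPartialHomeomorph X (Cm m)) (_ : φ ∈ atlas (Cm m) X) (e : Frame n V)
      [MemTrivializationAtlas e], ∀ z ∈ φ.target, φ.symm z ∈ e.baseSet →
      ∀ u : Cm m → Fin n → ℂ, ContDiff ℝ ∞ u →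
        Lam (g.coeff φ z) (pseudoCurvature (localGram K e φ) u z) =
          (-Complex.I / 2 : ℂ) • (eulerLagrange (g.coeff φ) (localGram K e φ) z *ᵥ u z) :=
    fun φ hφ e _ z hz hze u hu =>
      Lam_pseudoCurvature (g.isKahlerAt hφ hz).inner' (g.isKahlerAt hφ hz).invariant.self_of_nhds
        (hK.contDiffAt hφ e hz hze) (hK.isUnit_det e hze) hu.contDiffAt
  constructor
  · intro hs φ hφ e _ z hz hze u hu
    rw [key φ hφ e z hz hze u hu, hs φ hφ e z hz hze, Matrix.zero_mulVec, smul_zero]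
  · intro hs φ hφ e _ z hz hze
    ext i j
    have h1 := hs φ hφ e z hz hze (fun _ => Pi.single j 1) contDiff_const
    rw [key φ hφ e z hz hze _ contDiff_const] at h1
    have h2 := (smul_eq_zero.1 h1).resolve_left (by simp)
    rw [Matrix.mulVec_single_one] at h2
    exact congrFun h2 i

theorem hasDerivAt_energy_gradient [MeasurableSpace X] [BorelSpace X] [T2Space X]
    [SecondCountableTopology X] (hK : IsHermitianMetric m n K)
    (hh : IsVariation m n K h) {A : Set X} (hSA : closure {x | h x ≠ 0} ⊆ A)
    (hA : IntegrableOn (energyDensity n g K) A g.volume) :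
    HasDerivAt (fun t : ℝ => energy n g (expVariation n K h t) A)
      (-∫ x, gradientPairing n g K h x ∂g.volume) 0 := by
  rw [← integral_densityDeriv g hK hh]
  exact hasDerivAt_energy g hK hh hSA hA

theorem isCriticalPoint_iff_solvesEulerLagrange [MeasurableSpace X] [BorelSpace X] [T2Space X]
    [SecondCountableTopology X] (hK : IsHermitianMetric m n K) :
    IsCriticalPoint n g K ↔ SolvesEulerLagrange n g K := by
  constructor
  · intro hc
    refine solvesEulerLagrange_of_integral_eq_zero g hK fun h hh => ?_
    have hA : IntegrableOn (energyDensity n g K) (closure {x | h x ≠ 0}) g.volume :=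
      (continuous_energyDensity g hK).continuousOn.integrableOn_compact hh.compactSupport
    have h1 := (hasDerivAt_energy_gradient g hK hh Subset.rfl hA).unique
      (hc h hh _ isClosed_closure.measurableSet Subset.rfl hA)
    simpa using h1
  · intro hs h hh A _ hSA hA
    have h1 := hasDerivAt_energy_gradient g hK hh hSA hA
    simpa only [hs.gradientPairing_eq_zero, integral_zero, neg_zero] using h1

end Critical

end FlatKahler

end

theorem proposition1 {m n : ℕ} {X : Type*} [TopologicalSpace X] [T2Space X]
    [SecondCountableTopology X] [ChartedSpace (FlatKahler.Cm m) X]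
    [IsManifold 𝓘(ℂ, FlatKahler.Cm m) ω X] [MeasurableSpace X] [BorelSpace X]
    (g : FlatKahler.KahlerMetric m X)
    {V : X → Type*} [∀ x, AddCommGroup (V x)] [∀ x, Module ℂ (V x)]
    [∀ x, TopologicalSpace (V x)] [TopologicalSpace (TotalSpace (Fin n → ℂ) V)]
    [FiberBundle (Fin n → ℂ) V] [VectorBundle ℂ (Fin n → ℂ) V] [FlatKahler.IsFlatBundle n V]
    (K : ∀ x, V x →ₗ[ℂ] V x →ₗ⋆[ℂ] ℂ) (hK : FlatKahler.IsHermitianMetric m n K) :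
    LocallyIntegrable (FlatKahler.energyDensity n g K) g.volume ∧
    (∀ h : ∀ x, V x →ₗ[ℂ] V x, FlatKahler.IsVariation m n K h →
      (∀ t : ℝ, FlatKahler.IsHermitianMetric m n (FlatKahler.expVariation n K h t)) ∧
      ∀ A : Set X, MeasurableSet A → closure {x | h x ≠ 0} ⊆ A →
        IntegrableOn (FlatKahler.energyDensity n g K) A g.volume →
        HasDerivAt (fun t : ℝ => FlatKahler.energy n g (FlatKahler.expVariation n K h t) A)
          (-∫ x, FlatKahler.gradientPairing n g K h x ∂g.volume) 0) ∧
    (FlatKahler.IsCriticalPoint n g K ↔ FlatKahler.SolvesEulerLagrange n g K) ∧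
    (FlatKahler.SolvesEulerLagrange n g K ↔ FlatKahler.IsHarmonicMetric n g K) :=
  ⟨(FlatKahler.continuous_energyDensity g hK).locallyIntegrable,
    fun _ hh => ⟨hK.expVariation hh, fun _ _ hSA hA =>
      FlatKahler.hasDerivAt_energy_gradient g hK hh hSA hA⟩,
    FlatKahler.isCriticalPoint_iff_solvesEulerLagrange g hK,
    FlatKahler.solvesEulerLagrange_iff_isHarmonicMetric g hK⟩
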